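/- \textbf{The nearest common ancestors problem on an incremental tree.} A rooted tree $T$, initially consisting of the single node $0$, undergoes an on-line sequence of the following operations: \begin{itemize} \item $add\_leaf(x,y)$: make the new node $y$ a leaf of $T$, with parent the existing node $x$; \item $add\_root(y)$: make the new node $y$ the root of $T$, with the old root as its only child; \item $ca(x,y)$: for existing nodes $x,y$, report their characteristic ancestors in the current tree, i.e. the ordered triple $(a,a_x,a_y)$, where $a$ is the nearest common ancestor of $x$ and $y$ (every node being an ancestor of itself) and, for $z\in\{x,y\}$, $a_z$ is $a$ if $z=a$, and otherwise is the child of $a$ that is an ancestor of $z$. \end{itemize} Nodes are named $0,1,2,\dots$ in the order in which they are created. For a sequence of operations let $m$ be the number of its $ca$ operations and $n$ the number of nodes of the final tree (one more than the number of $add\_leaf$ and $add\_root$ operations), and put $\ell(n)=1+\lfloor\log_2 n\rfloor$. \textbf{Corollary.} There are a single random access machine program and a constant $C$ such that every legal sequence of operations, with parameters $m$ and $n$ as above, is processed on-line and each $ca$ query is answered correctly before the next operation is read, in total time at most $C\,(m+n\,\ell(n)^2)$, i.e. $O(m+n\log^2 n)$, initialization included, and using only the first $C\,n\,\ell(n)$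 memory cells, i.e. $O(n\log n)$ space. The machine works on nonnegative integers; its operations $+$, $-$ (truncated at $0$), $\times$, $\lfloor\cdot/\cdot\rfloor$, tests for zero, and direct or indirect memory accesses take one step each; its memory initially holds zeros; and all numbers that occur have at most $C\,\ell(n)$ bits, i.e. fit in words of $O(\log n)$ bits. The program does not depend on $n$ and is not given $n$, so $n$ need not be known in advance. -/

import Mathlib

/-! ### Rooted trees that grow by `add_leaf` and `add_root`, and characteristic ancestors -/

/-- A rooted tree, given by parent pointers, whose nodes are `0, …, card - 1`. -/
structure IncTree where
  card : ℕ
  root : ℕ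
  parent : ℕ → Option ℕ

namespace IncTree

/-- The tree whose only node is `0`. -/
def single : IncTree := ⟨1, 0, fun _ => none⟩

/-- `y` becomes a new leaf with parent `x`. -/
def addLeaf (T : IncTree) (x y : ℕ) : IncTree :=
  ⟨T.card + 1, T.root, Function.update T.parent y (some x)⟩

/-- `y` becomes the new root, and the old root becomes its only child. -/
def addRoot (T : IncTree) (y : ℕ) : IncTree :=
  ⟨T.card + 1, y, Function.update T.parent T.root (some y)⟩

/-- `a` is an ancestor of `x` (every node is an ancestor of itself). -/
def Anc (T : IncTree) (a x : ℕ) : Prop :=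
  Relation.ReflTransGen (fun u v => T.parent u = some v) x a

/-- `a` is the nearest common ancestor of `x` and `y`. -/
def IsNCA (T : IncTree) (x y a : ℕ) : Prop :=
  T.Anc a x ∧ T.Anc a y ∧ ∀ b, T.Anc b x → T.Anc b y → T.Anc b a

/-- `z` is the ancestor of `x` immediately preceding its ancestor `a`; if `x = a` then `z = a`. -/
def Precedes (T : IncTree) (x a z : ℕ) : Prop :=
  (x = a ∧ z = a) ∨ (x ≠ a ∧ T.Anc z x ∧ T.parent z = some a)

/-- `(a, ax, ay)` is the triple of characteristic ancestors `ca (x, y)`. -/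
def IsCA (T : IncTree) (x y a ax ay : ℕ) : Prop :=
  T.IsNCA x y a ∧ T.Precedes x a ax ∧ T.Precedes y a ay

end IncTree

/-- The operations of the nearest common ancestors problem on an incremental tree. -/
inductive NcaOp where
  | addLeaf (x y : ℕ)
  | addRoot (y : ℕ)
  | ca (x y : ℕ)

namespace NcaOp

/-- The effect of an operation on the tree. -/
def apply (T : IncTree) : NcaOp → IncTree
  | addLeaf x y => T.addLeaf x y
  | addRoot y => T.addRoot y
  | ca _ _ => T

/-- The operation may be performed on `T`: it refers to existing nodes, and a new node gets the
next unused number as its name. -/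
def Legal (T : IncTree) : NcaOp → Prop
  | addLeaf x y => x < T.card ∧ y = T.card
  | addRoot y => y = T.card
  | ca x y => x < T.card ∧ y < T.card

/-- Whether the operation is a query. -/
def isQuery : NcaOp → Bool
  | ca _ _ => true
  | _ => false

/-- Every operation of the sequence is legal at the time when it is performed, starting at `T`. -/
def LegalSeq (T : IncTree) : List NcaOp → Prop
  | [] => True
  | o :: os => o.Legal T ∧ LegalSeq (o.apply T) os

/-- The number of nodes of the tree that results from the sequence, starting at a single node. -/
def numNodes (os : List NcaOp) : ℕ := (os.foldl apply IncTree.single).card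

/-- The number of queries in the sequence. -/
def numQueries (os : List NcaOp) : ℕ := os.countP isQuery

end NcaOp

/-! ### A random access machine with a step count, a bounded memory and bounded words -/

namespace RAM

/-- The contents of the registers and of the memory cells. A program names its registers
explicitly, so it uses only a constant number of them; memory is addressed indirectly. -/
structure State where
  reg : ℕ → ℕ
  mem : ℕ → ℕ

/-- The arithmetic instructions: addition, truncated subtraction, multiplication, and division
with rounding down. -/
inductive Arith where
  | add | sub | mul | div

def Arith.eval : Arith → ℕ → ℕ → ℕ
  | add, a, b => a + b
  | sub, a, b => a - b
  | mul, a, b => a * b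
  | div, a, b => a / b

/-- Expressions: constants, registers, memory cells at a computed address, arithmetic. -/
inductive Exp where
  | const (k : ℕ)
  | reg (i : ℕ)
  | load (addr : Exp)
  | arith (o : Arith) (e f : Exp)

namespace Exp

def eval (s : State) : Exp → ℕ
  | const k => k
  | reg i => s.reg i
  | load e => s.mem (e.eval s)
  | arith o e f => o.eval (e.eval s) (f.eval s)

/-- The number of steps for an evaluation: one for every operator, constant and register. -/
def cost : Exp → ℕ
  | const _ => 1
  | reg _ => 1
  | load e => e.cost + 1
  | arith _ e f => e.cost + f.cost + 1

/-- The evaluation can be carried out on a machine with memory cells `0, …, A - 1` and words of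
`b` bits: all cells that are read exist, and all intermediate results fit into a word. -/
def Fits (A b : ℕ) (s : State) : Exp → Prop
  | const k => k < 2 ^ b
  | reg i => s.reg i < 2 ^ b
  | load e => e.Fits A b s ∧ e.eval s < A ∧ s.mem (e.eval s) < 2 ^ b
  | arith o e f => e.Fits A b s ∧ f.Fits A b s ∧ o.eval (e.eval s) (f.eval s) < 2 ^ b

end Exp

/-- Programs. A test succeeds when its expression has a nonzero value. -/
inductive Prog where
  | skip
  | assign (i : ℕ) (e : Exp)
  | store (addr e : Exp)
  | seq (p q : Prog)
  | ite (test : Exp) (p q : Prog)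
  | loop (test : Exp) (p : Prog)

/-- `Exec A b p s t s'`: on a machine with memory cells `0, …, A - 1` and words of `b` bits, the
program `p` started in state `s` halts after `t` steps in state `s'`, without ever addressing a
cell that does not exist and without overflow. -/
inductive Exec (A b : ℕ) : Prog → State → ℕ → State → Prop
  | skip (s : State) : Exec A b Prog.skip s 1 s
  | assign (s : State) (i : ℕ) (e : Exp) (he : e.Fits A b s) :
      Exec A b (Prog.assign i e) s (e.cost + 1)
        { s with reg := Function.update s.reg i (e.eval s) }
  | store (s : State) (d e : Exp) (hd : d.Fits A b s) (he : e.Fits A b s)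
      (hA : d.eval s < A) :
      Exec A b (Prog.store d e) s (d.cost + e.cost + 1)
        { s with mem := Function.update s.mem (d.eval s) (e.eval s) }
  | seq {s₀ s₁ s₂ : State} {p q : Prog} {t₁ t₂ : ℕ} (h₁ : Exec A b p s₀ t₁ s₁)
      (h₂ : Exec A b q s₁ t₂ s₂) :
      Exec A b (Prog.seq p q) s₀ (t₁ + t₂) s₂
  | ite_true {s s' : State} {e : Exp} {p q : Prog} {t : ℕ} (he : e.Fits A b s)
      (hv : e.eval s ≠ 0) (h : Exec A b p s t s') :
      Exec A b (Prog.ite e p q) s (e.cost + 1 + t) s'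
  | ite_false {s s' : State} {e : Exp} {p q : Prog} {t : ℕ} (he : e.Fits A b s)
      (hv : e.eval s = 0) (h : Exec A b q s t s') :
      Exec A b (Prog.ite e p q) s (e.cost + 1 + t) s'
  | loop_exit {s : State} {e : Exp} {p : Prog} (he : e.Fits A b s) (hv : e.eval s = 0) :
      Exec A b (Prog.loop e p) s (e.cost + 1) s
  | loop_step {s s₁ s₂ : State} {e : Exp} {p : Prog} {t₁ t₂ : ℕ} (he : e.Fits A b s)
      (hv : e.eval s ≠ 0) (h₁ : Exec A b p s t₁ s₁) (h₂ : Exec A b (Prog.loop e p) s₁ t₂ s₂) :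
      Exec A b (Prog.loop e p) s (e.cost + 1 + t₁ + t₂) s₂

/-- All registers and memory cells hold `0`. -/
def State.zero : State := ⟨fun _ => 0, fun _ => 0⟩

/-- Place the argument `v` of an operation in register `i`. -/
def State.put (s : State) (i v : ℕ) : State := { s with reg := Function.update s.reg i v }

end RAM

/-! ### On-line algorithms for the nearest common ancestors problem -/

/-- An algorithm: a fixed program for the initialization and for each kind of operation. It gets
no information besides the arguments of the operation at hand and what it has stored before. -/
structure NcaAlgorithm where
  init : RAM.Prog
  addLeaf : RAM.Prog
  addRoot : RAM.Prog
  ca : RAM.Prog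

namespace NcaAlgorithm

open RAM

/-- The program that performs an operation. -/
def code (P : NcaAlgorithm) : NcaOp → Prog
  | .addLeaf _ _ => P.addLeaf
  | .addRoot _ => P.addRoot
  | .ca _ _ => P.ca

/-- The arguments of an operation are passed in registers `0` and `1`. -/
def call (s : State) : NcaOp → State
  | .addLeaf x y => (s.put 0 x).put 1 y
  | .addRoot y => s.put 0 y
  | .ca x y => (s.put 0 x).put 1 y

/-- The result of a query is returned in registers `0`, `1` and `2`; it must be correct for the
current tree `T`. -/
def Correct (T : IncTree) (s : State) : NcaOp → Prop
  | .ca x y => T.IsCA x y (s.reg 0) (s.reg 1) (s.reg 2)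
  | _ => True

/-- With current tree `T` and machine state `s`, the algorithm processes the operations one after
the other, in `t` steps altogether, and answers every query correctly before it sees the next
operation. The machine has memory cells `0, …, A - 1` and words of `b` bits. -/
def Serves (P : NcaAlgorithm) (A b : ℕ) : IncTree → State → List NcaOp → ℕ → Prop
  | _, _, [], t => t = 0
  | T, s, o :: os, t => ∃ (t₁ t₂ : ℕ) (s' : State), t = t₁ + t₂ ∧
      Exec A b (P.code o) (call s o) t₁ s' ∧ Correct T s' o ∧
      P.Serves A b (o.apply T) s' os t₂

/-- The algorithm solves the problem for the given sequence of operations, starting with a tree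
of one node and with a memory full of zeros. The time `t` includes the initialization. -/
def Solves (P : NcaAlgorithm) (A b : ℕ) (os : List NcaOp) (t : ℕ) : Prop :=
  ∃ (t₁ t₂ : ℕ) (s : State), t = t₁ + t₂ ∧ Exec A b P.init State.zero t₁ s ∧
    P.Serves A b IncTree.single s os t₂

end NcaAlgorithm

set_option linter.unusedSimpArgs false

/-! ### Reasoning about programs of the random access machine -/

namespace RAM

/-! Reduction to range minima. The nodes form a list in preorder behind a sentinel `0`, whose key is
less than that of every node. A new leaf goes directly behind its parent, a new root directly behind
the sentinel. If x precedes y, the last element of least depth in the window behind x up to y is the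
child z, towards y, of the nearest common ancestor a (`Preorder.lastMin_spec`). The parent pointer
of z gives a, and a second window from a to x gives the child towards x
(`Preorder.precedes_of_lastMin`). Only differences of depths matter, so a new root takes over the
key of the sentinel, whose own key drops by one, and no other depth is touched.

Range minima in constant time. The elements carry increasing integer labels below `4 ^ J`, where `2
^ J ≤ 2 * N` for a list of length `N`. For every element and every `k < 2 * J`, two tables hold the
last minimum of that part of its aligned block of `2 ^ k` labels that ends with the element, or
comes after it. For labels at distance d and k = ⌊log d⌋, the blocks of length `2 ^ k` or those of
length `2 ^ (k + 1)` are adjacent (`div_adjacent`), so one suffix entry and one prefix entry cover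
the window (`lastMin_Ioc`).

Insertion. The new element has a greater key than its predecessor and at first shares its label. Its
row is then a copy of the predecessor's row, and among the old entries only the suffix entries of
the predecessor change (`preOk_insAt`, `sufOk_insAt`, `sufOk_insAt_self`). To break the tie, the
least j ≥ 1 is sought for which the block of length `4 ^ j` around it holds at most `2 ^ j`
elements, and these are spread with gaps `2 ^ j`. Only their entries with `k < 2 * j` have to be
recomputed (`Block.spread_same`), in time of order `2 ^ j * (j + 1)`.

Amortization. A block of length `4 ^ (i + 1)` weighs `i + 1` times the excess of its population over
`2 ^ i`. When level j = i + 2 is spread, some block of length `4 ^ (i + 1)` held more than `2 ^ (i +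
1)` elements, and afterwards each such block in the range holds at most `2 ^ i`; the drop pays for
the work (`pot_spread_drop`, `spread_cost`). An insertion adds at most `L * L` with L about log n
(`pot_insAt_le`), so all updates together take O(n log² n).

Space and growth. A level that fails has more than `2 ^ j` elements, which keeps `2 ^ J` below twice
the length of the list and the tables at O(n log n) cells. When J has to grow, the block to be
spread is the whole list, so every row is rewritten at the new width anyway and n need not be known.
-/

instance : Add Exp := ⟨Exp.arith .add⟩
instance : Sub Exp := ⟨Exp.arith .sub⟩
instance : Mul Exp := ⟨Exp.arith .mul⟩
instance : Div Exp := ⟨Exp.arith .div⟩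
instance (k : ℕ) : OfNat Exp k := ⟨Exp.const k⟩

/-- The arrays into which the memory is divided: linked list, labels, parents, the two parts of
the depth, a table of logarithms with the corresponding powers of two, and the two tables of
partial minima. -/
inductive Field where
  | nxt | prv | lab | par | dn | up | lg | pl | pre | suf
  deriving DecidableEq

namespace Field

/-- The arrays are interleaved with stride 16, so each can grow without a bound on its length being
known in advance. -/
def idx : Field → ℕ
  | nxt => 0 | prv => 1 | lab => 2 | par => 3 | dn => 4
  | up => 5 | lg => 6 | pl => 7 | pre => 8 | suf => 9

theorem idx_lt (f : Field) : f.idx < 16 := by cases f <;> decide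

theorem idx_inj {f g : Field} (h : f.idx = g.idx) : f = g := by
  cases f <;> cases g <;> first | rfl | (exact absurd h (by decide))

end Field

namespace State

/-- Entry `i` of the array `f`. -/
def fld (s : State) (f : Field) (i : ℕ) : ℕ := s.mem (16 * i + f.idx)

def setFld (s : State) (f : Field) (i v : ℕ) : State :=
  { s with mem := Function.update s.mem (16 * i + f.idx) v }

@[simp] theorem reg_put (s : State) (i j v : ℕ) :
    (s.put i v).reg j = if j = i then v else s.reg j := by
  simp [put, Function.update_apply]

@[simp] theorem fld_put (s : State) (i v : ℕ) (f : Field) (j : ℕ) :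
    (s.put i v).fld f j = s.fld f j := rfl

@[simp] theorem reg_setFld (s : State) (f : Field) (i v j : ℕ) :
    (s.setFld f i v).reg j = s.reg j := rfl

theorem fld_setFld (s : State) (f g : Field) (i v j : ℕ) :
    (s.setFld f i v).fld g j = if g = f ∧ j = i then v else s.fld g j := by
  have hf := f.idx_lt
  have hg := g.idx_lt
  simp only [fld, setFld, Function.update_apply]
  by_cases h : g = f ∧ j = i
  · rw [if_pos h, if_pos (by rw [h.1, h.2])]
  · rw [if_neg h, if_neg]
    intro h'
    have h1 : g.idx = f.idx := by omega
    exact h ⟨Field.idx_inj h1, by omega⟩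

@[simp] theorem fld_setFld_same (s : State) (f : Field) (i v j : ℕ) :
    (s.setFld f i v).fld f j = if j = i then v else s.fld f j := by
  simp [fld_setFld]

@[simp] theorem fld_setFld_ne (s : State) {f g : Field} (h : g ≠ f) (i v j : ℕ) :
    (s.setFld f i v).fld g j = s.fld g j := by
  simp [fld_setFld, h]

/-- All words of the state are smaller than `V`. -/
def Bdd (V : ℕ) (s : State) : Prop := (∀ i, s.reg i < V) ∧ ∀ a, s.mem a < V

theorem Bdd.fld {V : ℕ} {s : State} (h : s.Bdd V) (f : Field) (i : ℕ) : s.fld f i < V := h.2 _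

theorem Bdd.put {V : ℕ} {s : State} (h : s.Bdd V) {i v : ℕ} (hv : v < V) : (s.put i v).Bdd V := by
  refine ⟨fun j => ?_, h.2⟩
  rw [reg_put]
  split_ifs
  · exact hv
  · exact h.1 j

theorem Bdd.store {V : ℕ} {s : State} (h : s.Bdd V) {a v : ℕ} (hv : v < V) :
    State.Bdd V { s with mem := Function.update s.mem a v } := by
  refine ⟨h.1, fun j => ?_⟩
  simp only [Function.update_apply]
  split_ifs
  · exact hv
  · exact h.2 j

end State

/-! ### Word length: bounds for intermediate results. -/

namespace Exp

/-- Entry `a` of the array `f`. -/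
def ld (f : Field) (a : Exp) : Exp := load (16 * a + const f.idx)

/-- All cells that are read in the evaluation have addresses less than `A`. -/
def Safe (A : ℕ) (s : State) : Exp → Prop
  | const _ => True
  | reg _ => True
  | load e => e.Safe A s ∧ e.eval s < A
  | arith _ e f => e.Safe A s ∧ f.Safe A s

/-- This is the exponent in the bound `eval_lt_pow`. A loaded value is a stored word, hence less
than `V` however large the address expression is. -/
def size : Exp → ℕ
  | const _ => 1
  | reg _ => 1
  | load e => e.size
  | arith _ e f => e.size + f.size

/-- The expression has at most 16 leaves, and its constants are at most 16. -/
def small (e : Exp) : Bool := decide (e.size ≤ 16) && consts e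
where
  consts : Exp → Bool
    | const k => decide (k ≤ 16)
    | reg _ => true
    | load e => consts e
    | arith _ e f => consts e && consts f

@[simp] theorem eval_add (s : State) (e f : Exp) : (e + f).eval s = e.eval s + f.eval s := rfl
@[simp] theorem eval_sub (s : State) (e f : Exp) : (e - f).eval s = e.eval s - f.eval s := rfl
@[simp] theorem eval_mul (s : State) (e f : Exp) : (e * f).eval s = e.eval s * f.eval s := rfl
@[simp] theorem eval_div (s : State) (e f : Exp) : (e / f).eval s = e.eval s / f.eval s := rfl
@[simp] theorem eval_reg (s : State) (i : ℕ) : (reg i).eval s = s.reg i := rfl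
@[simp] theorem eval_const (s : State) (k : ℕ) : (const k).eval s = k := rfl
@[simp] theorem eval_ofNat (s : State) (k : ℕ) :
    (no_index (OfNat.ofNat k : Exp)).eval s = k := rfl
@[simp] theorem eval_ld (s : State) (f : Field) (e : Exp) :
    (ld f e).eval s = s.fld f (e.eval s) := rfl

variable {A : ℕ} {s : State}

@[simp] theorem safe_add {e f : Exp} : (e + f).Safe A s ↔ e.Safe A s ∧ f.Safe A s := Iff.rfl
@[simp] theorem safe_sub {e f : Exp} : (e - f).Safe A s ↔ e.Safe A s ∧ f.Safe A s := Iff.rfl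
@[simp] theorem safe_mul {e f : Exp} : (e * f).Safe A s ↔ e.Safe A s ∧ f.Safe A s := Iff.rfl
@[simp] theorem safe_div {e f : Exp} : (e / f).Safe A s ↔ e.Safe A s ∧ f.Safe A s := Iff.rfl
@[simp] theorem safe_reg (i : ℕ) : (reg i).Safe A s := trivial
@[simp] theorem safe_const (k : ℕ) : (const k).Safe A s := trivial
@[simp] theorem safe_ofNat (k : ℕ) :
    (no_index (OfNat.ofNat k : Exp)).Safe A s := trivial
@[simp] theorem safe_ld {f : Field} {e : Exp} :
    (ld f e).Safe (16 * A) s ↔ e.Safe (16 * A) s ∧ e.eval s < A := by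
  have h : (16 * e + const f.idx : Exp).eval s = 16 * e.eval s + f.idx := rfl
  have hf := f.idx_lt
  simp only [ld, Safe, h]
  constructor
  · rintro ⟨h1, h2⟩
    exact ⟨h1.1.2, by omega⟩
  · rintro ⟨h1, h2⟩
    exact ⟨⟨⟨trivial, h1⟩, trivial⟩, by omega⟩

theorem size_pos (e : Exp) : 0 < e.size := by
  induction e with
  | const _ => exact Nat.one_pos
  | reg _ => exact Nat.one_pos
  | load _ h => exact h
  | arith _ _ _ h _ => exact Nat.add_pos_left h _

/-- Sums are absorbed by products: u + v ≤ u * v once both powers are at least 2. Truncated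
subtraction and division do not exceed their first operand. -/
theorem eval_lt_pow {V : ℕ} (hV : 17 ≤ V) (hs : s.Bdd V) (e : Exp) (hc : small.consts e) :
    e.eval s < V ^ e.size := by
  induction e with
  | const k =>
    have : k ≤ 16 := by simpa [small.consts] using hc
    simp only [eval, size, pow_one]
    omega
  | reg i => simpa [eval, size] using hs.1 i
  | load e _ =>
    calc s.mem (e.eval s) < V := hs.2 _
      _ = V ^ 1 := (pow_one V).symm
      _ ≤ V ^ e.size := Nat.pow_le_pow_right (by omega) e.size_pos
  | arith o e f he hf =>
    simp only [small.consts, Bool.and_eq_true] at hc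
    have h1 := he hc.1
    have h2 := hf hc.2
    have h3 : V ^ 1 ≤ V ^ e.size := Nat.pow_le_pow_right (by omega) e.size_pos
    have h4 : V ^ 1 ≤ V ^ f.size := Nat.pow_le_pow_right (by omega) f.size_pos
    rw [pow_one] at h3 h4
    have h5 : V ^ e.size + V ^ f.size ≤ V ^ e.size * V ^ f.size := by nlinarith
    simp only [eval, size, pow_add]
    cases o with
    | add => exact lt_of_lt_of_le (Nat.add_lt_add h1 h2) h5
    | sub => exact lt_of_le_of_lt (Nat.sub_le _ _) (by nlinarith)
    | mul => exact Nat.mul_lt_mul'' h1 h2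
    | div => exact lt_of_le_of_lt (Nat.div_le_self _ _) (by nlinarith)

/-- Overflow of intermediate results thus never needs attention; what remains for each program is
that addresses exist and that the words it stores are less than `V`. -/
theorem fits_of_safe {V b : ℕ} (hV : 17 ≤ V) (hb : V ^ 16 ≤ 2 ^ b) (hs : s.Bdd V) (e : Exp)
    (he : e.small) (hA : e.Safe A s) : e.Fits A b s := by
  have key : ∀ e : Exp, e.size ≤ 16 → small.consts e → e.eval s < 2 ^ b := fun e h1 h2 =>
    lt_of_lt_of_le (eval_lt_pow hV hs e h2)
      (le_trans (Nat.pow_le_pow_right (by omega) h1) hb)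
  simp only [small, Bool.and_eq_true, decide_eq_true_eq] at he
  obtain ⟨h1, h2⟩ := he
  induction e with
  | const k => exact key _ h1 h2
  | reg i => exact key _ h1 h2
  | load e ih =>
    exact ⟨ih hA.1 h1 h2, hA.2, key (load e) h1 h2⟩
  | arith o e f he hf =>
    have h3 := h2
    simp only [small.consts, Bool.and_eq_true] at h3
    simp only [size] at h1
    exact ⟨he hA.1 (by omega) h3.1, hf hA.2 (by omega) h3.2, key (arith o e f) h1 h2⟩

end Exp

/-- The size of the arrays, a bound on the stored numbers, and the word length. -/
structure Cfg where
  A : ℕ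
  V : ℕ
  b : ℕ
  hV : 17 ≤ V
  hb : V ^ 16 ≤ 2 ^ b

/-! ### Proof rules for programs. -/

namespace Prog

/-- Assignment to entry `a` of the array `f`. -/
def sto (f : Field) (a e : Exp) : Prog := store (16 * a + Exp.const f.idx) e

/-- All expressions of the program are small. -/
def small : Prog → Bool
  | skip => true
  | assign _ e => e.small
  | store d e => d.small && e.small
  | seq p q => p.small && q.small
  | ite e p q => e.small && p.small && q.small
  | loop e p => e.small && p.small

/-- A bound for the number of steps of a program without loops. -/
def cst : Prog → ℕ
  | skip => 1
  | assign _ e => e.cost + 1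
  | store d e => d.cost + e.cost + 1
  | seq p q => p.cst + q.cst
  | ite e p q => e.cost + 1 + (p.cst + q.cst)
  | loop _ _ => 0

/-- A precondition of a program without loops for the postcondition `Q`. -/
def swp (M : Cfg) : Prog → (State → Prop) → State → Prop
  | skip, Q, s => Q s
  | assign i e, Q, s => e.Safe (16 * M.A) s ∧ e.eval s < M.V ∧ Q (s.put i (e.eval s))
  | store d e, Q, s => d.Safe (16 * M.A) s ∧ e.Safe (16 * M.A) s ∧ d.eval s < 16 * M.A ∧
      e.eval s < M.V ∧ Q { s with mem := Function.update s.mem (d.eval s) (e.eval s) }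
  | seq p q, Q, s => swp M p (swp M q Q) s
  | ite e p q, Q, s => e.Safe (16 * M.A) s ∧ (e.eval s ≠ 0 → swp M p Q s) ∧
      (e.eval s = 0 → swp M q Q s)
  | loop _ _, _, _ => False

theorem swp_sto {M : Cfg} {f : Field} {a e : Exp} {Q : State → Prop} {s : State} :
    (sto f a e).swp M Q s ↔ a.Safe (16 * M.A) s ∧ e.Safe (16 * M.A) s ∧ a.eval s < M.A ∧
      e.eval s < M.V ∧ Q (s.setFld f (a.eval s) (e.eval s)) := by
  have h : (16 * a + Exp.const f.idx : Exp).eval s = 16 * a.eval s + f.idx := rfl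
  have hf := f.idx_lt
  simp only [sto, swp, Exp.safe_add, Exp.safe_mul, Exp.safe_ofNat, Exp.safe_const, h, true_and,
    and_true]
  constructor
  · rintro ⟨h1, h2, h3, h4, h5⟩
    exact ⟨h1, h2, by omega, h4, h5⟩
  · rintro ⟨h1, h2, h3, h4, h5⟩
    exact ⟨h1, h2, by omega, h4, h5⟩

end Prog

/-- Started in a bounded state `s`, the program halts, and its running time and its final state
satisfy `Q`. -/
def Runs (M : Cfg) (p : Prog) (s : State) (Q : ℕ → State → Prop) : Prop :=
  s.Bdd M.V → ∃ t s', Exec (16 * M.A) M.b p s t s' ∧ s'.Bdd M.V ∧ Q t s'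

namespace Runs

variable {M : Cfg} {p q : Prog} {s : State} {Q : ℕ → State → Prop}

theorem mono {R : ℕ → State → Prop} (h : Runs M p s Q) (hR : ∀ t s', Q t s' → R t s') :
    Runs M p s R := fun hs => by
  obtain ⟨t, s', h1, h2, h3⟩ := h hs
  exact ⟨t, s', h1, h2, hR t s' h3⟩

theorem seq (h : Runs M p s fun t s' => Runs M q s' fun t' s'' => Q (t + t') s'') :
    Runs M (.seq p q) s Q := fun hs => by
  obtain ⟨t, s', h1, h2, h3⟩ := h hs
  obtain ⟨t', s'', h4, h5, h6⟩ := h3 h2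
  exact ⟨_, _, .seq h1 h4, h5, h6⟩

theorem of_bdd (h : s.Bdd M.V → Runs M p s Q) : Runs M p s Q := fun hs => h hs hs

/-- The proof obligations split: `small` and the bound `cst` are settled by evaluation, and only the
conditions collected in `swp` depend on the state. -/
theorem straight {R : State → Prop} (hp : p.small) (h : p.swp M R s) :
    Runs M p s fun t s' => t ≤ p.cst ∧ R s' := fun hs => by
  have fits : ∀ {e : Exp} {s : State}, s.Bdd M.V → e.small → e.Safe (16 * M.A) s →
      e.Fits (16 * M.A) M.b s := fun hs he h => Exp.fits_of_safe M.hV M.hb hs _ he h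
  induction p generalizing s R with
  | skip => exact ⟨_, _, .skip s, hs, le_rfl, h⟩
  | assign i e =>
    exact ⟨_, _, .assign s i e (fits hs hp h.1), hs.put h.2.1, le_rfl, h.2.2⟩
  | store d e =>
    simp only [Prog.small, Bool.and_eq_true] at hp
    exact ⟨_, _, .store s d e (fits hs hp.1 h.1) (fits hs hp.2 h.2.1) h.2.2.1,
      hs.store h.2.2.2.1, le_rfl, h.2.2.2.2⟩
  | seq p q ihp ihq =>
    simp only [Prog.small, Bool.and_eq_true] at hp
    obtain ⟨t, s', h1, h2, h3, h4⟩ := ihp hp.1 h hs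
    obtain ⟨t', s'', h5, h6, h7, h8⟩ := ihq hp.2 h4 h2
    exact ⟨_, _, .seq h1 h5, h6, Nat.add_le_add h3 h7, h8⟩
  | ite e p q ihp ihq =>
    simp only [Prog.small, Bool.and_eq_true] at hp
    by_cases he : e.eval s = 0
    · obtain ⟨t, s', h1, h2, h3, h4⟩ := ihq hp.2 (h.2.2 he) hs
      exact ⟨_, _, .ite_false (fits hs hp.1.1 h.1) he h1, h2,
        by simp only [Prog.cst]; omega, h4⟩
    · obtain ⟨t, s', h1, h2, h3, h4⟩ := ihp hp.1.2 (h.2.1 he) hs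
      exact ⟨_, _, .ite_true (fits hs hp.1.1 h.1) he h1, h2,
        by simp only [Prog.cst]; omega, h4⟩
  | loop e p => exact h.elim

theorem ite {e : Exp} (he : e.small) (hs : e.Safe (16 * M.A) s)
    (h1 : e.eval s ≠ 0 → Runs M p s fun t s' => Q (e.cost + 1 + t) s')
    (h2 : e.eval s = 0 → Runs M q s fun t s' => Q (e.cost + 1 + t) s') :
    Runs M (.ite e p q) s Q := fun hb => by
  have fits := Exp.fits_of_safe M.hV M.hb hb _ he hs
  by_cases h : e.eval s = 0
  · obtain ⟨t, s', h3, h4, h5⟩ := h2 h hb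
    exact ⟨_, _, .ite_false fits h h3, h4, h5⟩
  · obtain ⟨t, s', h3, h4, h5⟩ := h1 h hb
    exact ⟨_, _, .ite_true fits h h3, h4, h5⟩

/-- The rule for loops: `I m t s` is the invariant, where `m` decreases in each iteration and `t`
is the time spent so far. -/
theorem loop {e : Exp} (he : e.small) (I : ℕ → ℕ → State → Prop) {m : ℕ} (h0 : I m 0 s)
    (hsafe : ∀ m t s, I m t s → s.Bdd M.V → e.Safe (16 * M.A) s)
    (hstep : ∀ m t s, I m t s → s.Bdd M.V → e.eval s ≠ 0 →
      Runs M p s fun t' s' => ∃ m' < m, I m' (t + (e.cost + 1 + t')) s')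
    (hexit : ∀ m t s, I m t s → s.Bdd M.V → e.eval s = 0 → Q (t + (e.cost + 1)) s) :
    Runs M (.loop e p) s Q := by
  -- The time already spent is generalized, because the invariant speaks of the time since the loop
  -- was entered.
  suffices H : ∀ m t₀ s, I m t₀ s →
      Runs M (.loop e p) s fun t s' => Q (t₀ + t) s' from
    (H m 0 s h0).mono fun t s' h => by simpa using h
  intro m
  induction m using Nat.strong_induction_on with
  | _ m ih =>
    intro t₀ s hI hb
    have fits := Exp.fits_of_safe M.hV M.hb hb _ he (hsafe m t₀ s hI hb)
    by_cases h : e.eval s = 0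
    · exact ⟨_, _, .loop_exit fits h, hb, hexit m t₀ s hI hb h⟩
    · obtain ⟨t', s', h1, h2, m', hm, h3⟩ := hstep m t₀ s hI hb h hb
      obtain ⟨t'', s'', h4, h5, h6⟩ := ih m' hm _ s' h3 h2
      refine ⟨_, _, .loop_step fits h h1 h4, h5, ?_⟩
      show Q (t₀ + (e.cost + 1 + t' + t'')) s''
      rwa [show t₀ + (e.cost + 1 + t' + t'') = t₀ + (e.cost + 1 + t') + t'' by omega]

end Runs

end RAM

/-! ### Lists of elements with labels, and tables of partial minima -/

namespace Nca

/-- The sequence `f` with the new entry `v` immediately after position `i`. -/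
def insAt {α : Type*} (f : ℕ → α) (i : ℕ) (v : α) (q : ℕ) : α :=
  if q ≤ i then f q else if q = i + 1 then v else f (q - 1)

/-- The position after an insertion behind `i` of the entry that was at position `q`. -/
def shift (i q : ℕ) : ℕ := if q ≤ i then q else q + 1

/-! ### Insertion into a sequence. -/

section insAt

variable {α : Type*} (f : ℕ → α) (i : ℕ) (v : α)

@[simp] theorem insAt_shift (q : ℕ) : insAt f i v (shift i q) = f q := by
  unfold insAt shift
  split_ifs <;> first | rfl | omega

@[simp] theorem insAt_new : insAt f i v (i + 1) = v := by simp [insAt]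

theorem insAt_of_le {q : ℕ} (h : q ≤ i) : insAt f i v q = f q := by simp [insAt, h]

theorem shift_of_le {i q : ℕ} (h : q ≤ i) : shift i q = q := by simp [shift, h]

theorem shift_of_lt {i q : ℕ} (h : i < q) : shift i q = q + 1 := by simp [shift, Nat.not_le.2 h]

theorem eq_new_or_shift (i q : ℕ) : q = i + 1 ∨ ∃ q', q = shift i q' := by
  rcases lt_trichotomy q (i + 1) with h | h | h
  · exact .inr ⟨q, by rw [shift_of_le]; omega⟩
  · exact .inl h
  · exact .inr ⟨q - 1, by rw [shift_of_lt] <;> omega⟩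

theorem shift_lt_shift {i p q : ℕ} : shift i p < shift i q ↔ p < q := by
  unfold shift; split_ifs <;> omega

theorem shift_le_shift {i p q : ℕ} : shift i p ≤ shift i q ↔ p ≤ q := by
  unfold shift; split_ifs <;> omega

theorem shift_lt_succ {i q N : ℕ} (hi : i < N) : shift i q < N + 1 ↔ q < N := by
  unfold shift; split_ifs <;> omega

end insAt

/-- `el` lists the elements `0, …, N - 1`, beginning with `0`. -/
structure Order (N : ℕ) (el : ℕ → ℕ) : Prop where
  zero : el 0 = 0
  lt : ∀ i < N, el i < N
  inj : ∀ i < N, ∀ j < N, el i = el j → i = j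
  surj : ∀ e < N, ∃ i < N, el i = e

namespace Order

variable {N : ℕ} {el : ℕ → ℕ}

theorem ne_zero (h : Order N el) {i : ℕ} (hi : i < N) (h0 : 0 < i) : el i ≠ 0 := fun h' =>
  absurd (h.inj i hi 0 (by omega) (h'.trans h.zero.symm)) (by omega)

theorem ins (h : Order N el) {i : ℕ} (hi : i < N) : Order (N + 1) (insAt el i N) where
  zero := by rw [insAt_of_le _ _ _ (Nat.zero_le i), h.zero]
  lt q hq := by
    rcases eq_new_or_shift i q with rfl | ⟨q, rfl⟩
    · simp
    · rw [insAt_shift]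
      exact (h.lt q ((shift_lt_succ hi).1 hq)).trans (Nat.lt_succ_self N)
  inj p hp q hq hpq := by
    rcases eq_new_or_shift i p with rfl | ⟨p, rfl⟩ <;>
    rcases eq_new_or_shift i q with rfl | ⟨q, rfl⟩
    · rfl
    · have := h.lt q ((shift_lt_succ hi).1 hq)
      rw [insAt_new, insAt_shift] at hpq
      omega
    · have := h.lt p ((shift_lt_succ hi).1 hp)
      rw [insAt_new, insAt_shift] at hpq
      omega
    · rw [insAt_shift, insAt_shift] at hpq
      rw [h.inj p ((shift_lt_succ hi).1 hp) q ((shift_lt_succ hi).1 hq) hpq]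
  surj e he := by
    rcases Nat.lt_succ_iff_lt_or_eq.1 he with he | rfl
    · obtain ⟨q, hq, rfl⟩ := h.surj e he
      exact ⟨shift i q, (shift_lt_succ hi).2 hq, insAt_shift ..⟩
    · exact ⟨i + 1, by omega, insAt_new ..⟩

end Order

/-- `p` is the last position in `S` at which the key is minimal. -/
def LastMin (el : ℕ → ℕ) (key : ℕ → ℤ) (S : Set ℕ) (p : ℕ) : Prop :=
  p ∈ S ∧ ∀ q ∈ S, key (el p) ≤ key (el q) ∧ (p < q → key (el p) < key (el q))

namespace LastMin

variable {el : ℕ → ℕ} {key : ℕ → ℤ} {S T : Set ℕ} {p q : ℕ}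

theorem singleton : LastMin el key {p} p :=
  ⟨rfl, by rintro q rfl; exact ⟨le_rfl, fun h => absurd h (lt_irrefl _)⟩⟩

theorem union_right (hS : LastMin el key S p) (hT : LastMin el key T q)
    (hST : ∀ s ∈ S, ∀ t ∈ T, s < t) (h : key (el q) ≤ key (el p)) :
    LastMin el key (S ∪ T) q := by
  refine ⟨.inr hT.1, ?_⟩
  rintro r (hr | hr)
  · exact ⟨h.trans (hS.2 r hr).1, fun h' => absurd (hST r hr q hT.1) h'.not_gt⟩
  · exact hT.2 r hr

theorem union_left (hS : LastMin el key S p) (hT : LastMin el key T q)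
    (h : key (el p) < key (el q)) : LastMin el key (S ∪ T) p := by
  refine ⟨.inl hS.1, ?_⟩
  rintro r (hr | hr)
  · exact hS.2 r hr
  · have := h.trans_le (hT.2 r hr).1
    exact ⟨this.le, fun _ => this⟩

end LastMin

/-- The positions up to `i` in the same block of length `2 ^ k` as `i`. -/
def preSet (a : ℕ → ℕ) (i k : ℕ) : Set ℕ := {q | q ≤ i ∧ a q / 2 ^ k = a i / 2 ^ k}

/-- The positions after `i` in the same block of length `2 ^ k` as `i`. -/
def sufSet (N : ℕ) (a : ℕ → ℕ) (i k : ℕ) : Set ℕ :=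
  {q | i < q ∧ q < N ∧ a q / 2 ^ k = a i / 2 ^ k}

/-- The entry names the element, not its position, so that an insertion elsewhere need not touch it.
-/
def PreOk (el : ℕ → ℕ) (key : ℕ → ℤ) (a : ℕ → ℕ) (i k z : ℕ) : Prop :=
  ∃ p, LastMin el key (preSet a i k) p ∧ z = el p

/-- The value `0` can mark an empty set: element `0` has position 0, which lies behind no position.
-/
def SufOk (N : ℕ) (el : ℕ → ℕ) (key : ℕ → ℤ) (a : ℕ → ℕ) (i k z : ℕ) : Prop :=
  (sufSet N a i k = ∅ ∧ z = 0) ∨ ∃ p, LastMin el key (sufSet N a i k) p ∧ z = el p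

/-! ### Recurrences for partial minima, and changes that leave them valid. -/

section step

variable {N : ℕ} {el : ℕ → ℕ} {key : ℕ → ℤ} {a b : ℕ → ℕ} {i k z : ℕ}

theorem preOk_lt (h : PreOk el key a i k z) (ho : Order N el) (hi : i < N) : z < N := by
  obtain ⟨p, ⟨⟨hp, -⟩, -⟩, rfl⟩ := h
  exact ho.lt p (by omega)

theorem sufOk_lt (h : SufOk N el key a i k z) (ho : Order N el) (hi : i < N) : z < N := by
  rcases h with ⟨-, rfl⟩ | ⟨p, ⟨⟨-, hp, -⟩, -⟩, rfl⟩
  · omega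
  · exact ho.lt p hp

theorem preOk_new (h : ∀ q < i, a q / 2 ^ k ≠ a i / 2 ^ k) : PreOk el key a i k (el i) := by
  refine ⟨i, ?_, rfl⟩
  have : preSet a i k = {i} := by
    ext q
    simp only [preSet, Set.mem_ofPred_eq, Set.mem_singleton_iff]
    constructor
    · rintro ⟨h1, h2⟩
      by_contra h3
      exact h q (by omega) h2
    · rintro rfl
      exact ⟨le_rfl, rfl⟩
  rw [this]
  exact .singleton

theorem preOk_succ (h : a i / 2 ^ k = a (i + 1) / 2 ^ k) (hz : PreOk el key a i k z) :
    PreOk el key a (i + 1) k (if key (el (i + 1)) ≤ key z then el (i + 1) else z) := by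
  obtain ⟨p, hp, rfl⟩ := hz
  have : preSet a (i + 1) k = preSet a i k ∪ {i + 1} := by
    ext q
    simp only [preSet, Set.mem_ofPred_eq, Set.mem_union, Set.mem_singleton_iff, h]
    constructor
    · rintro ⟨h1, h2⟩
      by_cases h3 : q = i + 1
      · exact .inr h3
      · exact .inl ⟨by omega, h2⟩
    · rintro (⟨h1, h2⟩ | rfl)
      · exact ⟨by omega, h2⟩
      · exact ⟨le_rfl, rfl⟩
  unfold PreOk
  rw [this]
  split_ifs with hk
  · refine ⟨i + 1, hp.union_right .singleton ?_ hk, rfl⟩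
    rintro s ⟨hs, -⟩ t rfl
    omega
  · exact ⟨p, hp.union_left .singleton (not_le.1 hk), rfl⟩

theorem sufOk_new (h : ∀ q, i < q → q < N → a q / 2 ^ k ≠ a i / 2 ^ k) :
    SufOk N el key a i k 0 := by
  refine .inl ⟨?_, rfl⟩
  ext q
  simp only [sufSet, Set.mem_ofPred_eq, Set.mem_empty_iff_false, iff_false]
  rintro ⟨h1, h2, h3⟩
  exact h q h1 h2 h3

theorem sufOk_pred (ho : Order N el) (hi : i + 1 < N) (h : a (i + 1) / 2 ^ k = a i / 2 ^ k)
    (hz : SufOk N el key a (i + 1) k z) :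
    SufOk N el key a i k
      (if z ≠ 0 ∧ key z ≤ key (el (i + 1)) then z else el (i + 1)) := by
  have : sufSet N a i k = {i + 1} ∪ sufSet N a (i + 1) k := by
    ext q
    simp only [sufSet, Set.mem_ofPred_eq, Set.mem_union, Set.mem_singleton_iff, h]
    constructor
    · rintro ⟨h1, h2⟩
      by_cases h3 : q = i + 1
      · exact .inl h3
      · exact .inr ⟨by omega, h2⟩
    · rintro (rfl | ⟨h1, h2⟩)
      · exact ⟨by omega, hi, h⟩
      · exact ⟨by omega, h2⟩
  unfold SufOk at *
  rw [this]
  refine .inr ?_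
  rcases hz with ⟨he, rfl⟩ | ⟨p, hp, rfl⟩
  · rw [he, Set.union_empty]
    exact ⟨i + 1, .singleton, by simp⟩
  · have h0 : el p ≠ 0 := ho.ne_zero hp.1.2.1 (by have := hp.1.1; omega)
    by_cases hk : key (el p) ≤ key (el (i + 1))
    · rw [if_pos ⟨h0, hk⟩]
      refine ⟨p, LastMin.singleton.union_right hp ?_ hk, rfl⟩
      rintro s rfl t ⟨ht, -⟩
      exact ht
    · rw [if_neg fun h => hk h.2]
      exact ⟨i + 1, LastMin.singleton.union_left hp (not_le.1 hk), rfl⟩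

/-- The labels enter only through the question which positions share the block of `i`; this is what
lets entries survive a relabelling. -/
theorem PreOk.congr (hz : PreOk el key a i k z)
    (h : ∀ q ≤ i, b q / 2 ^ k = b i / 2 ^ k ↔ a q / 2 ^ k = a i / 2 ^ k) :
    PreOk el key b i k z := by
  have : preSet b i k = preSet a i k := by
    ext q
    exact and_congr_right fun hq => h q hq
  rwa [PreOk, this]

theorem SufOk.congr (hz : SufOk N el key a i k z)
    (h : ∀ q < N, b q / 2 ^ k = b i / 2 ^ k ↔ a q / 2 ^ k = a i / 2 ^ k) :
    SufOk N el key b i k z := by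
  have : sufSet N b i k = sufSet N a i k := by
    ext q
    exact and_congr_right fun _ => and_congr_right fun hq => h q hq
  rwa [SufOk, this]

/-- Meant for a new root, which lowers the key of the sentinel. That key was the strict minimum
before, so no comparison changes its outcome. -/
theorem LastMin.congr_key {key' : ℕ → ℤ} {S : Set ℕ} {p : ℕ} (h : LastMin el key S p)
    (hS : ∀ q ∈ S, q < N) (ho : Order N el) (h0 : key' 0 ≤ key 0)
    (hpos : ∀ e, 0 < e → e < N → key' e = key e ∧ key 0 < key e) : LastMin el key' S p := by
  refine ⟨h.1, fun q hq => ?_⟩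
  have hp := hS p h.1
  have hq' := hS q hq
  obtain ⟨h1, h2⟩ := h.2 q hq
  rcases Nat.eq_zero_or_pos p with rfl | hp0 <;> rcases Nat.eq_zero_or_pos q with rfl | hq0
  · exact ⟨le_rfl, fun h => absurd h (lt_irrefl _)⟩
  · have h3 := hpos (el q) (Nat.pos_of_ne_zero (ho.ne_zero hq' hq0)) (ho.lt q hq')
    rw [ho.zero]
    constructor <;> intros <;> omega
  · have h3 := hpos (el p) (Nat.pos_of_ne_zero (ho.ne_zero hp hp0)) (ho.lt p hp)
    rw [ho.zero] at h1
    omega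
  · have h3 := hpos (el p) (Nat.pos_of_ne_zero (ho.ne_zero hp hp0)) (ho.lt p hp)
    have h4 := hpos (el q) (Nat.pos_of_ne_zero (ho.ne_zero hq' hq0)) (ho.lt q hq')
    rw [h3.1, h4.1]
    exact ⟨h1, h2⟩

theorem PreOk.congr_key {key' : ℕ → ℤ} (hz : PreOk el key a i k z) (hi : i < N)
    (ho : Order N el) (h0 : key' 0 ≤ key 0)
    (hpos : ∀ e, 0 < e → e < N → key' e = key e ∧ key 0 < key e) : PreOk el key' a i k z := by
  obtain ⟨p, hp, rfl⟩ := hz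
  exact ⟨p, hp.congr_key (fun q hq => lt_of_le_of_lt hq.1 hi) ho h0 hpos, rfl⟩

theorem SufOk.congr_key {key' : ℕ → ℤ} (hz : SufOk N el key a i k z)
    (ho : Order N el) (h0 : key' 0 ≤ key 0)
    (hpos : ∀ e, 0 < e → e < N → key' e = key e ∧ key 0 < key e) :
    SufOk N el key' a i k z := by
  rcases hz with h | ⟨p, hp, rfl⟩
  · exact .inl h
  · exact .inr ⟨p, hp.congr_key (fun q hq => hq.2.1) ho h0 hpos, rfl⟩

end step

/-! ### Effect on the tables of a new element that shares its predecessor's label. -/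

section insertion

variable {N : ℕ} {el : ℕ → ℕ} {key : ℕ → ℤ} {a b : ℕ → ℕ} {i q k z : ℕ}

/-- A prefix that acquires the new element also contains its predecessor, which has the same label
and a smaller key, so the minimum stays where it was. -/
theorem preOk_insAt (hE : key (el i) < key N)
    (hb : ∀ q < N, b (shift i q) = a q) (hb' : b (i + 1) = a i) (hq : q < N)
    (hz : PreOk el key a q k z) : PreOk (insAt el i N) key b (shift i q) k z := by
  obtain ⟨p, ⟨⟨h1, h2⟩, h3⟩, rfl⟩ := hz
  refine ⟨shift i p, ⟨⟨shift_le_shift.2 h1, ?_⟩, ?_⟩, (insAt_shift ..).symm⟩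
  · rwa [hb p (by omega), hb q hq]
  · rintro r ⟨hr1, hr2⟩
    rw [hb q hq] at hr2
    rw [insAt_shift]
    rcases eq_new_or_shift i r with rfl | ⟨r, rfl⟩
    · rw [hb'] at hr2
      have hiq : i ≤ q := by
        by_contra hlt
        rw [shift_of_le (by omega)] at hr1
        omega
      have := (h3 i ⟨hiq, hr2⟩).1.trans_lt hE
      rw [insAt_new]
      exact ⟨this.le, fun _ => this⟩
    · rw [shift_le_shift] at hr1
      rw [hb r (by omega)] at hr2
      rw [insAt_shift, shift_lt_shift]
      exact h3 r ⟨hr1, hr2⟩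

theorem preOk_insAt_new (hi : i < N) (hE : key (el i) < key N)
    (hb : ∀ q < N, b (shift i q) = a q) (hb' : b (i + 1) = a i)
    (hz : PreOk el key a i k z) : PreOk (insAt el i N) key b (i + 1) k z := by
  have hi' : b i = a i := by simpa [shift_of_le] using hb i hi
  have h1 := preOk_insAt hE hb hb' hi hz
  rw [shift_of_le le_rfl] at h1
  have h2 := preOk_succ (by rw [hi', hb']) h1
  obtain ⟨p, hp, rfl⟩ := hz
  have h3 := (hp.2 i ⟨le_rfl, rfl⟩).1.trans_lt hE
  rwa [insAt_new, if_neg h3.not_ge] at h2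

/-- Here `q'` is either the image of `q` or the new position with `q = i`. The hypothesis `hnew`
states that a suffix acquires the new element only if it already contained the predecessor, whose
key is smaller. -/
theorem sufOk_transfer {q' : ℕ} (hi : i < N)
    (hb : ∀ q < N, b (shift i q) = a q) (hq' : b q' = a q) (hqq : ∀ r, q' < shift i r ↔ q < r)
    (hnew : q' < i + 1 → b (i + 1) / 2 ^ k = b q' / 2 ^ k →
      i ∈ sufSet N a q k ∧ key (el i) < key N)
    (hz : SufOk N el key a q k z) : SufOk (N + 1) (insAt el i N) key b q' k z := by
  have hmem : ∀ r, shift i r ∈ sufSet (N + 1) b q' k ↔ r ∈ sufSet N a q k := by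
    intro r
    simp only [sufSet, Set.mem_ofPred_eq, shift_lt_succ hi, hqq, hq']
    refine and_congr_right fun _ => and_congr_right fun hr => ?_
    rw [hb r hr]
  rcases hz with ⟨h1, rfl⟩ | ⟨p, ⟨h1, h2⟩, rfl⟩
  · refine .inl ⟨?_, rfl⟩
    by_contra hne
    obtain ⟨r, hr⟩ := Set.nonempty_iff_ne_empty.2 hne
    rcases eq_new_or_shift i r with rfl | ⟨r, rfl⟩
    · have := (hnew hr.1 hr.2.2).1
      rw [h1] at this
      exact this
    · have := (hmem r).1 hr
      rw [h1] at this
      exact this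
  · refine .inr ⟨shift i p, ⟨(hmem p).2 h1, fun r hr => ?_⟩, (insAt_shift ..).symm⟩
    rw [insAt_shift]
    rcases eq_new_or_shift i r with rfl | ⟨r, rfl⟩
    · obtain ⟨h3, h4⟩ := hnew hr.1 hr.2.2
      have := (h2 i h3).1.trans_lt h4
      rw [insAt_new]
      exact ⟨this.le, fun _ => this⟩
    · rw [insAt_shift, shift_lt_shift]
      exact h2 r ((hmem r).1 hr)

theorem sufOk_insAt (hi : i < N) (hE : key (el i) < key N)
    (hb : ∀ q < N, b (shift i q) = a q) (hb' : b (i + 1) = a i) (hq : q < N) (hqi : q ≠ i)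
    (hz : SufOk N el key a q k z) :
    SufOk (N + 1) (insAt el i N) key b (shift i q) k z := by
  refine sufOk_transfer hi hb (hb q hq) (fun r => shift_lt_shift) (fun h1 h2 => ?_) hz
  rw [hb', hb q hq] at h2
  refine ⟨⟨?_, hi, h2⟩, hE⟩
  by_contra h
  rw [shift_of_lt (by omega)] at h1
  omega

theorem sufOk_insAt_new (hi : i < N)
    (hb : ∀ q < N, b (shift i q) = a q) (hb' : b (i + 1) = a i)
    (hz : SufOk N el key a i k z) :
    SufOk (N + 1) (insAt el i N) key b (i + 1) k z := by
  refine sufOk_transfer hi hb hb' (fun r => ?_) (fun h => absurd h (lt_irrefl _)) hz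
  unfold shift
  split_ifs <;> omega

/-- The suffix of the predecessor is the exception: it acquires the new element without containing
the predecessor. The entry follows from the recurrence `sufOk_pred` in the longer list. -/
theorem sufOk_insAt_self (ho : Order N el) (hi : i < N)
    (hb : ∀ q < N, b (shift i q) = a q) (hb' : b (i + 1) = a i)
    (hz : SufOk N el key a i k z) :
    SufOk (N + 1) (insAt el i N) key b i k (if z ≠ 0 ∧ key z ≤ key N then z else N) := by
  have hi' : b i = a i := by simpa [shift_of_le] using hb i hi
  have h := sufOk_pred (i := i) (k := k) (ho.ins hi) (by omega) (by rw [hi', hb'])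
    (sufOk_insAt_new hi hb hb' hz)
  rwa [insAt_new] at h

end insertion

/-! ### A window as the union of a suffix and a prefix of adjacent blocks. -/

section query

variable {N : ℕ} {el : ℕ → ℕ} {key : ℕ → ℤ} {a : ℕ → ℕ} {i j k w z z' : ℕ}

/-- At a distance between `2 ^ k` and `2 ^ (k + 1)` the block numbers differ by 1 or 2, and numbers
that differ by 2 have halves that differ by exactly 1. -/
theorem div_adjacent {x y k : ℕ} (h1 : x + 2 ^ k ≤ y) (h2 : y < x + 2 ^ (k + 1)) :
    (y / 2 ^ k = x / 2 ^ k + 1) ∨ (y / 2 ^ k = x / 2 ^ k + 2 ∧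
      y / 2 ^ (k + 1) = x / 2 ^ (k + 1) + 1) := by
  have hpos : 0 < 2 ^ k := by positivity
  have h3 : x / 2 ^ k + 1 ≤ y / 2 ^ k := by
    rw [← Nat.add_div_right x hpos]
    exact Nat.div_le_div_right h1
  have h4 : y / 2 ^ k ≤ x / 2 ^ k + 2 := by
    have : y / 2 ^ k ≤ (x + 2 * 2 ^ k) / 2 ^ k :=
      Nat.div_le_div_right (by rw [pow_succ] at h2; omega)
    rwa [Nat.add_mul_div_right _ _ hpos] at this
  have h5 : ∀ z, z / 2 ^ (k + 1) = z / 2 ^ k / 2 := fun z => by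
    rw [pow_succ, Nat.div_div_eq_div_mul]
  rw [h5, h5]
  omega

/-- Labels increase, so between two adjacent blocks there is no room for a third: each position of
the window shares the block of `i` or that of `j`. -/
theorem lastMin_Ioc (hmono : ∀ p q, p < q → q < N → a p < a q) (hij : i < j) (hj : j < N)
    (hadj : a j / 2 ^ k = a i / 2 ^ k + 1) (ho : Order N el)
    (hz : SufOk N el key a i k z) (hz' : PreOk el key a j k z') :
    ∃ p, LastMin el key {q | i < q ∧ q ≤ j} p ∧
      (if z = 0 ∨ key z' ≤ key z then z' else z) = el p := by
  have hset : {q | i < q ∧ q ≤ j} = sufSet N a i k ∪ preSet a j k := by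
    ext q
    simp only [sufSet, preSet, Set.mem_ofPred_eq, Set.mem_union]
    have mono : ∀ p q, p ≤ q → q < N → a p / 2 ^ k ≤ a q / 2 ^ k := fun p q hpq hq => by
      rcases Nat.eq_or_lt_of_le hpq with rfl | h
      · exact le_rfl
      · exact Nat.div_le_div_right (hmono p q h hq).le
    constructor
    · rintro ⟨h1, h2⟩
      have h3 := mono i q h1.le (by omega)
      have h4 := mono q j h2 hj
      by_cases h5 : a q / 2 ^ k = a i / 2 ^ k
      · exact .inl ⟨h1, by omega, h5⟩
      · exact .inr ⟨h2, by omega⟩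
    · rintro (⟨h1, h2, h3⟩ | ⟨h1, h2⟩)
      · refine ⟨h1, ?_⟩
        by_contra h
        have := mono j q (by omega) h2
        omega
      · refine ⟨?_, h1⟩
        by_contra h
        have := mono q i (by omega) (by omega)
        omega
  rw [hset]
  obtain ⟨p', hp', rfl⟩ := hz'
  rcases hz with ⟨h1, rfl⟩ | ⟨p, hp, rfl⟩
  · rw [h1, Set.empty_union]
    exact ⟨p', hp', by simp⟩
  · have h0 : el p ≠ 0 := ho.ne_zero hp.1.2.1 (by have := hp.1.1; omega)
    by_cases hk : key (el p') ≤ key (el p)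
    · refine ⟨p', hp.union_right hp' ?_ hk, by simp [hk]⟩
      rintro s ⟨h1, h2, h3⟩ t ⟨h4, h5⟩
      by_contra h
      have hts : a t ≤ a s := by
        rcases Nat.eq_or_lt_of_le (not_lt.1 h) with rfl | h
        · exact le_rfl
        · exact (hmono t s h h2).le
      have := Nat.div_le_div_right (c := 2 ^ k) hts
      omega
    · exact ⟨p, hp.union_left hp' (not_le.1 hk), by simp [hk, h0]⟩

end query

/-! ### Spreading the labels in a block -/

/-- The positions `l, …, r` are those whose label is in block `g` of length `4 ^ j`, and they are
few enough to be spread. -/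
structure Block (N : ℕ) (a : ℕ → ℕ) (j g l r : ℕ) : Prop where
  mem : ∀ q < N, (l ≤ q ∧ q ≤ r ↔ a q / 2 ^ (2 * j) = g)
  le : l ≤ r
  lt : r < N

/-- The labels after the elements at positions `l, …, r` were spread over block `g`. -/
def spread (a : ℕ → ℕ) (j g l r q : ℕ) : ℕ :=
  if l ≤ q ∧ q ≤ r then g * 2 ^ (2 * j) + (q - l) * 2 ^ j else a q

namespace Block

variable {N : ℕ} {a : ℕ → ℕ} {j g l r : ℕ}

/-- At most `2 ^ j` elements with gaps `2 ^ j` occupy offsets below `2 ^ j * 2 ^ j`, so no label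
leaves the block. -/
theorem spread_div (h : Block N a j g l r) (hc : r + 1 - l ≤ 2 ^ j) {q : ℕ} (hq : q < N) :
    spread a j g l r q / 2 ^ (2 * j) = a q / 2 ^ (2 * j) := by
  unfold spread
  split_ifs with hlr
  · rw [(h.mem q hq).1 hlr, Nat.add_comm, Nat.add_mul_div_right _ _ (by positivity),
      Nat.div_eq_of_lt, zero_add]
    rw [two_mul, pow_add]
    exact Nat.mul_lt_mul_of_pos_right (by omega) (by positivity)
  · rfl

theorem spread_div_of_le (h : Block N a j g l r) (hc : r + 1 - l ≤ 2 ^ j) {q k : ℕ} (hq : q < N)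
    (hk : 2 * j ≤ k) : spread a j g l r q / 2 ^ k = a q / 2 ^ k := by
  obtain ⟨d, rfl⟩ := Nat.exists_eq_add_of_le hk
  rw [pow_add, ← Nat.div_div_eq_div_mul, ← Nat.div_div_eq_div_mul, h.spread_div hc hq]

/-- This limits the repair of the tables. Labels move only inside one block of length `4 ^ j`, which
is invisible from a position outside it and at all block lengths from `4 ^ j` on. -/
theorem spread_same (h : Block N a j g l r) (hc : r + 1 - l ≤ 2 ^ j) {i q k : ℕ} (hi : i < N)
    (hq : q < N) (hik : i < l ∨ r < i ∨ 2 * j ≤ k) :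
    spread a j g l r q / 2 ^ k = spread a j g l r i / 2 ^ k ↔ a q / 2 ^ k = a i / 2 ^ k := by
  by_cases hk : 2 * j ≤ k
  · rw [h.spread_div_of_le hc hq hk, h.spread_div_of_le hc hi hk]
  have hi' : ¬(l ≤ i ∧ i ≤ r) := by omega
  have hsi : spread a j g l r i = a i := if_neg hi'
  by_cases hq' : l ≤ q ∧ q ≤ r
  · have up : ∀ x y : ℕ, x / 2 ^ k = y / 2 ^ k → x / 2 ^ (2 * j) = y / 2 ^ (2 * j) := by
      intro x y hxy
      obtain ⟨d, hd⟩ := Nat.exists_eq_add_of_le (not_le.1 hk).le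
      rw [hd, pow_add, ← Nat.div_div_eq_div_mul, ← Nat.div_div_eq_div_mul, hxy]
    have hne : a q / 2 ^ (2 * j) ≠ a i / 2 ^ (2 * j) := by
      rw [(h.mem q hq).1 hq']
      exact fun h' => hi' ((h.mem i hi).2 h'.symm)
    refine iff_of_false (fun h' => hne ?_) fun h' => hne (up _ _ h')
    rw [← h.spread_div hc hq, ← h.spread_div hc hi]
    exact up _ _ h'
  · rw [hsi, spread, if_neg hq']

/-- The hypothesis tolerates ties inside the block, because the new element shares a label with its
predecessor until the block is spread. -/
theorem spread_lt (h : Block N a j g l r) (hc : r + 1 - l ≤ 2 ^ j)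
    (hmono : ∀ p q, p < q → q < N → (a p < a q ∨ l ≤ p ∧ q ≤ r)) {p q : ℕ} (hpq : p < q)
    (hq : q < N) : spread a j g l r p < spread a j g l r q := by
  by_cases hlr : l ≤ p ∧ q ≤ r
  · rw [spread, spread, if_pos (by omega), if_pos (by omega)]
    exact Nat.add_lt_add_left (Nat.mul_lt_mul_of_pos_right (by omega) (by positivity)) _
  · by_cases hp' : l ≤ p ∧ p ≤ r ∨ l ≤ q ∧ q ≤ r
    · have hne : a p / 2 ^ (2 * j) ≠ a q / 2 ^ (2 * j) := by
        intro heq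
        rcases hp' with h1 | h1
        · exact hlr ⟨h1.1, ((h.mem q hq).2 (heq ▸ (h.mem p (by omega)).1 h1)).2⟩
        · exact hlr ⟨((h.mem p (by omega)).2 (heq ▸ (h.mem q hq).1 h1)).1, h1.2⟩
      have hle : a p / 2 ^ (2 * j) ≤ a q / 2 ^ (2 * j) :=
        Nat.div_le_div_right ((hmono p q hpq hq).resolve_right hlr).le
      rw [← h.spread_div hc hq, ← h.spread_div hc (show p < N by omega)] at *
      by_contra h'
      have := Nat.div_le_div_right (c := 2 ^ (2 * j)) (not_lt.1 h')
      omega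
    · rw [spread, spread, if_neg (by omega), if_neg (by omega)]
      exact (hmono p q hpq hq).resolve_right hlr

end Block

/-- Adding `2 ^ j` to a multiple of `2 ^ j` leads to a new block of length `2 ^ k` just if the
result is a multiple of `2 ^ k`. -/
theorem div_add_pow {j k m : ℕ} (h : (m * 2 ^ j + 2 ^ j) % 2 ^ k ≠ 0) :
    (m * 2 ^ j + 2 ^ j) / 2 ^ k = m * 2 ^ j / 2 ^ k := by
  rcases le_or_gt k j with hkj | hkj
  · obtain ⟨d, rfl⟩ := Nat.exists_eq_add_of_le hkj
    exact absurd (Nat.mod_eq_zero_of_dvd ⟨m * 2 ^ d + 2 ^ d, by rw [pow_add]; ring⟩) h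
  · obtain ⟨d, rfl⟩ := Nat.exists_eq_add_of_lt hkj
    have e : m * 2 ^ j + 2 ^ j = 2 ^ j * (m + 1) := by ring
    have e' : 2 ^ (j + d + 1) = 2 ^ j * 2 ^ (d + 1) := by rw [← pow_add]; ring_nf
    rw [e, e'] at h
    rw [e, e', mul_comm m, Nat.mul_div_mul_left _ _ (by positivity),
      Nat.mul_div_mul_left _ _ (by positivity), Nat.succ_div, if_neg, add_zero]
    intro hdvd
    exact h (Nat.mod_eq_zero_of_dvd (Nat.mul_dvd_mul_left _ hdvd))

theorem div_lt_of_mod_eq_zero {x y k : ℕ} (hxy : x < y) (h : y % 2 ^ k = 0) :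
    x / 2 ^ k < y / 2 ^ k := by
  rw [Nat.div_lt_iff_lt_mul (by positivity), Nat.div_mul_cancel (Nat.dvd_of_mod_eq_zero h)]
  exact hxy

end Nca

/-! ### The potential that pays for spreading labels -/

namespace Nca

open Finset in
/-- The number of positions whose label is in block `q` of length `4 ^ i`. -/
def cnt (N : ℕ) (a : ℕ → ℕ) (i q : ℕ) : ℕ := #{p ∈ range N | a p / 2 ^ (2 * i) = q}

/-- The potential: crowded blocks have weight. -/
def pot (L Q N : ℕ) (a : ℕ → ℕ) : ℕ :=
  ∑ i ∈ Finset.range L, (i + 1) * ∑ q ∈ Finset.range Q, (cnt N a (i + 1) q - 2 ^ i)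

theorem cnt_eq_card_Icc {N : ℕ} {a : ℕ → ℕ} {j g l r : ℕ} (h : Block N a j g l r) :
    cnt N a j g = r + 1 - l := by
  rw [cnt, ← Nat.card_Icc]
  congr 1
  ext q
  simp only [Finset.mem_filter, Finset.mem_range, Finset.mem_Icc]
  constructor
  · rintro ⟨h1, h2⟩
    exact (h.mem q h1).2 h2
  · intro h1
    have := h.lt
    exact ⟨by omega, (h.mem q (by omega)).1 h1⟩

theorem cnt_insAt_le {N : ℕ} {a b : ℕ → ℕ} {x i q : ℕ} (hx : x < N)
    (hb : ∀ q < N, b (shift x q) = a q) (hb' : b (x + 1) = a x) :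
    cnt (N + 1) b i q ≤ cnt N a i q + if a x / 2 ^ (2 * i) = q then 1 else 0 := by
  classical
  have hsub : (Finset.range (N + 1)).filter (fun p => b p / 2 ^ (2 * i) = q) ⊆
      ((Finset.range N).filter (fun p => a p / 2 ^ (2 * i) = q)).image (shift x) ∪
        if a x / 2 ^ (2 * i) = q then {x + 1} else ∅ := by
    intro p hp
    simp only [Finset.mem_filter, Finset.mem_range] at hp
    rw [Finset.mem_union]
    rcases eq_new_or_shift x p with rfl | ⟨p, rfl⟩
    · rw [hb'] at hp
      rw [if_pos hp.2]
      exact .inr (Finset.mem_singleton_self _)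
    · have h1 := (shift_lt_succ hx).1 hp.1
      rw [hb p h1] at hp
      exact .inl (Finset.mem_image_of_mem _ (by simp [h1, hp.2]))
  refine (Finset.card_le_card hsub).trans ((Finset.card_union_le _ _).trans ?_)
  refine Nat.add_le_add Finset.card_image_le ?_
  split_ifs <;> simp

/-- On each level only the block of the new label gains an element, which costs `i + 1`, and these
weights add up to at most `L * L`. -/
theorem pot_insAt_le {L Q N : ℕ} {a b : ℕ → ℕ} {x : ℕ} (hx : x < N)
    (hb : ∀ q < N, b (shift x q) = a q) (hb' : b (x + 1) = a x) :
    pot L Q (N + 1) b ≤ pot L Q N a + L * L := by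
  have h1 : ∀ i, ∑ q ∈ Finset.range Q, (cnt (N + 1) b (i + 1) q - 2 ^ i) ≤
      ∑ q ∈ Finset.range Q, (cnt N a (i + 1) q - 2 ^ i) + 1 := by
    intro i
    calc _ ≤ ∑ q ∈ Finset.range Q, ((cnt N a (i + 1) q - 2 ^ i) +
          if a x / 2 ^ (2 * (i + 1)) = q then 1 else 0) := by
          refine Finset.sum_le_sum fun q _ => ?_
          have := cnt_insAt_le (i := i + 1) (q := q) hx hb hb'
          omega
      _ ≤ _ := by
          rw [Finset.sum_add_distrib, Finset.sum_ite_eq]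
          split_ifs <;> omega
  have h2 : ∑ i ∈ Finset.range L, (i + 1) ≤ L * L := by
    calc ∑ i ∈ Finset.range L, (i + 1) ≤ ∑ _i ∈ Finset.range L, L :=
          Finset.sum_le_sum fun i hi => by
            have := Finset.mem_range.1 hi
            omega
      _ = L * L := by simp
  calc pot L Q (N + 1) b ≤ ∑ i ∈ Finset.range L, ((i + 1) *
        ∑ q ∈ Finset.range Q, (cnt N a (i + 1) q - 2 ^ i) + (i + 1)) := by
        refine Finset.sum_le_sum fun i _ => ?_
        have := Nat.mul_le_mul_left (i + 1) (h1 i)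
        rwa [Nat.mul_add, mul_one] at this
    _ ≤ _ := by
        rw [Finset.sum_add_distrib]
        exact Nat.add_le_add_left h2 _

/-- A set of numbers with small pairwise differences is small. -/
theorem card_le_of_sub_lt {S : Finset ℕ} {d : ℕ} (h : ∀ p ∈ S, ∀ q ∈ S, q < p + d) :
    S.card ≤ d := by
  rcases S.eq_empty_or_nonempty with rfl | hS
  · simp
  · have hsub : S ⊆ Finset.Ico (S.min' hS) (S.min' hS + d) := fun q hq =>
      Finset.mem_Ico.2 ⟨S.min'_le q hq, h _ (S.min'_mem hS) q hq⟩
    simpa using Finset.card_le_card hsub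

theorem cnt_congr {N : ℕ} {a b : ℕ → ℕ} {i q : ℕ}
    (h : ∀ p < N, a p / 2 ^ (2 * i) = q ↔ b p / 2 ^ (2 * i) = q) : cnt N a i q = cnt N b i q := by
  unfold cnt
  congr 1
  exact Finset.filter_congr fun p hp => h p (Finset.mem_range.1 hp)

section spread

variable {N : ℕ} {a : ℕ → ℕ} {j g l r : ℕ}

theorem div_pow_div {x i d : ℕ} : x / 2 ^ (2 * i) / 2 ^ (2 * d) = x / 2 ^ (2 * (i + d)) := by
  rw [Nat.div_div_eq_div_mul, ← pow_add, mul_add]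

/-- With gaps `2 ^ j`, a block of length `4 ^ (i + 1)` holds at most `4 ^ (i + 1) / 2 ^ j` of the
spread elements, and this is at most `2 ^ i` as soon as `i + 2 ≤ j`. -/
theorem cnt_spread_le (h : Block N a j g l r) (hc : r + 1 - l ≤ 2 ^ j) {i q : ℕ}
    (hi : i + 2 ≤ j) (hq : q / 2 ^ (2 * (j - (i + 1))) = g) :
    cnt N (spread a j g l r) (i + 1) q ≤ 2 ^ i := by
  have hmem : ∀ p < N, spread a j g l r p / 2 ^ (2 * (i + 1)) = q → l ≤ p ∧ p ≤ r := by
    intro p hp hpq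
    rw [← hpq, div_pow_div, show i + 1 + (j - (i + 1)) = j by omega] at hq
    rwa [h.mem p hp, ← h.spread_div hc hp]
  refine card_le_of_sub_lt fun p hp p' hp' => ?_
  simp only [Finset.mem_filter, Finset.mem_range] at hp hp'
  have h1 := hmem p hp.1 hp.2
  have h2 := hmem p' hp'.1 hp'.2
  have h3 : spread a j g l r p' < spread a j g l r p + 2 ^ (2 * (i + 1)) := by
    by_contra h'
    have h4 := Nat.div_le_div_right (c := 2 ^ (2 * (i + 1))) (not_lt.1 h')
    rw [Nat.add_div_right _ (by positivity), hp.2, hp'.2] at h4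
    omega
  rw [spread, spread, if_pos h1, if_pos h2, add_assoc] at h3
  have h5 : 2 ^ (2 * (i + 1)) ≤ 2 ^ i * 2 ^ j := by
    rw [← pow_add]
    exact Nat.pow_le_pow_right (by omega) (by omega)
  have h6 : (p' - l) * 2 ^ j < (p - l + 2 ^ i) * 2 ^ j := by
    rw [Nat.add_mul]
    omega
  have := Nat.lt_of_mul_lt_mul_right h6
  omega

theorem cnt_spread_eq (h : Block N a j g l r) (hc : r + 1 - l ≤ 2 ^ j) {i q : ℕ}
    (hq : j ≤ i ∨ q / 2 ^ (2 * (j - i)) ≠ g) :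
    cnt N (spread a j g l r) i q = cnt N a i q := by
  refine cnt_congr fun p hp => ?_
  by_cases hij : j ≤ i
  · rw [h.spread_div_of_le hc hp (by omega)]
  · have hq' := hq.resolve_left hij
    by_cases hlr : l ≤ p ∧ p ≤ r
    · have h1 := (h.mem p hp).1 hlr
      have hji : i + (j - i) = j := by omega
      refine iff_of_false (fun h2 => hq' ?_) fun h2 => hq' ?_
      · rw [← h2, div_pow_div, hji, h.spread_div hc hp, h1]
      · rw [← h2, div_pow_div, hji, h1]
    · rw [spread, if_neg hlr]

theorem cnt_spread_sub_le (h : Block N a j g l r) (hc : r + 1 - l ≤ 2 ^ j) (i q : ℕ) :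
    cnt N (spread a j g l r) (i + 1) q - 2 ^ i ≤ cnt N a (i + 1) q - 2 ^ i := by
  by_cases h' : j ≤ i + 1 ∨ q / 2 ^ (2 * (j - (i + 1))) ≠ g
  · rw [cnt_spread_eq h hc h']
  · have := cnt_spread_le h hc (i := i) (q := q) (by omega) (by tauto)
    omega

theorem pot_spread_le (h : Block N a j g l r) (hc : r + 1 - l ≤ 2 ^ j) (L Q : ℕ) :
    pot L Q N (spread a j g l r) ≤ pot L Q N a :=
  Finset.sum_le_sum fun i _ => Nat.mul_le_mul_left _
    (Finset.sum_le_sum fun q _ => cnt_spread_sub_le h hc i q)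

/-- The block `q₀` loses its entire excess over `2 ^ i`, which was more than `2 ^ i`, and by
`cnt_spread_sub_le` no other excess increases. -/
theorem pot_spread_drop {i L Q q₀ : ℕ} (h : Block N a (i + 2) g l r)
    (hc : r + 1 - l ≤ 2 ^ (i + 2)) (hi : i < L) (hQ : q₀ < Q) (hq₀ : q₀ / 2 ^ 2 = g)
    (hcrowd : 2 ^ (i + 1) < cnt N a (i + 1) q₀) :
    pot L Q N (spread a (i + 2) g l r) + (i + 1) * 2 ^ i ≤ pot L Q N a := by
  have hi' := Finset.mem_range.2 hi
  have hQ' := Finset.mem_range.2 hQ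
  rw [pot, pot, ← Finset.add_sum_erase _ _ hi', ← Finset.add_sum_erase (Finset.range L) _ hi']
  rw [add_right_comm, ← Nat.mul_add]
  refine Nat.add_le_add (Nat.mul_le_mul_left _ ?_) (Finset.sum_le_sum fun k _ =>
    Nat.mul_le_mul_left _ (Finset.sum_le_sum fun q _ => cnt_spread_sub_le h hc k q))
  rw [← Finset.add_sum_erase _ _ hQ', ← Finset.add_sum_erase (Finset.range Q) _ hQ']
  rw [add_right_comm]
  refine Nat.add_le_add ?_ (Finset.sum_le_sum fun q _ => cnt_spread_sub_le h hc i q)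
  have h1 := cnt_spread_le h hc (i := i) (q := q₀) le_rfl
    (by rwa [show 2 * (i + 2 - (i + 1)) = 2 by omega])
  rw [pow_succ] at hcrowd
  omega

end spread

end Nca

/-! ### The program for an insertion -/


namespace Nca

open RAM RAM.Prog RAM.Exp

infixr:60 " ⨾ " => RAM.Prog.seq

/-- The integer that serves as the depth of element `e`. -/
def key (s : State) (e : ℕ) : ℤ := s.fld .dn e - s.fld .up e

/-- Whether the key of `z` is greater than that of `e`. -/
def keyGt (z e : Exp) : Exp := (ld .dn z + ld .up e) - (ld .dn e + ld .up z)

theorem eval_keyGt {s : State} {z e : Exp} :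
    (keyGt z e).eval s = 0 ↔ key s (z.eval s) ≤ key s (e.eval s) := by
  simp only [keyGt, eval_sub, eval_add, eval_ld, key]
  omega

theorem safe_keyGt {A : ℕ} {s : State} {z e : Exp} :
    (keyGt z e).Safe (16 * A) s ↔ (z.Safe (16 * A) s ∧ e.Safe (16 * A) s) ∧
      z.eval s < A ∧ e.eval s < A := by
  simp only [keyGt, safe_sub, safe_add, safe_ld]
  tauto

/-- `s'` agrees with `s` except in the registers `R` and the arrays `F`. -/
def Same (R : List ℕ) (F : List Field) (s s' : State) : Prop :=
  (∀ i, i ∉ R → s'.reg i = s.reg i) ∧ ∀ f, f ∉ F → s'.fld f = s.fld f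

namespace Same

variable {R : List ℕ} {F : List Field} {s s' s'' : State}

theorem refl : Same R F s s := ⟨fun _ _ => rfl, fun _ _ => rfl⟩

theorem trans {R' : List ℕ} {F' : List Field} (h : Same R F s s') (h' : Same R' F' s' s'')
    (hR : R' ⊆ R := by decide) (hF : F' ⊆ F := by decide) : Same R F s s'' :=
  ⟨fun i hi => (h'.1 i fun h => hi (hR h)).trans (h.1 i hi),
    fun f hf => (h'.2 f fun h => hf (hF h)).trans (h.2 f hf)⟩

theorem weaken {R' : List ℕ} {F' : List Field} (h : Same R F s s')
    (hR : R ⊆ R' := by decide) (hF : F ⊆ F' := by decide) : Same R' F' s s' :=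
  refl.trans h hR hF

theorem put (h : Same R F s s') {i v : ℕ} (hi : i ∈ R := by decide) : Same R F s (s'.put i v) :=
  ⟨fun j hj => by
    rw [State.reg_put, if_neg (by rintro rfl; exact hj hi)]
    exact h.1 j hj, h.2⟩

theorem setFld (h : Same R F s s') {f : Field} {i v : ℕ} (hf : f ∈ F := by decide) :
    Same R F s (s'.setFld f i v) :=
  ⟨h.1, fun g hg => by
    rw [← h.2 g hg]
    ext j
    rw [State.fld_setFld_ne _ (by rintro rfl; exact hg hf)]⟩

theorem key (h : Same R F s s') (h1 : Field.dn ∉ F := by decide)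
    (h2 : Field.up ∉ F := by decide) : Nca.key s' = Nca.key s := by
  ext e
  rw [Nca.key, Nca.key, h.2 _ h1, h.2 _ h2]

end Same

theorem key_congr {s s' : State} (h1 : s'.fld .dn = s.fld .dn) (h2 : s'.fld .up = s.fld .up) :
    key s' = key s := by
  ext e
  rw [key, key, h1, h2]

/-- Of the elements `z` and `e`, where `e` precedes `z`, the one with the smaller key; the later
one in case of a tie. There may be no `z`, which is indicated by `0`. -/
def sufComb (key : ℕ → ℤ) (z e : ℕ) : ℕ := if z ≠ 0 ∧ key z ≤ key e then z else e

/-- Replaces register `24` by the better one of the registers `24` and `i`. -/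
def combProg (i : ℕ) : Prog :=
  ite (reg 24) (ite (keyGt (reg 24) (reg i)) (assign 24 (reg i)) skip) (assign 24 (reg i))

theorem swp_combProg {M : Cfg} {s : State} {Q : State → Prop} {i : ℕ}
    (h1 : s.reg 24 < M.A) (h2 : s.reg i < M.A) (hAV : M.A ≤ M.V)
    (hQ : ∀ s', s'.reg 24 = sufComb (key s) (s.reg 24) (s.reg i) → Same [24] [] s s' → Q s') :
    (combProg i).swp M Q s := by
  simp only [combProg, swp, safe_reg, safe_keyGt, eval_reg, ne_eq, eval_keyGt, true_and, h1, h2]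
  refine ⟨fun h => ⟨fun h' => ⟨by omega, hQ _ ?_ (Same.refl.put)⟩, fun h' => hQ _ ?_ .refl⟩,
    fun h => ⟨by omega, hQ _ ?_ (Same.refl.put)⟩⟩
  · simp [sufComb, h']
  · simp [sufComb, h, h']
  · simp [sufComb, h]

/-- Adds the element in register `4` to the tables, with the label of the element in register
`3`, whose row begins at register `7`; the new row begins at register `8`. -/
def copyBody : Prog :=
  assign 24 (ld .suf (reg 7 + reg 6)) ⨾
  sto .pre (reg 8 + reg 6) (ld .pre (reg 7 + reg 6)) ⨾
  sto .suf (reg 8 + reg 6) (reg 24) ⨾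
  combProg 4 ⨾
  sto .suf (reg 7 + reg 6) (reg 24) ⨾
  assign 6 (reg 6 + 1)

def copyLoop : Prog := loop (reg 10 - reg 6) copyBody

/-- Since the two rows are disjoint, each entry is still in its original state when it is read. -/
theorem runs_copyLoop {M : Cfg} {s : State} {K X E : ℕ} (hK : s.reg 10 = K) (h6 : s.reg 6 = 0)
    (hX : s.reg 7 = X) (hE : s.reg 8 = E) (hAV : M.A ≤ M.V) (hXA : X + K ≤ M.A)
    (hEA : E + K ≤ M.A) (hXE : X + K ≤ E ∨ E + K ≤ X) (h4 : s.reg 4 < M.A)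
    (hz : ∀ k < K, s.fld .suf (X + k) < M.A) :
    Runs M copyLoop s fun t s' => t ≤ 200 * (K + 1) ∧ Same [6, 24] [.pre, .suf] s s' ∧
      (∀ i, s'.fld .pre i = if E ≤ i ∧ i < E + K then s.fld .pre (X + (i - E)) else
        s.fld .pre i) ∧
      ∀ i, s'.fld .suf i = if E ≤ i ∧ i < E + K then s.fld .suf (X + (i - E)) else
        if X ≤ i ∧ i < X + K then sufComb (key s) (s.fld .suf i) (s.reg 4) else s.fld .suf i := by
  refine Runs.loop (by decide) (fun m t s' => ∃ k, k + m = K ∧ s'.reg 6 = k ∧ t ≤ 200 * k ∧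
      Same [6, 24] [.pre, .suf] s s' ∧
      (∀ i, s'.fld .pre i = if E ≤ i ∧ i < E + k then s.fld .pre (X + (i - E)) else
        s.fld .pre i) ∧
      ∀ i, s'.fld .suf i = if E ≤ i ∧ i < E + k then s.fld .suf (X + (i - E)) else
        if X ≤ i ∧ i < X + k then sufComb (key s) (s.fld .suf i) (s.reg 4) else s.fld .suf i)
    (m := K) ⟨0, by omega, h6, by omega, .refl, fun i => ?_, fun i => ?_⟩ ?_ ?_ ?_
  · rw [if_neg (by omega)]
  · rw [if_neg (by omega), if_neg (by omega)]
  · intros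
    simp
  · rintro m t s' ⟨k, hk, hk6, ht, hS, hpre, hsuf⟩ hb he
    have r10 : s'.reg 10 = K := by rw [hS.1 10 (by decide), hK]
    have r7 : s'.reg 7 = X := by rw [hS.1 7 (by decide), hX]
    have r8 : s'.reg 8 = E := by rw [hS.1 8 (by decide), hE]
    have r4 : s'.reg 4 = s.reg 4 := hS.1 4 (by decide)
    simp only [eval_sub, eval_reg, r10, hk6, ne_eq] at he
    have hkK : k < K := by omega
    have hzk : s'.fld .suf (X + k) = s.fld .suf (X + k) := by
      rw [hsuf, if_neg (by omega), if_neg (by omega)]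
    have hzp : s'.fld .pre (X + k) = s.fld .pre (X + k) := by
      rw [hpre, if_neg (by omega)]
    have hz' := hz k hkK
    have hbp := hb.fld .pre (X + k)
    rw [hzp] at hbp
    refine (Runs.straight (R := fun s'' => s''.reg 6 = k + 1 ∧ Same [6, 24] [.pre, .suf] s' s'' ∧
      (∀ i, s''.fld .pre i = if i = E + k then s.fld .pre (X + k) else s'.fld .pre i) ∧
      (∀ i, s''.fld .suf i = if i = X + k then sufComb (key s) (s.fld .suf (X + k)) (s.reg 4) else
        if i = E + k then s.fld .suf (X + k) else s'.fld .suf i)) (by decide) ?_).mono ?_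
    · simp only [copyBody, swp, swp_sto, safe_reg, safe_add, safe_ld, eval_ld, eval_add, eval_reg,
        State.reg_put, State.fld_put, State.reg_setFld, r7, r8, hk6, hzk, hzp, true_and, if_true,
        State.fld_setFld_ne, ne_eq, reduceCtorEq, not_false_eq_true,
        Nat.reduceEqDiff, if_false, safe_ofNat, eval_ofNat]
      refine ⟨by omega, by omega, by omega, by omega, by omega, by omega, by omega, ?_⟩
      refine swp_combProg (by simpa using hz') (by simpa [r4] using h4) hAV fun s'' hc hS' => ?_
      have q7 : s''.reg 7 = X := by simpa [r7] using hS'.1 7 (by decide)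
      have q6 : s''.reg 6 = k := by simpa [hk6] using hS'.1 6 (by decide)
      have hS1 : Same [6, 24] [.pre, .suf] s' (((s'.put 24 (s.fld .suf (X + k))).setFld .pre
        (E + k) (s.fld .pre (X + k))).setFld .suf (E + k) (s.fld .suf (X + k))) :=
        (Same.refl.put.setFld).setFld
      have hc' : s''.reg 24 = sufComb (key s) (s.fld .suf (X + k)) (s.reg 4) := by
        rw [hc, (hS.trans hS1).key]
        simp [r4]
      have hlt := sufComb_lt (κ := key s) hz' h4
      simp only [eval_reg, eval_add, q6, q7, hc', safe_ofNat, safe_reg, eval_ofNat, true_and,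
        State.reg_put, State.reg_setFld, if_true, State.fld_put, State.fld_setFld_same,
        and_self]
      refine ⟨by omega, by omega, by omega, (hS1.trans hS').setFld.put, fun i => ?_, fun i => ?_⟩
      · rw [hS'.2 .pre (by decide)]
        simp
      · rw [hS'.2 .suf (by decide)]
        simp
    · rintro t' s'' ⟨ht', h6', hS', hpre', hsuf'⟩
      refine ⟨m - 1, by omega, k + 1, by omega, h6', ?_, hS.trans hS', fun i => ?_, fun i => ?_⟩
      -- The body is bounded by evaluating `cst`; with 4 steps for the test a round stays below 200.
      -- The other loops are accounted for in the same way.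
      · have : t' ≤ 190 := ht'.trans (by decide)
        have : (reg 10 - reg 6 : Exp).cost = 3 := rfl
        omega
      · rw [hpre', hpre]
        rcases lt_trichotomy i (E + k) with h | rfl | h
        · rw [if_neg (by omega)]
          split_ifs <;> first | rfl | omega
        · rw [if_pos rfl, if_pos (by omega), Nat.add_sub_cancel_left]
        · rw [if_neg (by omega), if_neg (by omega), if_neg (by omega)]
      · rw [hsuf', hsuf]
        by_cases h1 : i = X + k
        · subst h1
          rw [if_pos rfl, if_neg (by omega), if_pos (by omega)]
        · rw [if_neg h1]
          by_cases h2 : i = E + k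
          · subst h2
            rw [if_pos rfl, if_pos (by omega), Nat.add_sub_cancel_left]
          · rw [if_neg h2]
            split_ifs <;> first | rfl | omega
  · rintro m t s' ⟨k, hk, hk6, ht, hS, hpre, hsuf⟩ hb he
    have r10 : s'.reg 10 = K := by rw [hS.1 10 (by decide), hK]
    simp only [eval_sub, eval_reg, r10, hk6] at he
    obtain rfl : k = K := by omega
    have : (reg 10 - reg 6 : Exp).cost = 3 := rfl
    exact ⟨by omega, hS, hpre, hsuf⟩
where
  sufComb_lt {κ : ℕ → ℤ} {z e A : ℕ} (hz : z < A) (he : e < A) : sufComb κ z e < A := by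
    unfold sufComb
    split_ifs <;> assumption

end Nca

/-! ### Filling rows of the tables, and the table of logarithms. -/

namespace Nca

open RAM RAM.Prog RAM.Exp

/-- The contents of a row of the first table for element `e` with label `v`, where `z` is the
corresponding entry for the preceding element. -/
def preVal (key : ℕ → ℤ) (v k e z : ℕ) : ℕ :=
  if v % 2 ^ k = 0 then e else if key e ≤ key z then e else z

/-- The contents of a row of the second table for the predecessor of element `e`, where `z` is the
entry for `e`; there is no element `e` if `e = 0`. -/
def sufVal (key : ℕ → ℤ) (u k e z : ℕ) : ℕ :=
  if u % 2 ^ k = 0 ∨ e = 0 then 0 else sufComb key z e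

/-- The machine has no remainder operation; the tests for multiples of `2 ^ k` are expressed by
division. -/
theorem sub_div_mul_self (a b : ℕ) : a - a / b * b = a % b := by
  rw [Nat.mod_eq_sub_mul_div, mul_comm]

/-- Stores register `24` in a row of the array `f` and proceeds to the next entry. -/
def putRow (f : Field) : Prog :=
  sto f (reg 8 + reg 6) (reg 24) ⨾
  assign 22 (reg 22 * 2) ⨾
  assign 6 (reg 6 + 1)

theorem swp_putRow {M : Cfg} {f : Field} {s' s₁ : State} {E k x : ℕ}
    (hA : E + k < M.A ∧ k + 1 < M.V) (h6 : s'.reg 6 = k) (h8 : s'.reg 8 = E)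
    (h22 : s'.reg 22 = 2 ^ k) (hpow : 2 ^ k * 2 < M.V) (h24 : s₁.reg 24 = x) (hx : x < M.V)
    (hS : Same [24] [] s' s₁) :
    (putRow f).swp M (fun s'' => s''.reg 6 = k + 1 ∧ s''.reg 22 = 2 ^ (k + 1) ∧
      Same [6, 22, 24] [f] s' s'' ∧
      ∀ i, s''.fld f i = if i = E + k then x else s'.fld f i) s₁ := by
  have q6 : s₁.reg 6 = k := by rw [hS.1 6 (by decide), h6]
  have q8 : s₁.reg 8 = E := by rw [hS.1 8 (by decide), h8]
  have q22 : s₁.reg 22 = 2 ^ k := by rw [hS.1 22 (by decide), h22]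
  simp [putRow, swp, swp_sto, q6, q8, q22, h24]
  refine ⟨hA.1, hx, hpow, hA.2, by rw [pow_succ], (((hS.weaken (by decide) (by simp)).setFld
    (by simp)).put).put, fun i => ?_⟩
  rw [hS.2 f (by simp)]

def preBody : Prog :=
  ite (reg 21 - reg 21 / reg 22 * reg 22)
    (assign 24 (ld .pre (reg 7 + reg 6)) ⨾
      ite (keyGt (reg 20) (reg 24)) skip (assign 24 (reg 20)))
    (assign 24 (reg 20)) ⨾
  putRow .pre

/-- Fills the row of the first table that begins at register `8`. -/
def preLoop : Prog := loop (reg 15 - reg 6) preBody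

/-- Entry `k` of the source is read before entry `k` of the target is written, so the two rows may
coincide. Where the label is a multiple of `2 ^ k` a new block starts and the source is not read; no
bound is required of it there. -/
theorem runs_preLoop {M : Cfg} {s : State} {K Y E v e : ℕ} (hK : s.reg 15 = K) (h6 : s.reg 6 = 0)
    (h22 : s.reg 22 = 1) (h7 : s.reg 7 = Y) (h8 : s.reg 8 = E) (h21 : s.reg 21 = v)
    (h20 : s.reg 20 = e) (hAV : M.A < M.V) (hKV : 2 ^ K < M.V) (hYA : Y + K ≤ M.A)
    (hEA : E + K ≤ M.A) (hYE : Y = E ∨ Y + K ≤ E ∨ E + K ≤ Y) (he : e < M.A)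
    (hz : ∀ k < K, v % 2 ^ k ≠ 0 → s.fld .pre (Y + k) < M.A) :
    Runs M preLoop s fun t s' => t ≤ 200 * (K + 1) ∧ Same [6, 22, 24] [.pre] s s' ∧
      (∀ i, s'.fld .pre i = if E ≤ i ∧ i < E + K then
        preVal (key s) v (i - E) e (s.fld .pre (Y + (i - E))) else s.fld .pre i) := by
  refine Runs.loop (by decide) (fun m t s' => ∃ k, k + m = K ∧ s'.reg 6 = k ∧ s'.reg 22 = 2 ^ k ∧
      t ≤ 200 * k ∧ Same [6, 22, 24] [.pre] s s' ∧
      (∀ i, s'.fld .pre i = if E ≤ i ∧ i < E + k then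
        preVal (key s) v (i - E) e (s.fld .pre (Y + (i - E))) else s.fld .pre i))
    (m := K) ⟨0, by omega, h6, h22, by omega, .refl, fun i => ?_⟩ ?_ ?_ ?_
  · rw [if_neg (by omega)]
  · intros
    simp
  · rintro m t s' ⟨k, hk, hk6, hk22, ht, hS, hpre⟩ hb hne
    have r15 : s'.reg 15 = K := by rw [hS.1 15 (by decide), hK]
    have r7 : s'.reg 7 = Y := by rw [hS.1 7 (by decide), h7]
    have r8 : s'.reg 8 = E := by rw [hS.1 8 (by decide), h8]
    have r20 : s'.reg 20 = e := by rw [hS.1 20 (by decide), h20]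
    have r21 : s'.reg 21 = v := by rw [hS.1 21 (by decide), h21]
    simp only [eval_sub, eval_reg, r15, hk6, ne_eq] at hne
    have hkK : k < K := by omega
    have hzk : s'.fld .pre (Y + k) = s.fld .pre (Y + k) := by
      rw [hpre, if_neg (by omega)]
    have hz' := hz k hkK
    have hpow : 2 ^ k * 2 < M.V := by
      rw [← pow_succ]
      exact lt_of_le_of_lt (Nat.pow_le_pow_right (by omega) hkK) hKV
    have hkey := hS.key
    refine (Runs.straight (R := fun s'' => s''.reg 6 = k + 1 ∧ s''.reg 22 = 2 ^ (k + 1) ∧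
      Same [6, 22, 24] [.pre] s' s'' ∧
      (∀ i, s''.fld .pre i = if i = E + k then preVal (key s) v k e (s.fld .pre (Y + k)) else
        s'.fld .pre i)) (by decide) ?_).mono ?_
    · have hfin := fun s₁ => swp_putRow (M := M) (f := .pre) (s₁ := s₁) (by omega) hk6 r8 hk22 hpow
        (x := preVal (key s) v k e (s.fld .pre (Y + k)))
      have hbz := hb.fld .pre (Y + k)
      rw [hzk] at hbz
      have hx : preVal (key s) v k e (s.fld .pre (Y + k)) < M.V := by
        unfold preVal
        split_ifs <;> omega
      simp only [preBody, swp]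
      simp only [eval_sub, eval_div, eval_mul, eval_reg, sub_div_mul_self, r21, hk22, safe_sub,
        safe_reg, safe_div, safe_mul, true_and, and_self, safe_ld, safe_add, eval_add, eval_ld,
        safe_keyGt, eval_keyGt, ne_eq, State.reg_put, Nat.reduceEqDiff, if_false, if_true, r7, r20,
        hk6, hzk]
      have key_put : ∀ x, key (s'.put 24 x) = key s := fun x => hkey
      simp only [key_put]
      refine ⟨fun h => ⟨by omega, ?_, ⟨he, hz' h⟩, fun h1 => hfin _ ?_ ?_ Same.refl.put, fun h1 =>
        ⟨by omega, hfin _ ?_ ?_ (Same.refl.put.put)⟩⟩, fun h => ⟨by omega, hfin _ ?_ ?_ Same.refl.put⟩⟩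
      · have := hz' h; omega
      · simp [preVal, h, h1]
      · exact hx
      · simp [preVal, h, h1]
      · exact hx
      · simp [preVal, h]
      · exact hx
    · rintro t' s'' ⟨ht', h6', h22', hS', hpre'⟩
      refine ⟨m - 1, by omega, k + 1, by omega, h6', h22', ?_, hS.trans hS', fun i => ?_⟩
      · have : t' ≤ 190 := ht'.trans (by decide)
        have : (reg 15 - reg 6 : Exp).cost = 3 := rfl
        omega
      · rw [hpre', hpre]
        rcases lt_trichotomy i (E + k) with h | rfl | h
        · rw [if_neg (by omega)]
          split_ifs <;> first | rfl | omega
        · rw [if_pos rfl, if_pos (by omega), Nat.add_sub_cancel_left]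
        · rw [if_neg (by omega), if_neg (by omega), if_neg (by omega)]
  · rintro m t s' ⟨k, hk, hk6, hk22, ht, hS, hpre⟩ hb hne
    have r15 : s'.reg 15 = K := by rw [hS.1 15 (by decide), hK]
    simp only [eval_sub, eval_reg, r15, hk6] at hne
    obtain rfl : k = K := by omega
    have : (reg 15 - reg 6 : Exp).cost = 3 := rfl
    exact ⟨by omega, hS, hpre⟩

def sufBody : Prog :=
  ite ((reg 21 - reg 21 / reg 22 * reg 22) * reg 23)
    (assign 24 (ld .suf (reg 7 + reg 6)) ⨾ combProg 23)
    (assign 24 0) ⨾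
  putRow .suf

/-- Fills the row of the second table that begins at register `8`. -/
def sufLoop : Prog := loop (reg 15 - reg 6) sufBody

theorem runs_sufLoop {M : Cfg} {s : State} {K Y E v e : ℕ} (hK : s.reg 15 = K) (h6 : s.reg 6 = 0)
    (h22 : s.reg 22 = 1) (h7 : s.reg 7 = Y) (h8 : s.reg 8 = E) (h21 : s.reg 21 = v)
    (h23 : s.reg 23 = e) (hAV : M.A < M.V) (hKV : 2 ^ K < M.V) (hYA : Y + K ≤ M.A)
    (hEA : E + K ≤ M.A) (hYE : Y = E ∨ Y + K ≤ E ∨ E + K ≤ Y) (he : e < M.A)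
    (hz : ∀ k < K, e ≠ 0 → s.fld .suf (Y + k) < M.A) :
    Runs M sufLoop s fun t s' => t ≤ 200 * (K + 1) ∧ Same [6, 22, 24] [.suf] s s' ∧
      (∀ i, s'.fld .suf i = if E ≤ i ∧ i < E + K then
        sufVal (key s) v (i - E) e (s.fld .suf (Y + (i - E))) else s.fld .suf i) := by
  refine Runs.loop (by decide) (fun m t s' => ∃ k, k + m = K ∧ s'.reg 6 = k ∧ s'.reg 22 = 2 ^ k ∧
      t ≤ 200 * k ∧ Same [6, 22, 24] [.suf] s s' ∧
      (∀ i, s'.fld .suf i = if E ≤ i ∧ i < E + k then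
        sufVal (key s) v (i - E) e (s.fld .suf (Y + (i - E))) else s.fld .suf i))
    (m := K) ⟨0, by omega, h6, h22, by omega, .refl, fun i => ?_⟩ ?_ ?_ ?_
  · rw [if_neg (by omega)]
  · intros
    simp
  · rintro m t s' ⟨k, hk, hk6, hk22, ht, hS, hsuf⟩ hb hne
    have r15 : s'.reg 15 = K := by rw [hS.1 15 (by decide), hK]
    have r7 : s'.reg 7 = Y := by rw [hS.1 7 (by decide), h7]
    have r8 : s'.reg 8 = E := by rw [hS.1 8 (by decide), h8]
    have r23 : s'.reg 23 = e := by rw [hS.1 23 (by decide), h23]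
    have r21 : s'.reg 21 = v := by rw [hS.1 21 (by decide), h21]
    simp only [eval_sub, eval_reg, r15, hk6, ne_eq] at hne
    have hkK : k < K := by omega
    have hzk : s'.fld .suf (Y + k) = s.fld .suf (Y + k) := by
      rw [hsuf, if_neg (by omega)]
    have hz' := hz k hkK
    have hpow : 2 ^ k * 2 < M.V := by
      rw [← pow_succ]
      exact lt_of_le_of_lt (Nat.pow_le_pow_right (by omega) hkK) hKV
    have hkey := hS.key
    refine (Runs.straight (R := fun s'' => s''.reg 6 = k + 1 ∧ s''.reg 22 = 2 ^ (k + 1) ∧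
      Same [6, 22, 24] [.suf] s' s'' ∧
      (∀ i, s''.fld .suf i = if i = E + k then sufVal (key s) v k e (s.fld .suf (Y + k)) else
        s'.fld .suf i)) (by decide) ?_).mono ?_
    · have hfin := fun s₁ => swp_putRow (M := M) (f := .suf) (s₁ := s₁) (by omega) hk6 r8 hk22 hpow
        (x := sufVal (key s) v k e (s.fld .suf (Y + k)))
      have hbz := hb.fld .suf (Y + k)
      rw [hzk] at hbz
      have hx : sufVal (key s) v k e (s.fld .suf (Y + k)) < M.V := by
        unfold sufVal sufComb
        split_ifs <;> omega
      simp only [sufBody, swp]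
      simp only [eval_sub, eval_div, eval_mul, eval_reg, sub_div_mul_self, r21, hk22, safe_sub,
        safe_reg, safe_div, safe_mul, true_and, and_self, safe_ld, safe_add, eval_add, eval_ld,
        ne_eq, State.reg_put, r7, r23, hk6, hzk, safe_ofNat, eval_ofNat, mul_eq_zero]
      refine ⟨fun h => ⟨by omega, ?_, ?_⟩, fun h => ⟨by omega, hfin _ ?_ ?_ Same.refl.put⟩⟩
      · have := hz' (by tauto); omega
      · have h1 := hz' (by tauto)
        refine swp_combProg (by simpa using h1) (by simpa [r23] using he) hAV.le fun s₁ h2 h3 => ?_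
        have h4 : s₁.reg 24 = sufComb (key s) (s.fld .suf (Y + k)) e := by
          rw [h2, show key (s'.put 24 (s.fld .suf (Y + k))) = key s from hkey]
          simp [r23]
        have h5 := runs_copyLoop.sufComb_lt (κ := key s) h1 he
        refine hfin _ ?_ hx (Same.refl.put.trans h3)
        rw [h4, sufVal, if_neg h]
      · simp [sufVal, h]
      · exact hx
    · rintro t' s'' ⟨ht', h6', h22', hS', hsuf'⟩
      refine ⟨m - 1, by omega, k + 1, by omega, h6', h22', ?_, hS.trans hS', fun i => ?_⟩
      · have : t' ≤ 190 := ht'.trans (by decide)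
        have : (reg 15 - reg 6 : Exp).cost = 3 := rfl
        omega
      · rw [hsuf', hsuf]
        rcases lt_trichotomy i (E + k) with h | rfl | h
        · rw [if_neg (by omega)]
          split_ifs <;> first | rfl | omega
        · rw [if_pos rfl, if_pos (by omega), Nat.add_sub_cancel_left]
        · rw [if_neg (by omega), if_neg (by omega), if_neg (by omega)]
  · rintro m t s' ⟨k, hk, hk6, hk22, ht, hS, hsuf⟩ hb hne
    have r15 : s'.reg 15 = K := by rw [hS.1 15 (by decide), hK]
    simp only [eval_sub, eval_reg, r15, hk6] at hne
    obtain rfl : k = K := by omega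
    have : (reg 15 - reg 6 : Exp).cost = 3 := rfl
    exact ⟨by omega, hS, hsuf⟩

/-- Extends the tables of logarithms and powers of two up to register `16`, exclusively. -/
def growLoop : Prog := loop (reg 16 - reg 19)
  (sto .lg (reg 19) (ld .lg (reg 19 / 2) + 1) ⨾
    sto .pl (reg 19) (ld .pl (reg 19 / 2) * 2) ⨾
    assign 19 (reg 19 + 1))

/-- The tables of logarithms and powers of two are correct for arguments less than `n`. -/
def Logs (n : ℕ) (s : State) : Prop :=
  ∀ i, 1 ≤ i → i < n → s.fld .lg i = Nat.log 2 i ∧ s.fld .pl i = 2 ^ Nat.log 2 i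

/-- From 2 on, the logarithm of k is one more than that of `k / 2`, whose entry is already present.
-/
theorem runs_growLoop {M : Cfg} {s : State} {p q : ℕ} (hq : s.reg 16 = q) (hp : s.reg 19 = p)
    (hp2 : 2 ≤ p) (hpq : p ≤ q) (hqA : q ≤ M.A) (hAV : M.A < M.V) (hl : Logs p s) :
    Runs M growLoop s fun t s' => t ≤ 100 * (q + 1) ∧ Same [19] [.lg, .pl] s s' ∧ Logs q s' := by
  refine Runs.loop (by decide) (fun m t s' => ∃ k, k + m = q ∧ p ≤ k ∧ s'.reg 19 = k ∧
      t ≤ 100 * k ∧ Same [19] [.lg, .pl] s s' ∧ Logs k s') (m := q - p)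
    ⟨p, by omega, le_rfl, hp, by omega, .refl, hl⟩ ?_ ?_ ?_
  · intros
    simp
  · rintro m t s' ⟨k, hk, hpk, h19, ht, hS, hlk⟩ hb hne
    have r16 : s'.reg 16 = q := by rw [hS.1 16 (by decide), hq]
    simp only [eval_sub, eval_reg, r16, h19, ne_eq] at hne
    obtain ⟨h1, h2⟩ := hlk (k / 2) (by omega) (by omega)
    have h3 : Nat.log 2 k = Nat.log 2 (k / 2) + 1 := by
      rw [Nat.log_div_base, Nat.sub_add_cancel (Nat.log_pos (by omega) (by omega))]
    have h4 : 2 ^ Nat.log 2 k ≤ k := Nat.pow_log_le_self 2 (by omega)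
    have h5 : Nat.log 2 k < k := Nat.log_lt_self 2 (by omega)
    have h6 : 2 ^ Nat.log 2 (k / 2) * 2 = 2 ^ Nat.log 2 k := by rw [h3, pow_succ]
    refine (Runs.straight (R := fun s'' => s''.reg 19 = k + 1 ∧ Same [19] [.lg, .pl] s' s'' ∧
      Logs (k + 1) s'') (by decide) ?_).mono ?_
    · simp [swp, swp_sto, h19, h1, h2, State.fld_setFld_ne, -Nat.log_div_base]
      refine ⟨by omega, by omega, by omega, by omega, by omega, by omega, by omega,
        (Same.refl.setFld).setFld.put, fun i hi1 hi2 => ?_⟩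
      simp only [State.fld_put, State.fld_setFld_same, ne_eq, reduceCtorEq, not_false_eq_true,
        State.fld_setFld_ne]
      by_cases hik : i = k
      · subst hik
        rw [if_pos rfl, if_pos rfl, h3, pow_succ]
        exact ⟨rfl, rfl⟩
      · simp only [hik, if_false]
        exact hlk i hi1 (by omega)
    · rintro t' s'' ⟨ht', h7, h8, h9⟩
      have : t' ≤ 90 := ht'.trans (by decide)
      have : (reg 16 - reg 19 : Exp).cost = 3 := rfl
      exact ⟨m - 1, by omega, k + 1, by omega, by omega, h7, by omega, hS.trans h8, h9⟩
  · rintro m t s' ⟨k, hk, hpk, h19, ht, hS, hlk⟩ hb hne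
    have r16 : s'.reg 16 = q := by rw [hS.1 16 (by decide), hq]
    simp only [eval_sub, eval_reg, r16, h19] at hne
    obtain rfl : k = q := by omega
    have : (reg 16 - reg 19 : Exp).cost = 3 := rfl
    exact ⟨by omega, hS, hlk⟩

end Nca

/-! ### The linked list, and the search for a block that is not crowded. -/

namespace Nca

open RAM RAM.Prog RAM.Exp

/-- The elements are doubly linked in the order given by `el`. -/
structure Links (N : ℕ) (el : ℕ → ℕ) (s : State) : Prop where
  nxt : ∀ i, i + 1 < N → s.fld .nxt (el i) = el (i + 1)
  last : s.fld .nxt (el (N - 1)) = 0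
  prv : ∀ i, i + 1 < N → s.fld .prv (el (i + 1)) = el i
  first : s.fld .prv 0 < N

theorem Links.congr {N : ℕ} {el : ℕ → ℕ} {s s' : State} (h : Links N el s)
    (h1 : s'.fld .nxt = s.fld .nxt) (h2 : s'.fld .prv = s.fld .prv) : Links N el s' := by
  constructor
  · rw [h1]; exact h.nxt
  · rw [h1]; exact h.last
  · rw [h2]; exact h.prv
  · rw [h2]; exact h.first

theorem Links.nxt_lt {N : ℕ} {el : ℕ → ℕ} {s : State} (h : Links N el s) (ho : Order N el) {i : ℕ}
    (hi : i < N) : s.fld .nxt (el i) < N := by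
  by_cases h' : i + 1 < N
  · rw [h.nxt i h']
    exact ho.lt _ h'
  · obtain rfl : i = N - 1 := by omega
    rw [h.last]
    omega

theorem Links.prv_lt {N : ℕ} {el : ℕ → ℕ} {s : State} (h : Links N el s) (ho : Order N el) {i : ℕ}
    (hi : i < N) : s.fld .prv (el i) < N := by
  cases i with
  | zero => rw [ho.zero]; exact h.first
  | succ i => rw [h.prv i hi]; exact ho.lt _ (by omega)

/-- The labels in the order of the list. -/
def labs (s : State) (el : ℕ → ℕ) (q : ℕ) : ℕ := s.fld .lab (el q)

/-- Moves register `12` to the left up to the beginning of the block. -/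
def leftLoop : Prog := loop (reg 12 * (ld .lab (ld .prv (reg 12)) + 1 - reg 18))
  (assign 12 (ld .prv (reg 12)) ⨾ assign 14 (reg 14 + 1))

/-- Moves register `13` to the right up to the end of the block. -/
def rightLoop : Prog :=
  loop (ld .nxt (reg 13) * (reg 18 + reg 17 - ld .lab (ld .nxt (reg 13))))
    (assign 13 (ld .nxt (reg 13)) ⨾ assign 14 (reg 14 + 1))

section

variable {M : Cfg} {s : State} {N : ℕ} {el : ℕ → ℕ}

/-- The test is a product that acts as a conjunction. It vanishes at the sentinel and when the
preceding label is less than the base of the block; the `+ 1` makes truncated subtraction express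
this strict inequality. -/
theorem runs_leftLoop {l c base : ℕ} (ho : Order N el) (hl : Links N el s) (hNA : N ≤ M.A)
    (hAV : M.A < M.V) (h12 : s.reg 12 = el l) (h14 : s.reg 14 = c) (h18 : s.reg 18 = base)
    (hlN : l < N) (hc : c + l ≤ N) :
    Runs M leftLoop s fun t s' => ∃ l' ≤ l, s'.reg 12 = el l' ∧ s'.reg 14 = c + (l - l') ∧
      t ≤ 100 * (l - l' + 1) ∧ Same [12, 14] [] s s' ∧ (l' = 0 ∨ labs s el (l' - 1) < base) ∧
      ∀ q, l' ≤ q → q < l → base ≤ labs s el q := by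
  refine Runs.loop (by decide) (fun m t s' => ∃ l' ≤ l, m = l' ∧ s'.reg 12 = el l' ∧
      s'.reg 14 = c + (l - l') ∧ t ≤ 100 * (l - l') ∧ Same [12, 14] [] s s' ∧
      ∀ q, l' ≤ q → q < l → base ≤ labs s el q) (m := l)
    ⟨l, le_rfl, rfl, h12, by omega, by omega, .refl, fun q _ _ => by omega⟩ ?_ ?_ ?_
  · rintro m t s' ⟨l', hl', rfl, r12, -, -, hS, -⟩ hb
    have h1 := hl.prv_lt ho (show m < N by omega)
    have h2 := ho.lt m (by omega)
    simp only [safe_mul, safe_reg, safe_sub, safe_add, safe_ld, eval_ld, eval_reg, r12,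
      hS.2 .prv (by decide), safe_ofNat, true_and, and_true]
    omega
  · rintro m t s' ⟨l', hl', rfl, r12, r14, ht, hS, hq⟩ hb hne
    have h1 := hl.prv_lt ho (show m < N by omega)
    have h2 := ho.lt m (by omega)
    simp only [eval_mul, eval_sub, eval_add, eval_ld, eval_reg, r12, eval_ofNat,
      hS.1 18 (by decide), h18, hS.2 .prv (by decide), hS.2 .lab (by decide), ne_eq,
      mul_eq_zero, not_or] at hne
    have hm0 : m ≠ 0 := by
      rintro rfl
      exact hne.1 ho.zero
    obtain ⟨m, rfl⟩ := Nat.exists_eq_succ_of_ne_zero hm0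
    have h3 := hl.prv m (by omega)
    rw [Nat.succ_eq_add_one, h3] at hne
    rw [Nat.succ_eq_add_one] at *
    refine (Runs.straight (R := fun s'' => s''.reg 12 = el m ∧ s''.reg 14 = c + (l - m) ∧
      Same [12, 14] [] s' s'') (by decide) ?_).mono ?_
    · simp [swp, r12, r14, hS.2 .prv (by decide), h3]
      exact ⟨by omega, by omega, by omega, by omega, Same.refl.put.put⟩
    · rintro t' s'' ⟨ht', h4, h5, h6⟩
      refine ⟨m, by omega, m, by omega, rfl, h4, h5, ?_, hS.trans h6, fun q hq1 hq2 => ?_⟩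
      · have : t' ≤ 40 := ht'.trans (by decide)
        have : (reg 12 * (ld .lab (ld .prv (reg 12)) + 1 - reg 18) : Exp).cost ≤ 18 := by decide
        omega
      · rcases Nat.eq_or_lt_of_le hq1 with rfl | hq1
        · rw [labs]
          omega
        · exact hq q hq1 hq2
  · rintro m t s' ⟨l', hl', rfl, r12, r14, ht, hS, hq⟩ hb hne
    refine ⟨m, hl', r12, r14, ?_, hS, ?_, hq⟩
    · have : (reg 12 * (ld .lab (ld .prv (reg 12)) + 1 - reg 18) : Exp).cost ≤ 18 := by decide
      omega
    · simp only [eval_mul, eval_sub, eval_add, eval_ld, eval_reg, r12, eval_ofNat,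
        hS.1 18 (by decide), h18, hS.2 .prv (by decide), hS.2 .lab (by decide),
        mul_eq_zero] at hne
      cases m with
      | zero => exact .inl rfl
      | succ m =>
        rw [hl.prv m (by omega)] at hne
        have := hne.resolve_left (ho.ne_zero (by omega) (by omega))
        refine .inr ?_
        rw [labs, Nat.add_sub_cancel]
        omega

/-- As on the left, the test vanishes at the end of the list, where the successor is `0`, and when
the next label is outside the block. -/
theorem runs_rightLoop {r c base len : ℕ} (ho : Order N el) (hl : Links N el s) (hNA : N ≤ M.A)
    (hAV : M.A < M.V) (h13 : s.reg 13 = el r) (h14 : s.reg 14 = c) (h18 : s.reg 18 = base)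
    (h17 : s.reg 17 = len) (hrN : r < N) (hc : c ≤ r + 1) :
    Runs M rightLoop s fun t s' => ∃ r' ≥ r, r' < N ∧ s'.reg 13 = el r' ∧
      s'.reg 14 = c + (r' - r) ∧ t ≤ 100 * (r' - r + 1) ∧ Same [13, 14] [] s s' ∧
      (r' + 1 = N ∨ base + len ≤ labs s el (r' + 1)) ∧
      ∀ q, r < q → q ≤ r' → labs s el q < base + len := by
  refine Runs.loop (by decide) (fun m t s' => ∃ r' ≥ r, m + r' + 1 = N ∧ s'.reg 13 = el r' ∧
      s'.reg 14 = c + (r' - r) ∧ t ≤ 100 * (r' - r) ∧ Same [13, 14] [] s s' ∧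
      ∀ q, r < q → q ≤ r' → labs s el q < base + len) (m := N - 1 - r)
    ⟨r, le_rfl, by omega, h13, by omega, by omega, .refl, fun q _ _ => by omega⟩ ?_ ?_ ?_
  · rintro m t s' ⟨r', hr', hm, r13, -, -, hS, -⟩ hb
    have h1 := hl.nxt_lt ho (show r' < N by omega)
    have h2 := ho.lt r' (by omega)
    simp only [safe_mul, safe_reg, safe_sub, safe_add, safe_ld, eval_ld, eval_reg, r13,
      hS.2 .nxt (by decide), safe_ofNat, true_and, and_true]
    omega
  · rintro m t s' ⟨r', hr', hm, r13, r14, ht, hS, hq⟩ hb hne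
    have h1 := hl.nxt_lt ho (show r' < N by omega)
    have h2 := ho.lt r' (by omega)
    simp only [eval_mul, eval_sub, eval_add, eval_ld, eval_reg, r13, eval_ofNat,
      hS.1 17 (by decide), h17, hS.1 18 (by decide), h18, hS.2 .nxt (by decide),
      hS.2 .lab (by decide), ne_eq, mul_eq_zero, not_or] at hne
    have hm0 : r' + 1 < N := by
      by_contra h
      obtain rfl : r' = N - 1 := by omega
      exact hne.1 hl.last
    have h3 := hl.nxt r' hm0
    rw [h3] at hne
    refine (Runs.straight (R := fun s'' => s''.reg 13 = el (r' + 1) ∧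
      s''.reg 14 = c + (r' + 1 - r) ∧ Same [13, 14] [] s' s'') (by decide) ?_).mono ?_
    · simp [swp, r13, r14, hS.2 .nxt (by decide), h3]
      exact ⟨by omega, by omega, by omega, by omega, Same.refl.put.put⟩
    · rintro t' s'' ⟨ht', h4, h5, h6⟩
      refine ⟨m - 1, by omega, r' + 1, by omega, by omega, h4, h5, ?_, hS.trans h6,
        fun q hq1 hq2 => ?_⟩
      · have : t' ≤ 40 := ht'.trans (by decide)
        have : (ld .nxt (reg 13) * (reg 18 + reg 17 - ld .lab (ld .nxt (reg 13))) : Exp).cost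
          ≤ 40 := by decide
        omega
      · rcases Nat.eq_or_lt_of_le hq2 with rfl | hq2
        · rw [labs]
          omega
        · exact hq q hq1 (by omega)
  · rintro m t s' ⟨r', hr', hm, r13, r14, ht, hS, hq⟩ hb hne
    refine ⟨r', hr', by omega, r13, r14, ?_, hS, ?_, hq⟩
    · have : (ld .nxt (reg 13) * (reg 18 + reg 17 - ld .lab (ld .nxt (reg 13))) : Exp).cost
        ≤ 40 := by decide
      omega
    · by_cases hN : r' + 1 = N
      · exact .inl hN
      · simp only [eval_mul, eval_sub, eval_add, eval_ld, eval_reg, r13, eval_ofNat,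
          hS.1 17 (by decide), h17, hS.1 18 (by decide), h18, hS.2 .nxt (by decide),
          hS.2 .lab (by decide), mul_eq_zero] at hne
        rw [hl.nxt r' (by omega)] at hne
        have := hne.resolve_left (ho.ne_zero (by omega) (by omega))
        refine .inr ?_
        rw [labs]
        omega

def searchStep : Prog :=
  assign 15 (reg 15 + 2) ⨾ assign 16 (reg 16 * 2) ⨾ assign 17 (reg 17 * 4) ⨾
    assign 18 (ld .lab (reg 3) / reg 17 * reg 17)

def searchInit : Prog :=
  assign 12 (reg 3) ⨾ assign 13 (reg 4) ⨾ assign 14 2 ⨾ assign 15 0 ⨾ assign 16 1 ⨾ assign 17 1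

/-- Finds the smallest block around register `3` that is not too crowded to be spread. -/
def searchProg : Prog :=
  searchInit ⨾ loop (reg 14 - reg 16) (searchStep ⨾ leftLoop ⨾ rightLoop)

/-- The situation after blocks up to length `4 ^ j` were examined. -/
structure Searched (N : ℕ) (el : ℕ → ℕ) (x j l r : ℕ) (s s' : State) : Prop where
  same : Same [12, 13, 14, 15, 16, 17, 18] [] s s'
  r12 : s'.reg 12 = el l
  r13 : s'.reg 13 = el r
  r14 : s'.reg 14 = r + 1 - l
  r15 : s'.reg 15 = 2 * j
  r16 : s'.reg 16 = 2 ^ j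
  r17 : s'.reg 17 = 2 ^ (2 * j)
  lx : l ≤ x
  xr : x + 1 ≤ r
  rN : r < N
  pow_lt : 2 ^ j < 2 * N
  inside : ∀ q, l ≤ q → q ≤ r → labs s el q / 2 ^ (2 * j) = labs s el x / 2 ^ (2 * j)
  block : 1 ≤ j → Block N (labs s el) j (labs s el x / 2 ^ (2 * j)) l r ∧
    s'.reg 18 = labs s el x / 2 ^ (2 * j) * 2 ^ (2 * j)
  crowded : 2 ≤ j →
    2 ^ (j - 1) < cnt N (labs s el) (j - 1) (labs s el x / 2 ^ (2 * (j - 1)))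

/-- The two ends only move outward and are kept from one level to the next, so the total time is
linear in the final population plus the number of levels. The failure of the last but one level is
recorded in `crowded`; it is what pays for the spreading. -/
theorem runs_searchProg {x : ℕ} (ho : Order N el) (hl : Links N el s) (hNA : N ≤ M.A)
    (hAV : M.A < M.V) (hNV : 4 * N * N ≤ M.V) (hx : x + 1 < N) (h3 : s.reg 3 = el x)
    (h4 : s.reg 4 = el (x + 1)) (hmono : ∀ p q, p ≤ q → q < N → labs s el p ≤ labs s el q) 
    (htie : labs s el (x + 1) = labs s el x) :
    Runs M searchProg s fun t s' => ∃ j l r, 1 ≤ j ∧ Searched N el x j l r s s' ∧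
      r + 1 - l ≤ 2 ^ j ∧ t ≤ 2000 * (2 ^ j + j + 1) := by
  refine .seq ((Runs.straight (R := Searched N el x 0 x (x + 1) s) (by decide) ?_).mono ?_)
  · have h5 := M.hV
    have h6 := ho.lt x (by omega)
    have h7 := ho.lt (x + 1) hx
    simp only [searchInit, swp, safe_reg, eval_reg, true_and, safe_ofNat, eval_ofNat,
      State.reg_put, Nat.reduceEqDiff, if_false, h3, h4]
    refine ⟨by omega, by omega, by omega, by omega, by omega, by omega, ?_⟩
    exact
      { same := Same.refl.put.put.put.put.put.put
        r12 := by simp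
        r13 := by simp
        r14 := by simp; omega
        r15 := by simp
        r16 := by simp
        r17 := by simp
        lx := le_rfl
        xr := le_rfl
        rN := hx
        pow_lt := by simp; omega
        inside := by
          intro q h1 h2
          obtain rfl | rfl : q = x ∨ q = x + 1 := by omega
          · rfl
          · rw [htie]
        block := by omega
        crowded := by omega }
  intro t₀ s₀ ⟨ht₀, hs₀⟩
  have ht₀ : t₀ ≤ 40 := ht₀.trans (by decide)
  have hcost : (reg 14 - reg 16 : Exp).cost = 3 := rfl
  refine Runs.loop (by decide) (fun m t s' => ∃ j l r, m + j = 2 * N ∧ Searched N el x j l r s s' ∧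
    t ≤ 1000 * (r + 1 - l + j)) (m := 2 * N) ⟨0, x, x + 1, rfl, hs₀, by omega⟩ ?_ ?_ ?_
  · intros
    simp
  · rintro m t s' ⟨j, l, r, hm, hs, ht⟩ hb hne
    have hlx := hs.lx
    have hxr := hs.xr
    have hrN := hs.rN
    simp only [eval_sub, eval_reg, hs.r14, hs.r16, ne_eq] at hne
    -- A level that fails has more than `2 ^ j` of the `N` elements. This bounds the number of
    -- rounds and the next block length.
    have hpow : 2 ^ (j + 1) < 2 * N := by rw [pow_succ]; omega
    have hj : 2 * (j + 1) < 2 * N := by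
      have : j < 2 ^ j := Nat.lt_two_pow_self
      rw [pow_succ] at hpow
      omega
    have hlen : 2 ^ (2 * (j + 1)) < 4 * N * N := by
      rw [two_mul, pow_add]
      calc 2 ^ (j + 1) * 2 ^ (j + 1) < (2 * N) * (2 * N) := Nat.mul_lt_mul'' hpow hpow
        _ = 4 * N * N := by ring
    have hlen' : 2 ^ (2 * j) * 4 = 2 ^ (2 * (j + 1)) := by
      rw [mul_add, pow_add]; norm_num
    have hN : 2 * N ≤ 4 * N * N := by nlinarith
    have hx' := ho.lt x (by omega)
    obtain ⟨g, hg⟩ : ∃ g, g = labs s el x / 2 ^ (2 * (j + 1)) := ⟨_, rfl⟩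
    have hbase : g * 2 ^ (2 * (j + 1)) ≤ labs s el x := by
      rw [hg]; exact Nat.div_mul_le_self _ _
    have hiff : ∀ y, y / 2 ^ (2 * (j + 1)) = g ↔
        g * 2 ^ (2 * (j + 1)) ≤ y ∧ y < g * 2 ^ (2 * (j + 1)) + 2 ^ (2 * (j + 1)) := by
      intro y
      rw [Nat.div_eq_iff (by positivity)]
      have : 0 < 2 ^ (2 * (j + 1)) := by positivity
      omega
    refine .seq ((Runs.straight (R := fun s'' => s''.reg 15 = 2 * (j + 1) ∧
      s''.reg 16 = 2 ^ (j + 1) ∧ s''.reg 17 = 2 ^ (2 * (j + 1)) ∧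
      s''.reg 18 = g * 2 ^ (2 * (j + 1)) ∧
      Same [15, 16, 17, 18] [] s' s'') (by decide) ?_).mono ?_)
    · have hlab := hb.fld .lab (s.reg 3)
      rw [hs.same.2 .lab (by decide), h3] at hlab
      simp [searchStep, swp, hs.r15, hs.r16, hs.r17, hs.same.1 3, h3, hs.same.2 .lab, hlen',
        ← pow_succ]
      refine ⟨by omega, by omega, by omega, by omega, ?_, by omega, by rw [hg]; rfl,
        Same.refl.put.put.put.put⟩
      exact lt_of_le_of_lt (Nat.div_mul_le_self _ _) hlab
    rintro t₁ s₁ ⟨ht₁, e15, e16, e17, e18, hS₁⟩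
    have ht₁ : t₁ ≤ 50 := ht₁.trans (by decide)
    have hS₁' := hs.same.trans hS₁
    refine .seq ((runs_leftLoop ho (hl.congr (hS₁'.2 _ (by decide)) (hS₁'.2 _ (by decide))) hNA hAV
      ((hS₁.1 12 (by decide)).trans hs.r12) ((hS₁.1 14 (by decide)).trans hs.r14) e18 (by omega)
      (by omega)).mono ?_)
    rintro t₂ s₂ ⟨l', hl', f12, f14, ht₂, hS₂, hfirst, hleft⟩
    have hS₂' := hS₁'.trans hS₂
    refine (runs_rightLoop ho (hl.congr (hS₂'.2 _ (by decide)) (hS₂'.2 _ (by decide))) hNA hAV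
      ((hS₂.1 13 (by decide)).trans ((hS₁.1 13 (by decide)).trans hs.r13)) f14
      ((hS₂.1 18 (by decide)).trans e18) ((hS₂.1 17 (by decide)).trans e17) hrN
      (by omega)).mono ?_
    rintro t₃ s₃ ⟨r', hr', hr'N, g13, g14, ht₃, hS₃, hlast, hright⟩
    have hS₃' := hS₂'.trans hS₃
    have hlabs : ∀ q, labs s₁ el q = labs s el q := fun q => by
      rw [labs, labs, hS₁'.2 _ (by decide)]
    have hlabs' : ∀ q, labs s₂ el q = labs s el q := fun q => by
      rw [labs, labs, hS₂'.2 _ (by decide)]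
    simp only [hlabs, hlabs'] at hfirst hleft hlast hright
    have hin : ∀ q, l ≤ q → q ≤ r → labs s el q / 2 ^ (2 * (j + 1)) = g := by
      intro q hq1 hq2
      rw [hg, ← div_pow_div, ← div_pow_div (i := j), hs.inside q hq1 hq2]
    have hin' : ∀ q, l' ≤ q → q ≤ r' → labs s el q / 2 ^ (2 * (j + 1)) = g := by
      intro q hq1 hq2
      rcases lt_or_ge q l with h | h
      · have h1 := hleft q hq1 h
        have h2 := hmono q x (by omega) (by omega)
        have h3 := (hiff _).1 hg.symm
        exact (hiff _).2 ⟨h1, by omega⟩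
      · rcases le_or_gt q r with h' | h'
        · exact hin q h h'
        · have h1 := hright q h' hq2
          have h2 := hmono x q (by omega) (by omega)
          exact (hiff _).2 ⟨by omega, h1⟩
    refine ⟨m - 1, by omega, j + 1, l', r', by omega, ?_, by omega⟩
    exact
      { same := hS₃'.weaken
        r12 := by rw [hS₃.1 12 (by decide), f12]
        r13 := g13
        r14 := by rw [g14]; omega
        r15 := by rw [hS₃.1 15 (by decide), hS₂.1 15 (by decide), e15]
        r16 := by rw [hS₃.1 16 (by decide), hS₂.1 16 (by decide), e16]
        r17 := by rw [hS₃.1 17 (by decide), hS₂.1 17 (by decide), e17]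
        lx := by omega
        xr := by omega
        rN := hr'N
        pow_lt := hpow
        inside := by rw [← hg]; exact hin'
        block := by
          intro _
          rw [← hg, hS₃.1 18 (by decide), hS₂.1 18 (by decide), e18]
          refine ⟨⟨fun q hq => ⟨fun h => hin' q h.1 h.2, fun h => ?_⟩, by omega, hr'N⟩, rfl⟩
          have h1 := (hiff _).1 h
          constructor
          · by_contra hlt
            have h2 := hmono q (l' - 1) (by omega) (by omega)
            omega
          · by_contra hlt
            have h2 := hmono (r' + 1) q (by omega) hq
            omega
        crowded := by
          intro hj2
          rw [Nat.add_sub_cancel, cnt_eq_card_Icc (hs.block (by omega)).1]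
          omega }
  · rintro m t s' ⟨j, l, r, hm, hs, ht⟩ hb he
    simp only [eval_sub, eval_reg, hs.r14, hs.r16] at he
    have hlx := hs.lx
    have hxr := hs.xr
    refine ⟨j, l, r, ?_, hs, by omega, by omega⟩
    -- Level 0 cannot succeed: it already contains both `x` and `x + 1`, and only one element is
    -- allowed.
    by_contra hj
    obtain rfl : j = 0 := by omega
    rw [pow_zero] at he
    omega

end

end Nca

/-! ### Spreading a block and recomputing its rows. -/

namespace Nca

open RAM RAM.Prog RAM.Exp

theorem rows_disjoint {x y K : ℕ} (h : x ≠ y) : x * K + K ≤ y * K ∨ y * K + K ≤ x * K := by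
  rcases Nat.lt_or_gt_of_ne h with h | h
  · left
    calc x * K + K = (x + 1) * K := by ring
      _ ≤ y * K := Nat.mul_le_mul_right K h
  · right
    calc y * K + K = (y + 1) * K := by ring
      _ ≤ x * K := Nat.mul_le_mul_right K h

theorem row_le {e N K A : ℕ} (h : e < N) (hA : N * K ≤ A) : e * K + K ≤ A := by
  calc e * K + K = (e + 1) * K := by ring
    _ ≤ N * K := Nat.mul_le_mul_right K h
    _ ≤ A := hA

def fwdInit : Prog := assign 19 (reg 14) ⨾ assign 20 (reg 12) ⨾ assign 21 (reg 18)

def fwdHead : Prog :=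
  sto .lab (reg 20) (reg 21) ⨾ assign 6 0 ⨾ assign 22 1 ⨾ assign 8 (reg 20 * reg 10) ⨾
    assign 7 (ld .prv (reg 20) * reg 10)

def fwdTail : Prog :=
  assign 20 (ld .nxt (reg 20)) ⨾ assign 21 (reg 21 + reg 16) ⨾ assign 19 (reg 19 - 1)

/-- Spreads the labels in a block and computes the rows of the first table. -/
def fwdProg : Prog := fwdInit ⨾ loop (reg 19) (fwdHead ⨾ preLoop ⨾ fwdTail)

def bwdInit : Prog := assign 19 (reg 14) ⨾ assign 20 (reg 13) ⨾ assign 23 0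

def bwdHead : Prog :=
  assign 6 0 ⨾ assign 22 1 ⨾ assign 8 (reg 20 * reg 10) ⨾ assign 7 (reg 23 * reg 10)

def bwdTail : Prog :=
  assign 23 (reg 20) ⨾ assign 20 (ld .prv (reg 20)) ⨾ assign 21 (reg 21 - reg 16) ⨾
    assign 19 (reg 19 - 1)

/-- Computes the rows of the second table in a block. -/
def bwdProg : Prog := bwdInit ⨾ loop (reg 19) (bwdHead ⨾ sufLoop ⨾ bwdTail)

/-- The registers describe a block that is to be spread. -/
structure Spreadable (M : Cfg) (N : ℕ) (el : ℕ → ℕ) (a : ℕ → ℕ) (K j g l r : ℕ) (s : State) :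
    Prop where
  order : Order N el
  links : Links N el s
  block : Block N a j g l r
  few : r + 1 - l ≤ 2 ^ j
  mono : ∀ p q, p < q → q < N → spread a j g l r p < spread a j g l r q
  hK : 2 * j ≤ K
  hA : N * K ≤ M.A
  hNA : N ≤ M.A
  hAV : M.A < M.V
  hV : g * 2 ^ (2 * j) + 2 ^ (2 * j) < M.V
  r10 : s.reg 10 = K
  r12 : s.reg 12 = el l
  r13 : s.reg 13 = el r
  r14 : s.reg 14 = r + 1 - l
  r15 : s.reg 15 = 2 * j
  r16 : s.reg 16 = 2 ^ j
  r18 : s.reg 18 = g * 2 ^ (2 * j)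

theorem spread_add {a : ℕ → ℕ} {j g l r : ℕ} (d : ℕ) (hd : l + d ≤ r) :
    spread a j g l r (l + d) = g * 2 ^ (2 * j) + d * 2 ^ j := by
  rw [spread, if_pos (by omega), Nat.add_sub_cancel_left]

namespace Spreadable

variable {M : Cfg} {s s' : State} {N : ℕ} {el a : ℕ → ℕ} {K j g l r : ℕ}

theorem congr {R : List ℕ} {F : List Field} (h : Spreadable M N el a K j g l r s)
    (hS : Same R F s s')
    (h1 : ∀ i ∈ R, i ∉ [10, 12, 13, 14, 15, 16, 18] := by decide)
    (h2 : Field.nxt ∉ F := by decide) (h3 : Field.prv ∉ F := by decide) :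
    Spreadable M N el a K j g l r s' :=
  { h with
    links := h.links.congr (hS.2 _ h2) (hS.2 _ h3)
    r10 := by rw [hS.1 10 fun h' => h1 10 h' (by decide), h.r10]
    r12 := by rw [hS.1 12 fun h' => h1 12 h' (by decide), h.r12]
    r13 := by rw [hS.1 13 fun h' => h1 13 h' (by decide), h.r13]
    r14 := by rw [hS.1 14 fun h' => h1 14 h' (by decide), h.r14]
    r15 := by rw [hS.1 15 fun h' => h1 15 h' (by decide), h.r15]
    r16 := by rw [hS.1 16 fun h' => h1 16 h' (by decide), h.r16]
    r18 := by rw [hS.1 18 fun h' => h1 18 h' (by decide), h.r18] }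

theorem label_eq (d : ℕ) : g * 2 ^ (2 * j) + d * 2 ^ j = (g * 2 ^ j + d) * 2 ^ j := by
  rw [two_mul, pow_add]
  ring

theorem label_lt {d : ℕ} (h : Spreadable M N el a K j g l r s) (hd : d ≤ r + 1 - l) :
    g * 2 ^ (2 * j) + d * 2 ^ j < M.V := by
  refine lt_of_le_of_lt (Nat.add_le_add_left ?_ _) h.hV
  rw [two_mul, pow_add]
  exact Nat.mul_le_mul_right _ (hd.trans h.few)

theorem pow_lt (h : Spreadable M N el a K j g l r s) : 2 ^ (2 * j) < M.V := by
  have := h.hV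
  omega

theorem base_mod {k : ℕ} (hk : k < 2 * j) : (g * 2 ^ (2 * j)) % 2 ^ k = 0 :=
  Nat.mod_eq_zero_of_dvd ((pow_dvd_pow 2 hk.le).mul_left g)

/-- The entries of the first table that are computed in the block. -/
theorem preOk_preVal {key : ℕ → ℤ} {d k z : ℕ} (h : Spreadable M N el a K j g l r s)
    (hd : l + d ≤ r) (hk : k < 2 * j)
    (hz : ∀ d', d = d' + 1 → PreOk el key (spread a j g l r) (l + d') k z) :
    PreOk el key (spread a j g l r) (l + d) k
      (preVal key (g * 2 ^ (2 * j) + d * 2 ^ j) k (el (l + d)) z) := by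
  have hrN := h.block.lt
  unfold preVal
  by_cases h0 : (g * 2 ^ (2 * j) + d * 2 ^ j) % 2 ^ k = 0
  · rw [if_pos h0]
    refine preOk_new fun q hq => ?_
    have h1 := h.mono q (l + d) hq (by omega)
    rw [spread_add d hd] at *
    exact (div_lt_of_mod_eq_zero h1 h0).ne
  · rw [if_neg h0]
    cases d with
    | zero =>
      rw [Nat.zero_mul, add_zero] at h0
      exact absurd (base_mod hk) h0
    | succ d =>
      refine preOk_succ ?_ (hz d rfl)
      rw [Nat.add_eq, spread_add d (by omega), add_assoc, spread_add (d + 1) hd, label_eq, label_eq]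
      rw [label_eq, ← add_assoc, add_mul _ 1, one_mul] at h0
      rw [← add_assoc, add_mul _ 1, one_mul]
      exact (div_add_pow h0).symm

/-- The entries of the second table that are computed in the block. -/
theorem sufOk_sufVal {key : ℕ → ℤ} {d k z e : ℕ} (h : Spreadable M N el a K j g l r s)
    (hd : l + d ≤ r) (hk : k < 2 * j) (he : l + d = r → e = 0)
    (hz : l + d < r → e = el (l + d + 1) ∧
      SufOk N el key (spread a j g l r) (l + d + 1) k z) :
    SufOk N el key (spread a j g l r) (l + d) k
      (sufVal key (g * 2 ^ (2 * j) + (d + 1) * 2 ^ j) k e z) := by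
  have hrN := h.block.lt
  have hsd := spread_add (a := a) (j := j) (g := g) d hd
  unfold sufVal
  rcases Nat.eq_or_lt_of_le hd with hr | hr
  · rw [if_pos (.inr (he hr))]
    refine sufOk_new fun q hq1 hq2 h1 => ?_
    obtain ⟨c, hc⟩ := Nat.exists_eq_add_of_le hk.le
    have h2 : spread a j g l r q / 2 ^ (2 * j) = spread a j g l r (l + d) / 2 ^ (2 * j) := by
      rw [hc, pow_add, ← Nat.div_div_eq_div_mul, h1, Nat.div_div_eq_div_mul]
    rw [h.block.spread_div h.few hq2, h.block.spread_div h.few (by omega),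
      (h.block.mem (l + d) (by omega)).1 (by omega)] at h2
    have := (h.block.mem q hq2).2 h2
    omega
  · obtain ⟨rfl, hz'⟩ := hz hr
    have hs' := spread_add (a := a) (j := j) (g := g) (l := l) (r := r) (d + 1) (by omega)
    have hne := h.order.ne_zero (i := l + d + 1) (by omega) (by omega)
    by_cases h0 : (g * 2 ^ (2 * j) + (d + 1) * 2 ^ j) % 2 ^ k = 0
    · rw [if_pos (.inl h0)]
      refine sufOk_new fun q hq1 hq2 => ?_
      have h1 : spread a j g l r (l + (d + 1)) ≤ spread a j g l r q := by
        rcases Nat.eq_or_lt_of_le (show l + (d + 1) ≤ q by omega) with rfl | hlt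
        · exact le_rfl
        · exact (h.mono _ _ hlt hq2).le
      have h2 := h.mono (l + d) (l + (d + 1)) (by omega) (by omega)
      rw [hs'] at h1 h2
      have h3 := div_lt_of_mod_eq_zero h2 h0
      have h4 := Nat.div_le_div_right (c := 2 ^ k) h1
      omega
    · rw [if_neg (by tauto)]
      refine sufOk_pred h.order (by omega) ?_ hz'
      rw [add_assoc, hs', hsd, label_eq, label_eq]
      rw [label_eq, ← add_assoc, add_mul _ 1, one_mul] at h0
      rw [← add_assoc, add_mul _ 1, one_mul]
      exact div_add_pow h0

/-- The positions are treated from left to right, each row using the one before it. The first label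
is a multiple of `4 ^ j`, so for `k < 2 * j` nothing to the left of the block is consulted. -/
theorem runs_fwdProg (h : Spreadable M N el (labs s el) K j g l r s) :
    Runs M fwdProg s fun t s' => t ≤ 1000 * ((r + 1 - l + 1) * (2 * j + 1)) ∧
      Same [6, 7, 8, 19, 20, 21, 22, 24] [.lab, .pre] s s' ∧
      s'.reg 21 = g * 2 ^ (2 * j) + (r + 1 - l) * 2 ^ j ∧
      (∀ q < N, labs s' el q = spread (labs s el) j g l r q) ∧
      ∀ q < N, ∀ k < K, (l ≤ q ∧ q ≤ r ∧ k < 2 * j →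
          PreOk el (key s) (spread (labs s el) j g l r) q k (s'.fld .pre (el q * K + k))) ∧
        (¬(l ≤ q ∧ q ≤ r ∧ k < 2 * j) →
          s'.fld .pre (el q * K + k) = s.fld .pre (el q * K + k)) := by
  have hAV := h.hAV
  have hNA := h.hNA
  have hlr := h.block.le
  have hrN := h.block.lt
  have hKj := h.hK
  have hb' : s.Bdd M.V → g * 2 ^ (2 * j) < M.V := fun hb => h.r18 ▸ hb.1 18
  refine .of_bdd fun hb₀ => .seq ((Runs.straight (R := fun s' => s'.reg 19 = r + 1 - l ∧
    s'.reg 20 = el l ∧ s'.reg 21 = g * 2 ^ (2 * j) ∧ Same [19, 20, 21] [] s s') (by decide)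
    ?_).mono ?_)
  · have := h.order.lt l (by omega)
    simp [fwdInit, swp, h.r14, h.r12, h.r18]
    exact ⟨by omega, by omega, hb' hb₀, Same.refl.put.put.put⟩
  rintro t₀ s₀ ⟨ht₀, e19, e20, e21, hS₀⟩
  have ht₀ : t₀ ≤ 20 := ht₀.trans (by decide)
  refine Runs.loop (by decide) (fun m t s' => ∃ d, d + m = r + 1 - l ∧ s'.reg 19 = m ∧
    (0 < m → s'.reg 20 = el (l + d)) ∧ s'.reg 21 = g * 2 ^ (2 * j) + d * 2 ^ j ∧
    t ≤ 900 * (d * (2 * j + 1)) ∧ Same [6, 7, 8, 19, 20, 21, 22, 24] [.lab, .pre] s s' ∧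
    (∀ q < N, labs s' el q = if l ≤ q ∧ q < l + d then spread (labs s el) j g l r q else
      labs s el q) ∧
      ∀ q < N, ∀ k < K, (l ≤ q ∧ q < l + d ∧ k < 2 * j →
          PreOk el (key s) (spread (labs s el) j g l r) q k (s'.fld .pre (el q * K + k))) ∧
        (¬(l ≤ q ∧ q < l + d ∧ k < 2 * j) →
          s'.fld .pre (el q * K + k) = s.fld .pre (el q * K + k))) (m := r + 1 - l)
    ⟨0, by omega, e19, fun _ => e20, by rw [e21]; omega, by omega, hS₀.weaken, fun q _ => ?_,
      fun q _ k _ => ⟨by omega, fun _ => ?_⟩⟩ ?_ ?_ ?_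
  · rw [labs, labs, hS₀.2 _ (by decide), if_neg (by omega)]
  · rw [hS₀.2 _ (by decide)]
  · intros
    simp
  · rintro m t s' ⟨d, hd, i19, i20, i21, ht, hS, hlab, hpre⟩ hb hne
    simp only [eval_reg, i19] at hne
    have i20 := i20 (Nat.pos_of_ne_zero hne)
    have hs' := h.congr hS
    have hq := h.order.lt (l + d) (by omega)
    have hp := hs'.links.prv_lt h.order (show l + d < N by omega)
    have hn := hs'.links.nxt_lt h.order (show l + d < N by omega)
    have hrow := row_le hq h.hA
    have hrowp := row_le hp h.hA
    refine .seq ((Runs.straight (R := fun s'' => s''.reg 6 = 0 ∧ s''.reg 22 = 1 ∧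
      s''.reg 8 = el (l + d) * K ∧ s''.reg 7 = s'.fld .prv (el (l + d)) * K ∧
      Same [6, 7, 8, 22] [.lab] s' s'' ∧
      ∀ i, s''.fld .lab i = if i = el (l + d) then g * 2 ^ (2 * j) + d * 2 ^ j else
        s'.fld .lab i) (by decide) ?_).mono ?_)
    · have := h.label_lt (d := d) (by omega)
      simp [fwdHead, swp, swp_sto, i20, i21, hs'.r10]
      exact ⟨by omega, by omega, by omega, by omega, by omega, by omega, by omega,
        Same.refl.setFld.put.put.put.put⟩
    rintro t₁ s₁ ⟨ht₁, f6, f22, f8, f7, hS₁, hlab₁⟩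
    have ht₁ : t₁ ≤ 60 := ht₁.trans (by decide)
    have hpre₁ : s₁.fld .pre = s'.fld .pre := hS₁.2 _ (by decide)
    have hprev : ∀ d', d = d' + 1 → s'.fld .prv (el (l + d)) = el (l + d') := by
      rintro d' rfl
      exact hs'.links.prv (l + d') (by omega)
    have hz : ∀ k < 2 * j, ∀ d', d = d' + 1 → PreOk el (key s) (spread (labs s el) j g l r)
        (l + d') k (s₁.fld .pre (s'.fld .prv (el (l + d)) * K + k)) := by
      intro k hk d' hd'
      rw [hpre₁, hprev d' hd']
      exact (hpre (l + d') (by omega) k (by omega)).1 ⟨by omega, by omega, hk⟩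
    refine .seq ((runs_preLoop (K := 2 * j) (v := g * 2 ^ (2 * j) + d * 2 ^ j) (e := el (l + d))
      ((hS₁.1 15 (by decide)).trans hs'.r15) f6 f22 f7 f8 ((hS₁.1 21 (by decide)).trans i21)
      ((hS₁.1 20 (by decide)).trans i20) hAV h.pow_lt (by omega) (by omega) ?_ (by omega)
      ?_).mono ?_)
    -- Equality can occur only at the sentinel, whose backward pointer is arbitrary.
    · by_cases heq : s'.fld .prv (el (l + d)) = el (l + d)
      · rw [heq]
        exact .inl rfl
      · have := rows_disjoint (K := K) heq
        omega
    · intro k hk hmod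
      cases d with
      | zero =>
        rw [Nat.zero_mul, add_zero] at hmod
        exact absurd (base_mod hk) hmod
      | succ d =>
        have := preOk_lt (hz k hk d rfl) h.order (by omega)
        omega
    rintro t₂ s₂ ⟨ht₂, hS₂, hpre₂⟩
    have hkey : key s₁ = key s := (hS.trans hS₁).key
    have hS₂' := (hS₁.weaken (R' := [6, 7, 8, 22, 24]) (F' := [.lab, .pre])).trans hS₂
    refine (Runs.straight (R := fun s'' => s''.reg 19 = m - 1 ∧
      (s''.reg 20 = s'.fld .nxt (el (l + d))) ∧
      s''.reg 21 = g * 2 ^ (2 * j) + (d + 1) * 2 ^ j ∧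
      Same [19, 20, 21] [] s₂ s'') (by decide) ?_).mono ?_
    · have h1 := h.label_lt (d := d + 1) (by omega)
      have f20 : s₂.reg 20 = el (l + d) := by rw [hS₂'.1 20 (by decide), i20]
      have f21 : s₂.reg 21 = g * 2 ^ (2 * j) + d * 2 ^ j := by rw [hS₂'.1 21 (by decide), i21]
      have f16 : s₂.reg 16 = 2 ^ j := by rw [hS₂'.1 16 (by decide), hs'.r16]
      have f19 : s₂.reg 19 = m := by rw [hS₂'.1 19 (by decide), i19]
      have f : g * 2 ^ (2 * j) + d * 2 ^ j + 2 ^ j = g * 2 ^ (2 * j) + (d + 1) * 2 ^ j := by ring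
      simp [fwdTail, swp, f20, f21, f16, f19, hS₂'.2 .nxt (by decide), f]
      exact ⟨by omega, by omega, h1, by omega, Same.refl.put.put.put⟩
    rintro t₃ s₃ ⟨ht₃, k19, k20, k21, hS₃⟩
    have ht₃ : t₃ ≤ 60 := ht₃.trans (by decide)
    have hcost : (reg 19 : Exp).cost = 1 := rfl
    refine ⟨m - 1, by omega, d + 1, by omega, k19, fun hm => ?_, k21, ?_,
      (hS.trans hS₂').trans hS₃, fun q hq => ?_, fun q hq k hk => ?_⟩
    · rw [k20, hs'.links.nxt (l + d) (by omega), add_assoc]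
    · rw [hcost, add_mul d]
      omega
    · rw [labs, hS₃.2 _ (by decide), hS₂.2 _ (by decide), hlab₁]
      by_cases heq : q = l + d
      · subst heq
        rw [if_pos rfl, if_pos (by omega), spread_add d (by omega)]
      · rw [if_neg fun h' => heq (h.order.inj q hq (l + d) (by omega) h')]
        refine (hlab q hq).trans ?_
        split_ifs <;> first | rfl | omega
    · rw [hS₃.2 _ (by decide), hpre₂, hpre₁, hkey]
      have h1 := hpre q hq k hk
      by_cases heq : q = l + d
      · subst heq
        constructor
        · rintro ⟨-, -, hk2⟩
          rw [if_pos (by omega), Nat.add_sub_cancel_left]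
          refine h.preOk_preVal (by omega) hk2 fun d' hd' => ?_
          rw [← hpre₁]
          exact hz k hk2 d' hd'
        · intro h2
          rw [if_neg (by omega)]
          exact h1.2 (by omega)
      · have h2 := rows_disjoint (K := K) fun h' =>
          heq (h.order.inj q hq (l + d) (by omega) h')
        rw [if_neg (by omega)]
        exact ⟨fun h3 => h1.1 (by omega), fun h3 => h1.2 (by omega)⟩
  · rintro m t s' ⟨d, hd, i19, i20, i21, ht, hS, hlab, hpre⟩ hb hne
    simp only [eval_reg, i19] at hne
    obtain rfl : d = r + 1 - l := by omega
    have hcost : (reg 19 : Exp).cost = 1 := rfl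
    refine ⟨?_, hS, i21, fun q hq => ?_, fun q hq k hk => ?_⟩
    · rw [hcost, add_mul (r + 1 - l)]
      omega
    · rw [hlab q hq, spread]
      split_ifs <;> first | rfl | omega
    · have h1 := hpre q hq k hk
      exact ⟨fun h2 => h1.1 (by omega), fun h2 => h1.2 (by omega)⟩

/-- From right to left, with register 21 holding the label of the right neighbour; hence it starts
one gap beyond the last label. Register 23 is the right neighbour, or `0` at the end of the block.
The parameter `b` stands for the labels before the spreading, which memory may no longer hold. -/
theorem runs_bwdProg {b : ℕ → ℕ} (h : Spreadable M N el b K j g l r s)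
    (h21 : s.reg 21 = g * 2 ^ (2 * j) + (r + 1 - l) * 2 ^ j) :
    Runs M bwdProg s fun t s' => t ≤ 1000 * ((r + 1 - l + 1) * (2 * j + 1)) ∧
      Same [6, 7, 8, 19, 20, 21, 22, 23, 24] [.suf] s s' ∧
      ∀ q < N, ∀ k < K, (l ≤ q ∧ q ≤ r ∧ k < 2 * j →
          SufOk N el (key s) (spread b j g l r) q k (s'.fld .suf (el q * K + k))) ∧
        (¬(l ≤ q ∧ q ≤ r ∧ k < 2 * j) →
          s'.fld .suf (el q * K + k) = s.fld .suf (el q * K + k)) := by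
  have hAV := h.hAV
  have hNA := h.hNA
  have hlr := h.block.le
  have hrN := h.block.lt
  have hKj := h.hK
  have hcost : (reg 19 : Exp).cost = 1 := rfl
  refine .seq ((Runs.straight (R := fun s' => s'.reg 19 = r + 1 - l ∧
    s'.reg 20 = el r ∧ s'.reg 23 = 0 ∧ Same [19, 20, 23] [] s s') (by decide)
    ?_).mono ?_)
  · have := h.order.lt r (by omega)
    simp [bwdInit, swp, h.r14, h.r13]
    exact ⟨by omega, by omega, by omega, Same.refl.put.put.put⟩
  rintro t₀ s₀ ⟨ht₀, e19, e20, e23, hS₀⟩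
  have ht₀ : t₀ ≤ 20 := ht₀.trans (by decide)
  refine Runs.loop (by decide) (fun m t s' => m ≤ r + 1 - l ∧ s'.reg 19 = m ∧
    (0 < m → s'.reg 20 = el (l + m - 1)) ∧ s'.reg 21 = g * 2 ^ (2 * j) + m * 2 ^ j ∧
    (s'.reg 23 = if m = r + 1 - l then 0 else el (l + m)) ∧
    t ≤ 900 * ((r + 1 - l - m) * (2 * j + 1)) ∧
    Same [6, 7, 8, 19, 20, 21, 22, 23, 24] [.suf] s s' ∧
      ∀ q < N, ∀ k < K, (l + m ≤ q ∧ q ≤ r ∧ k < 2 * j →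
          SufOk N el (key s) (spread b j g l r) q k (s'.fld .suf (el q * K + k))) ∧
        (¬(l + m ≤ q ∧ q ≤ r ∧ k < 2 * j) →
          s'.fld .suf (el q * K + k) = s.fld .suf (el q * K + k))) (m := r + 1 - l)
    ⟨le_rfl, e19, fun _ => ?_, ?_, ?_, by omega, hS₀.weaken,
      fun q _ k _ => ⟨by omega, fun _ => ?_⟩⟩ ?_ ?_ ?_
  · rw [e20]
    congr 1
    omega
  · rw [hS₀.1 21 (by decide), h21]
  · rw [if_pos rfl, e23]
  · rw [hS₀.2 _ (by decide)]
  · intros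
    simp
  · rintro m t s' ⟨hm, i19, i20, i21, i23, ht, hS, hsuf⟩ hb hne
    simp only [eval_reg, i19] at hne
    have i20 := i20 (Nat.pos_of_ne_zero hne)
    obtain ⟨m, rfl⟩ := Nat.exists_eq_succ_of_ne_zero hne
    rw [show l + m.succ - 1 = l + m by omega] at i20
    simp only [Nat.succ_eq_add_one] at *
    have hs' := h.congr hS
    have hq := h.order.lt (l + m) (by omega)
    have hp := hs'.links.prv_lt h.order (show l + m < N by omega)
    have hrow := row_le hq h.hA
    obtain ⟨ne, hne'⟩ : ∃ ne, ne = s'.reg 23 := ⟨_, rfl⟩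
    have hneN : ne < N := by
      rw [hne', i23]
      split_ifs
      · omega
      · exact h.order.lt _ (by omega)
    have hrowp := row_le hneN h.hA
    refine .seq ((Runs.straight (R := fun s'' => s''.reg 6 = 0 ∧ s''.reg 22 = 1 ∧
      s''.reg 8 = el (l + m) * K ∧ s''.reg 7 = ne * K ∧
      Same [6, 7, 8, 22] [] s' s'') (by decide) ?_).mono ?_)
    · simp [bwdHead, swp, i20, hs'.r10, ← hne']
      exact ⟨by omega, by omega, by omega, by omega, Same.refl.put.put.put.put⟩
    rintro t₁ s₁ ⟨ht₁, f6, f22, f8, f7, hS₁⟩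
    have ht₁ : t₁ ≤ 60 := ht₁.trans (by decide)
    have hsuf₁ : s₁.fld .suf = s'.fld .suf := hS₁.2 _ (by decide)
    have hlast : l + m = r → ne = 0 := by
      intro hr
      rw [hne', i23, if_pos (by omega)]
    have hz : ∀ k < 2 * j, l + m < r → ne = el (l + m + 1) ∧
        SufOk N el (key s) (spread b j g l r) (l + m + 1) k (s₁.fld .suf (ne * K + k)) := by
      intro k hk hr
      have h1 : ne = el (l + m + 1) := by rw [hne', i23, if_neg (by omega), add_assoc]
      refine ⟨h1, ?_⟩
      rw [hsuf₁, h1]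
      exact (hsuf (l + m + 1) (by omega) k (by omega)).1 ⟨by omega, by omega, hk⟩
    refine .seq ((runs_sufLoop (K := 2 * j) (v := g * 2 ^ (2 * j) + (m + 1) * 2 ^ j) (e := ne)
      ((hS₁.1 15 (by decide)).trans hs'.r15) f6 f22 f7 f8 ((hS₁.1 21 (by decide)).trans i21)
      ((hS₁.1 23 (by decide)).trans hne'.symm) hAV h.pow_lt (by omega) (by omega) ?_ (by omega)
      ?_).mono ?_)
    · by_cases heq : ne = el (l + m)
      · rw [heq]
        exact .inl rfl
      · have := rows_disjoint (K := K) heq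
        omega
    · intro k hk hne0
      have := sufOk_lt (hz k hk (by by_contra hr; exact hne0 (hlast (by omega)))).2 h.order
        (by have := mt hlast hne0; omega)
      omega
    rintro t₂ s₂ ⟨ht₂, hS₂, hsuf₂⟩
    have hkey : key s₁ = key s := (hS.trans hS₁).key
    have hS₂' := (hS₁.weaken (R' := [6, 7, 8, 22, 24]) (F' := [.suf])).trans hS₂
    refine (Runs.straight (R := fun s'' => s''.reg 19 = m ∧
      (s''.reg 20 = s'.fld .prv (el (l + m))) ∧ s''.reg 23 = el (l + m) ∧
      s''.reg 21 = g * 2 ^ (2 * j) + m * 2 ^ j ∧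
      Same [19, 20, 21, 23] [] s₂ s'') (by decide) ?_).mono ?_
    · have h1 := h.label_lt (d := m) (by omega)
      have f20 : s₂.reg 20 = el (l + m) := by rw [hS₂'.1 20 (by decide), i20]
      have f21 : s₂.reg 21 = g * 2 ^ (2 * j) + m * 2 ^ j + 2 ^ j := by
        rw [hS₂'.1 21 (by decide), i21]
        ring
      have f16 : s₂.reg 16 = 2 ^ j := by rw [hS₂'.1 16 (by decide), hs'.r16]
      have f19 : s₂.reg 19 = m + 1 := by rw [hS₂'.1 19 (by decide), i19]
      simp [bwdTail, swp, f20, f21, f16, f19, hS₂'.2 .prv (by decide)]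
      exact ⟨by omega, by omega, by omega, by omega, by omega, Same.refl.put.put.put.put⟩
    rintro t₃ s₃ ⟨ht₃, k19, k20, k23, k21, hS₃⟩
    have ht₃ : t₃ ≤ 60 := ht₃.trans (by decide)
    refine ⟨m, by omega, by omega, k19, fun hm => ?_, k21, ?_, ?_,
      (hS.trans hS₂').trans hS₃, fun q hq k hk => ?_⟩
    · obtain ⟨m, rfl⟩ := Nat.exists_eq_succ_of_ne_zero hm.ne'
      rw [k20, Nat.succ_eq_add_one, ← add_assoc, hs'.links.prv (l + m) (by omega)]
      rfl
    · rw [k23, if_neg (by omega)]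
    · rw [hcost, show r + 1 - l - m = r + 1 - l - (m + 1) + 1 by omega, add_mul _ 1]
      omega
    · rw [hS₃.2 _ (by decide), hsuf₂, hsuf₁, hkey]
      have h1 := hsuf q hq k hk
      by_cases heq : q = l + m
      · subst heq
        constructor
        · rintro ⟨-, -, hk2⟩
          rw [if_pos (by omega), Nat.add_sub_cancel_left]
          refine h.sufOk_sufVal (by omega) hk2 hlast ?_
          rw [← hsuf₁]
          exact hz k hk2
        · intro h2
          rw [if_neg (by omega)]
          exact h1.2 (by omega)
      · have h2 := rows_disjoint (K := K) fun h' =>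
          heq (h.order.inj q hq (l + m) (by omega) h')
        rw [if_neg (by omega)]
        exact ⟨fun h3 => h1.1 (by omega), fun h3 => h1.2 (by omega)⟩
  · rintro m t s' ⟨hm, i19, i20, i21, i23, ht, hS, hsuf⟩ hb hne
    simp only [eval_reg, i19] at hne
    subst hne
    refine ⟨?_, hS, fun q hq k hk => ?_⟩
    · rw [Nat.sub_zero] at ht
      rw [hcost, add_mul (r + 1 - l)]
      omega
    · exact hsuf q hq k hk

end Spreadable

end Nca

/-! ### The representation invariant, and insertion with a tied label. -/

namespace Nca

open RAM RAM.Prog RAM.Exp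

/-- The machine is big enough for lists of length `N`. -/
structure Cap (M : Cfg) (N : ℕ) : Prop where
  len : 2 * N ≤ M.A
  rows : ∀ J, 2 ^ J ≤ 2 * N → N * (2 * J) ≤ M.A
  hAV : M.A < M.V
  hV : 16 * N * N ≤ M.V

theorem Cap.mono {M : Cfg} {N N' : ℕ} (h : Cap M N) (hN : N' ≤ N) : Cap M N' where
  len := by have := h.len; omega
  rows J hJ := (Nat.mul_le_mul_right _ hN).trans (h.rows J (by omega))
  hAV := h.hAV
  hV := (Nat.mul_le_mul (Nat.mul_le_mul_left _ hN) hN).trans h.hV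

/-- The state of the machine represents the list `el` of length `N`. -/
structure Repr (N J : ℕ) (el : ℕ → ℕ) (s : State) : Prop where
  order : Order N el
  links : Links N el s
  mono : ∀ p q, p < q → q < N → labs s el p < labs s el q
  lab_lt : ∀ q < N, labs s el q < 2 ^ (2 * J)
  r10 : s.reg 10 = 2 * J
  r11 : s.reg 11 = 2 ^ J
  one_le : 1 ≤ J
  pow_le : 2 ^ J ≤ 2 * N
  pre : ∀ q < N, ∀ k < 2 * J,
    PreOk el (key s) (labs s el) q k (s.fld .pre (el q * (2 * J) + k))
  suf : ∀ q < N, ∀ k < 2 * J,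
    SufOk N el (key s) (labs s el) q k (s.fld .suf (el q * (2 * J) + k))
  logs : Logs (2 ^ J) s

theorem Logs.congr {n : ℕ} {s s' : State} (h : Logs n s) (h1 : s'.fld .lg = s.fld .lg)
    (h2 : s'.fld .pl = s.fld .pl) : Logs n s' := by
  intro i hi hi'
  rw [h1, h2]
  exact h i hi hi'

/-- The new element receives the label of its predecessor, which is where `copyLoop` takes the new
row from. The tie lasts until `fwdProg`. -/
def linkProg : Prog :=
  assign 5 (ld .nxt (reg 3)) ⨾ sto .nxt (reg 3) (reg 4) ⨾ sto .nxt (reg 4) (reg 5) ⨾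
    sto .prv (reg 4) (reg 3) ⨾ sto .prv (reg 5) (reg 4) ⨾ sto .lab (reg 4) (ld .lab (reg 3)) ⨾
    assign 6 0 ⨾ assign 7 (reg 3 * reg 10) ⨾ assign 8 (reg 4 * reg 10)

/-- A block longer than the range of labels contains the whole list, so the stride of the rows may
change here without moving any entry: all rows are about to be recomputed. -/
def growProg : Prog :=
  ite (reg 15 - reg 10)
    (assign 19 (reg 11) ⨾ growLoop ⨾ assign 10 (reg 15) ⨾ assign 11 (reg 16)) skip

/-- Inserts the element in register `4` into the list after the element in register `3`. -/
def insertProg : Prog :=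
  (linkProg ⨾ copyLoop) ⨾ searchProg ⨾ growProg ⨾ fwdProg ⨾ bwdProg

theorem insAt_of_lt {α : Type*} (f : ℕ → α) (i : ℕ) (v : α) {q : ℕ} (h : i + 1 < q) :
    insAt f i v q = f (q - 1) := by
  rw [insAt, if_neg (by omega), if_neg (by omega)]

/-- Behind the last element `nx` is `0`, and the update of the backward pointers then overwrites
that of the sentinel. This is why `Links.first` asks no more of it than a valid address. -/
theorem links_insert {N x nx : ℕ} {el : ℕ → ℕ} {s s' : State} (ho : Order N el)
    (hl : Links N el s) (hx : x < N) (hnx : s.fld .nxt (el x) = nx)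
    (h1 : ∀ e, s'.fld .nxt e = if e = N then nx else if e = el x then N else s.fld .nxt e)
    (h2 : ∀ e, s'.fld .prv e = if e = nx then N else if e = N then el x else s.fld .prv e) :
    Links (N + 1) (insAt el x N) s' := by
  have hne : ∀ q < N, el q ≠ N := fun q hq => (ho.lt q hq).ne
  have hnxN : nx < N := hnx ▸ hl.nxt_lt ho hx
  have hnx' : ∀ q, 0 < q → q < N → (el q = nx ↔ q = x + 1) := by
    intro q hq0 hq
    by_cases hx' : x + 1 < N
    · rw [← hnx, hl.nxt x hx']
      exact ⟨fun h => ho.inj _ hq _ hx' h, fun h => h ▸ rfl⟩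
    · obtain rfl : x = N - 1 := by omega
      rw [hl.last] at hnx
      subst hnx
      exact ⟨fun h => absurd h (ho.ne_zero hq hq0), fun h => by omega⟩
  have old : ∀ q < N, q ≠ x → s'.fld .nxt (el q) = s.fld .nxt (el q) := by
    intro q hq hqx
    rw [h1, if_neg (hne q hq), if_neg fun h => hqx (ho.inj q hq x hx h)]
  refine ⟨fun i hi => ?_, ?_, fun i hi => ?_, ?_⟩
  · rcases lt_trichotomy i x with h | rfl | h
    · rw [insAt_of_le _ _ _ (by omega), insAt_of_le _ _ _ (by omega), old i (by omega) h.ne,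
        hl.nxt i (by omega)]
    · rw [insAt_of_le _ _ _ le_rfl, insAt_new, h1, if_neg (hne i hx), if_pos rfl]
    · obtain ⟨q, rfl⟩ := Nat.exists_eq_add_of_lt h
      have e1 : insAt el x N (x + q + 1 + 1) = el (x + q + 1) :=
        insAt_of_lt _ _ _ (by omega)
      rw [e1]
      cases q with
      | zero => rw [add_zero, insAt_new, h1, if_pos rfl, ← hnx, hl.nxt x (by omega)]
      | succ q =>
        have e2 : insAt el x N (x + (q + 1) + 1) = el (x + q + 1) :=
          insAt_of_lt _ _ _ (by omega)
        rw [e2, old _ (by omega) (by omega), hl.nxt _ (by omega)]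
        rfl
  · rw [Nat.add_sub_cancel]
    by_cases hx' : x + 1 = N
    · subst hx'
      rw [insAt_new, h1, if_pos rfl, ← hnx]
      exact hl.last
    · have e1 : insAt el x N N = el (N - 1) := by
        rw [insAt, if_neg (by omega), if_neg (by omega)]
      rw [e1, old _ (by omega) (by omega), hl.last]
  · rcases lt_trichotomy i x with h | rfl | h
    · rw [insAt_of_le _ _ _ (by omega), insAt_of_le _ _ _ (by omega), h2,
        if_neg (by rw [hnx' _ (by omega) (by omega)]; omega), if_neg (hne _ (by omega)),
        hl.prv i (by omega)]
    · rw [insAt_of_le _ _ _ le_rfl, insAt_new, h2, if_neg hnxN.ne', if_pos rfl]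
    · obtain ⟨q, rfl⟩ := Nat.exists_eq_add_of_lt h
      have e1 : insAt el x N (x + q + 1 + 1) = el (x + q + 1) :=
        insAt_of_lt _ _ _ (by omega)
      rw [e1, h2]
      cases q with
      | zero => rw [add_zero, insAt_new, if_pos ((hnx' _ (by omega) (by omega)).2 rfl)]
      | succ q =>
        have e2 : insAt el x N (x + (q + 1) + 1) = el (x + q + 1) :=
          insAt_of_lt _ _ _ (by omega)
        rw [e2, if_neg (by rw [hnx' _ (by omega) (by omega)]; omega), if_neg (hne _ (by omega)),
          ← add_assoc, hl.prv _ (by omega)]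
  · rw [h2]
    split_ifs
    · omega
    · have := ho.lt x hx
      omega
    · have := hl.first
      omega

theorem pot_congr {L Q N : ℕ} {a b : ℕ → ℕ} (h : ∀ p < N, a p = b p) :
    pot L Q N a = pot L Q N b := by
  refine Finset.sum_congr rfl fun i _ => ?_
  congr 1
  refine Finset.sum_congr rfl fun q _ => ?_
  rw [cnt_congr fun p hp => by rw [h p hp]]

section

variable {M : Cfg} {s : State} {N J : ℕ} {el : ℕ → ℕ}

theorem runs_growProg {j : ℕ} (h10 : s.reg 10 = 2 * J) (h11 : s.reg 11 = 2 ^ J)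
    (h15 : s.reg 15 = 2 * j) (h16 : s.reg 16 = 2 ^ j) (hJ : 1 ≤ J) (hjA : 2 ^ j ≤ M.A)
    (hAV : M.A < M.V) (hl : Logs (2 ^ J) s) :
    Runs M growProg s fun t s' => t ≤ 100 * (2 ^ j + 1) + 100 ∧
      Same [10, 11, 19] [.lg, .pl] s s' ∧ s'.reg 10 = 2 * max J j ∧ s'.reg 11 = 2 ^ max J j ∧
      Logs (2 ^ max J j) s' := by
  have hcost : (reg 15 - reg 10 : Exp).cost = 3 := rfl
  refine Runs.ite (by decide) (by simp) (fun hne => ?_) fun he => ?_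
  · simp only [eval_sub, eval_reg, h10, h15] at hne
    have hJj : J < j := by omega
    have hp : 2 ^ J ≤ 2 ^ j := Nat.pow_le_pow_right (by omega) hJj.le
    have hp2 : 2 ^ 1 ≤ 2 ^ J := Nat.pow_le_pow_right (by omega) hJ
    rw [max_eq_right hJj.le]
    refine .seq ((Runs.straight (R := fun s' => s'.reg 19 = 2 ^ J ∧ Same [19] [] s s')
      (by decide) ?_).mono ?_)
    · simp [swp, h11]
      exact ⟨by omega, Same.refl.put⟩
    rintro t₁ s₁ ⟨ht₁, h19, hS₁⟩
    have ht₁ : t₁ ≤ 10 := ht₁.trans (by decide)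
    refine .seq ((runs_growLoop ((hS₁.1 16 (by decide)).trans h16) h19 (by omega) hp hjA hAV
      (hl.congr (hS₁.2 _ (by decide)) (hS₁.2 _ (by decide)))).mono ?_)
    rintro t₂ s₂ ⟨ht₂, hS₂, hl₂⟩
    have hS : Same [10, 11, 19] [.lg, .pl] s s₂ := (hS₁.weaken).trans hS₂
    refine .of_bdd fun hb => (Runs.straight (R := fun s' => s'.reg 10 = 2 * j ∧ s'.reg 11 = 2 ^ j ∧
      Same [10, 11] [] s₂ s') (by decide) ?_).mono ?_
    · have e1 : s₂.reg 15 = 2 * j := by rw [hS.1 15 (by decide), h15]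
      have e2 : s₂.reg 16 = 2 ^ j := by rw [hS.1 16 (by decide), h16]
      simp [swp, e1, e2]
      exact ⟨e1 ▸ hb.1 15, e2 ▸ hb.1 16, Same.refl.put.put⟩
    · rintro t₃ s₃ ⟨ht₃, e1, e2, hS₃⟩
      have ht₃ : t₃ ≤ 10 := ht₃.trans (by decide)
      exact ⟨by omega, hS.trans hS₃, e1, e2,
        hl₂.congr (hS₃.2 _ (by decide)) (hS₃.2 _ (by decide))⟩
  · simp only [eval_sub, eval_reg, h10, h15] at he
    rw [max_eq_left (by omega)]
    refine (Runs.straight (R := fun s' => s' = s) (by decide) (by simp [swp])).mono ?_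
    rintro t s' ⟨ht, rfl⟩
    have ht : t ≤ 10 := ht.trans (by decide)
    exact ⟨by omega, .refl, h10, h11, hl⟩

/-- The situation after an element was added with the label of its predecessor. -/
theorem runs_linkProg {x : ℕ} (h : Repr N J el s) (cap : Cap M (N + 1)) (hx : x < N)
    (h3 : s.reg 3 = el x) (h4 : s.reg 4 = N) (hE : key s (el x) < key s N) :
    Runs M (linkProg ⨾ copyLoop) s fun t s' => t ≤ 400 * (J + 1) ∧
      Same [5, 6, 7, 8, 24] [.nxt, .prv, .lab, .pre, .suf] s s' ∧
      Links (N + 1) (insAt el x N) s' ∧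
      (∀ q < N, labs s' (insAt el x N) (shift x q) = labs s el q) ∧
      labs s' (insAt el x N) (x + 1) = labs s el x ∧
      ∀ q < N + 1, ∀ k < 2 * J,
        PreOk (insAt el x N) (key s) (labs s' (insAt el x N)) q k
          (s'.fld .pre (insAt el x N q * (2 * J) + k)) ∧
        SufOk (N + 1) (insAt el x N) (key s) (labs s' (insAt el x N)) q k
          (s'.fld .suf (insAt el x N q * (2 * J) + k)) := by
  have ho := h.order
  have hlen := cap.len
  have hAV := cap.hAV
  have hrows : (N + 1) * (2 * J) ≤ M.A := cap.rows J (h.pow_le.trans (by omega))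
  have hex := ho.lt x hx
  have hnx := h.links.nxt_lt ho hx
  have hrow := row_le (show el x < N + 1 by omega) hrows
  have hrowN := row_le (Nat.lt_succ_self N) hrows
  refine .of_bdd fun hb => .seq ((Runs.straight (R := fun s' => s'.reg 6 = 0 ∧
    s'.reg 7 = el x * (2 * J) ∧ s'.reg 8 = N * (2 * J) ∧
    Same [5, 6, 7, 8] [.nxt, .prv, .lab] s s' ∧
    (∀ e, s'.fld .nxt e = if e = N then s.fld .nxt (el x) else if e = el x then N else
      s.fld .nxt e) ∧
    (∀ e, s'.fld .prv e = if e = s.fld .nxt (el x) then N else if e = N then el x else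
      s.fld .prv e) ∧
    ∀ e, s'.fld .lab e = if e = N then s.fld .lab (el x) else s.fld .lab e)
    (by decide) ?_).mono ?_)
  · have hbl := hb.fld .lab (el x)
    simp [linkProg, swp, swp_sto, h3, h4, h.r10]
    constructorm* _ ∧ _
    all_goals first
      | omega
      | exact hbl
      | exact Same.refl.put.setFld.setFld.setFld.setFld.setFld.put.put.put
  rintro t₁ s₁ ⟨ht₁, e6, e7, e8, hS₁, hnxt, hprv, hlab⟩
  have ht₁ : t₁ ≤ 100 := ht₁.trans (by decide)
  have hk₁ : key s₁ = key s := hS₁.key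
  refine (runs_copyLoop ((hS₁.1 10 (by decide)).trans h.r10) e6 e7 e8 hAV.le hrow hrowN
    (rows_disjoint hex.ne) ?_ ?_).mono ?_
  · rw [hS₁.1 4 (by decide), h4]
    omega
  · intro k hk
    rw [hS₁.2 .suf (by decide)]
    have := sufOk_lt (h.suf x hx k hk) ho hx
    omega
  rintro t₂ s₂ ⟨ht₂, hS₂, hpre, hsuf⟩
  have hS : Same [5, 6, 7, 8, 24] [.nxt, .prv, .lab, .pre, .suf] s s₂ := hS₁.weaken.trans hS₂
  rw [hS₁.2 .pre (by decide)] at hpre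
  rw [hS₁.2 .suf (by decide), hk₁, hS₁.1 4 (by decide), h4] at hsuf
  have hl₂ : ∀ e, s₂.fld .lab e = if e = N then s.fld .lab (el x) else s.fld .lab e := by
    rw [hS₂.2 _ (by decide)]
    exact hlab
  have hb1 : ∀ q < N, labs s₂ (insAt el x N) (shift x q) = labs s el q := by
    intro q hq
    rw [labs, insAt_shift, hl₂, if_neg (ho.lt q hq).ne]
    rfl
  have hb2 : labs s₂ (insAt el x N) (x + 1) = labs s el x := by
    rw [labs, insAt_new, hl₂, if_pos rfl]
    rfl
  refine ⟨by omega, hS, (links_insert ho h.links hx rfl hnxt hprv).congr (hS₂.2 _ (by decide))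
    (hS₂.2 _ (by decide)), hb1, hb2, fun q hq k hk => ?_⟩
  have hx' := h.pre x hx k hk
  have hxs := h.suf x hx k hk
  rcases eq_new_or_shift x q with rfl | ⟨q, rfl⟩
  · rw [insAt_new, hpre, hsuf, if_pos (by omega), if_pos (by omega), Nat.add_sub_cancel_left]
    exact ⟨preOk_insAt_new hx hE hb1 hb2 hx', sufOk_insAt_new hx hb1 hb2 hxs⟩
  · have hq := (shift_lt_succ hx).1 hq
    have hrd := rows_disjoint (K := 2 * J) (ho.lt q hq).ne
    rw [insAt_shift, hpre, hsuf, if_neg (by omega), if_neg (by omega)]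
    refine ⟨preOk_insAt hE hb1 hb2 hq (h.pre q hq k hk), ?_⟩
    by_cases hqx : q = x
    · subst hqx
      rw [if_pos (by omega), shift_of_le le_rfl]
      exact sufOk_insAt_self ho hx hb1 hb2 hxs
    · have hrd := rows_disjoint (K := 2 * J) fun h' => hqx (ho.inj q hq x hx h')
      rw [if_neg (by omega)]
      exact sufOk_insAt hx hE hb1 hb2 hq hqx (h.suf q hq k hk)

end

end Nca

/-! ### The amortized cost of an insertion. -/

namespace Nca

open RAM RAM.Prog RAM.Exp

section

variable {M : Cfg} {s : State} {N J : ℕ} {el : ℕ → ℕ}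

theorem block_end_le {a g j J : ℕ} (ha : a < 2 ^ (2 * J)) (hg : a / 2 ^ (2 * j) = g) :
    g * 2 ^ (2 * j) + 2 ^ (2 * j) ≤ 2 ^ (2 * J) + 2 ^ (2 * j) := by
  subst hg
  have := Nat.div_mul_le_self a (2 ^ (2 * j))
  omega

/-- For j = i + 2 the work is `4 * 2 ^ i * (i + 3)`, at most 12 times the drop `(i + 1) * 2 ^ i` of
the potential. For j = 1 there is no lower crowded level, and the work is the constant 4. -/
theorem spread_cost {N j g l r L Q x : ℕ} {a : ℕ → ℕ} (h : Block N a j g l r)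
    (hc : r + 1 - l ≤ 2 ^ j) (hj : 1 ≤ j) (hjL : j ≤ L + 1) (hg : a x / 2 ^ (2 * j) = g)
    (hxQ : a x < Q)
    (hcrowd : 2 ≤ j → 2 ^ (j - 1) < cnt N a (j - 1) (a x / 2 ^ (2 * (j - 1)))) :
    2 ^ j * (j + 1) + 12 * pot L Q N (spread a j g l r) ≤ 4 + 12 * pot L Q N a := by
  rcases Nat.eq_or_lt_of_le hj with rfl | hj2
  · have := pot_spread_le h hc L Q
    omega
  · obtain ⟨i, rfl⟩ : ∃ i, j = i + 2 := ⟨j - 2, by omega⟩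
    have h1 := pot_spread_drop (L := L) (Q := Q) (q₀ := a x / 2 ^ (2 * (i + 1))) h hc (by omega)
      (lt_of_le_of_lt (Nat.div_le_self _ _) hxQ)
      (by rw [← hg]; exact div_pow_div (d := 1)) (hcrowd hj2)
    have h2 : 2 ^ (i + 2) * (i + 2 + 1) ≤ 12 * ((i + 1) * 2 ^ i) := by
      rw [pow_add]
      have : 0 < 2 ^ i := by positivity
      nlinarith
    omega

-- Linking costs O(J), the other phases O(`2 ^ j * (j + 1)`). The first is at most a multiple of `L
-- * L`; the second is paid by the potential, to which the insertion itself had added at most `L *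
-- L`. Each table entry of the result is either recomputed in the block or carried over by
-- `spread_same`.
set_option maxHeartbeats 1000000 in
theorem runs_insertProg {x L : ℕ} (h : Repr N J el s) (cap : Cap M (N + 1)) (hx : x < N)
    (h3 : s.reg 3 = el x) (h4 : s.reg 4 = N) (hE : key s (el x) < key s N)
    (hL : N + 1 ≤ 2 ^ L) :
    Runs M insertProg s fun t s' => ∃ J', Repr (N + 1) J' (insAt el x N) s' ∧
      (∀ f ∈ [Field.par, .dn, .up], s'.fld f = s.fld f) ∧
      t + 300000 * pot L (2 ^ (2 * (L + 1))) (N + 1) (labs s' (insAt el x N)) ≤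
        300000 * pot L (2 ^ (2 * (L + 1))) N (labs s el) + 400000 * (L * L) := by
  have hlen := cap.len
  have hAV := cap.hAV
  have hVN := cap.hV
  have hL0 : 1 ≤ L := by
    by_contra h0
    obtain rfl : L = 0 := by omega
    rw [pow_zero] at hL
    omega
  have two_L : 2 ^ (L + 1) = 2 * 2 ^ L := by ring
  have hJL : J ≤ L + 1 := by
    refine (Nat.pow_le_pow_iff_right (a := 2) (by omega)).1 ?_
    have := h.pow_le
    omega
  have hJJ : 2 ^ (2 * J) ≤ 4 * N * N := by
    rw [two_mul, pow_add]
    calc 2 ^ J * 2 ^ J ≤ (2 * N) * (2 * N) := Nat.mul_le_mul h.pow_le h.pow_le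
      _ = 4 * N * N := by ring
  have ho' := h.order.ins hx
  refine .seq ((runs_linkProg h cap hx h3 h4 hE).mono ?_)
  rintro t₁ s₁ ⟨ht₁, hS₁, hl₁, hb1, hb2, htab⟩
  obtain ⟨el', hel'⟩ : ∃ el', el' = insAt el x N := ⟨_, rfl⟩
  have hel3 : el' x = el x := by rw [hel', insAt_of_le _ _ _ le_rfl]
  have hel4 : el' (x + 1) = N := by rw [hel', insAt_new]
  rw [← hel'] at ho' hl₁ hb1 hb2 htab ⊢
  obtain ⟨a, ha⟩ : ∃ a, a = labs s₁ el' := ⟨_, rfl⟩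
  have hax : a x = labs s el x := by simpa [ha, shift_of_le] using hb1 x hx
  have hlab_lt : ∀ q < N + 1, a q < 2 ^ (2 * J) := by
    intro q hq
    rcases eq_new_or_shift x q with rfl | ⟨q, rfl⟩
    · rw [ha, hb2]
      exact h.lab_lt x hx
    · rw [ha, hb1 q ((shift_lt_succ hx).1 hq)]
      exact h.lab_lt q ((shift_lt_succ hx).1 hq)
  have hmono : ∀ p q, p < q → q < N + 1 → a p < a q ∨ p = x ∧ q = x + 1 := by
    intro p q hpq hq
    rw [ha]
    rcases eq_new_or_shift x p with rfl | ⟨p, rfl⟩ <;>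
    rcases eq_new_or_shift x q with rfl | ⟨q, rfl⟩
    · omega
    · have hq' := (shift_lt_succ hx).1 hq
      rw [hb2, hb1 q hq']
      refine .inl (h.mono x q ?_ hq')
      by_contra hle
      rw [shift_of_le (by omega)] at hpq
      omega
    · have hpx : p ≤ x := by
        by_contra hlt
        rw [shift_of_lt (by omega)] at hpq
        omega
      rw [hb2, hb1 p (by omega), shift_of_le hpx]
      rcases Nat.eq_or_lt_of_le hpx with rfl | hlt
      · exact .inr ⟨rfl, rfl⟩
      · exact .inl (h.mono p x hlt hx)
    · have hq' := (shift_lt_succ hx).1 hq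
      have hpq' := shift_lt_shift.1 hpq
      rw [hb1 q hq', hb1 p (by omega)]
      exact .inl (h.mono p q hpq' hq')
  have htie : a (x + 1) = a x := by rw [ha, hb2, ← ha, hax]
  refine .seq ((runs_searchProg ho' hl₁ (by omega) hAV (by nlinarith) (by omega)
    ((hS₁.1 3 (by decide)).trans (h3.trans hel3.symm))
    ((hS₁.1 4 (by decide)).trans (h4.trans hel4.symm)) ?_ (by rw [← ha, htie])).mono ?_)
  · intro p q hpq hq
    rw [← ha]
    rcases Nat.eq_or_lt_of_le hpq with rfl | hlt
    · exact le_rfl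
    · rcases hmono p q hlt hq with h' | ⟨rfl, rfl⟩
      · exact h'.le
      · exact htie.ge
  rintro t₂ s₂ ⟨j, l, r, hj1, hs₂, hc, ht₂⟩
  have hS₂ : Same [5, 6, 7, 8, 12, 13, 14, 15, 16, 17, 18, 24] [.nxt, .prv, .lab, .pre, .suf]
    s s₂ := hS₁.weaken.trans hs₂.same
  obtain ⟨hblock, h18⟩ := hs₂.block hj1
  obtain ⟨g, hg⟩ : ∃ g, g = a x / 2 ^ (2 * j) := ⟨_, rfl⟩
  have hcrowd := hs₂.crowded
  rw [← ha] at hblock h18 hcrowd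
  rw [← hg] at hblock h18
  have hjL : j ≤ L + 1 := by
    refine (Nat.pow_le_pow_iff_right (a := 2) (by omega)).1 ?_
    have := hs₂.pow_lt
    omega
  have hjj : 2 ^ (2 * j) ≤ 4 * (N + 1) * (N + 1) := by
    rw [two_mul, pow_add]
    calc 2 ^ j * 2 ^ j ≤ (2 * (N + 1)) * (2 * (N + 1)) :=
          Nat.mul_le_mul hs₂.pow_lt.le hs₂.pow_lt.le
      _ = 4 * (N + 1) * (N + 1) := by ring
  have hjpow := hs₂.pow_lt
  refine .seq ((runs_growProg (J := J) (j := j) ((hS₂.1 10 (by decide)).trans h.r10)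
    ((hS₂.1 11 (by decide)).trans h.r11) hs₂.r15 hs₂.r16 h.one_le (by omega) hAV
    (h.logs.congr (hS₂.2 _ (by decide)) (hS₂.2 _ (by decide)))).mono ?_)
  rintro t₃ s₃ ⟨ht₃, hS₃, h10, h11, hlogs⟩
  obtain ⟨J', hJ'⟩ : ∃ J', J' = max J j := ⟨_, rfl⟩
  rw [← hJ'] at h10 h11 hlogs
  have hJJ' : J ≤ J' := by omega
  have hjJ' : j ≤ J' := by omega
  have hpowJ' : 2 ^ J' ≤ 2 * (N + 1) := by
    rcases le_total J j with h' | h'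
    · rw [hJ', max_eq_right h']
      exact hjpow.le
    · rw [hJ', max_eq_left h']
      exact h.pow_le.trans (by omega)
  have hrows := cap.rows J' hpowJ'
  have hlab₃ : labs s₃ el' = a := by
    ext q
    rw [ha, labs, labs, hS₃.2 _ (by decide), hs₂.same.2 _ (by decide)]
  have hkey₃ : key s₃ = key s := by
    rw [hS₃.key, hS₂.key]
  have hsp : Spreadable M (N + 1) el' a (2 * J') j g l r s₃ :=
    { order := ho'
      links := hl₁.congr (by rw [hS₃.2 _ (by decide), hs₂.same.2 _ (by decide)])
        (by rw [hS₃.2 _ (by decide), hs₂.same.2 _ (by decide)])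
      block := hblock
      few := hc
      mono := by
        intro p q hpq hq
        refine hblock.spread_lt hc (fun p q hpq hq => ?_) hpq hq
        rcases hmono p q hpq hq with h' | ⟨rfl, rfl⟩
        · exact .inl h'
        · exact .inr ⟨hs₂.lx, hs₂.xr⟩
      hK := by omega
      hA := hrows
      hNA := by omega
      hAV := hAV
      hV := by
        have := block_end_le (j := j) (hlab_lt x (by omega)) hg.symm
        nlinarith
      r10 := h10
      r12 := by rw [hS₃.1 12 (by decide), hs₂.r12]
      r13 := by rw [hS₃.1 13 (by decide), hs₂.r13]
      r14 := by rw [hS₃.1 14 (by decide), hs₂.r14]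
      r15 := by rw [hS₃.1 15 (by decide), hs₂.r15]
      r16 := by rw [hS₃.1 16 (by decide), hs₂.r16]
      r18 := by rw [hS₃.1 18 (by decide), h18] }
  have hfwd := (hlab₃ ▸ hsp).runs_fwdProg
  rw [hlab₃] at hfwd
  refine .seq (hfwd.mono ?_)
  rintro t₄ s₄ ⟨ht₄, hS₄, h21, hlab₄, hpre₄⟩
  refine ((hsp.congr hS₄).runs_bwdProg h21).mono ?_
  rintro t₅ s₅ ⟨ht₅, hS₅, hsuf₅⟩
  have hS₄' : Same [6, 7, 8, 19, 20, 21, 22, 23, 24] [.lab, .pre, .suf] s₃ s₅ :=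
    hS₄.weaken.trans hS₅
  have hS : Same [5, 6, 7, 8, 10, 11, 12, 13, 14, 15, 16, 17, 18, 19, 20, 21, 22, 23, 24]
      [.nxt, .prv, .lab, .pre, .suf, .lg, .pl] s s₅ :=
    (hS₂.weaken.trans hS₃).trans hS₄'
  have hkey₅ : key s₅ = key s := hS.key
  have hlab₅ : ∀ q < N + 1, labs s₅ el' q = spread a j g l r q := by
    intro q hq
    rw [← hlab₄ q hq, labs, labs, hS₅.2 _ (by decide)]
  have hdiv : ∀ p < N + 1, ∀ q < N + 1, ∀ k, labs s₅ el' p / 2 ^ k = labs s₅ el' q / 2 ^ k ↔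
      spread a j g l r p / 2 ^ k = spread a j g l r q / 2 ^ k := by
    intro p hp q hq k
    rw [hlab₅ p hp, hlab₅ q hq]
  -- An entry that was not recomputed implies that the stride is unchanged: for `J < j` all labels
  -- lie in block 0 of length `4 ^ j`, so every position and every `k < 2 * J'` would have been
  -- included.
  have hout : ∀ q < N + 1, ∀ k < 2 * J', ¬(l ≤ q ∧ q ≤ r ∧ k < 2 * j) → J' = J ∧
      (q < l ∨ r < q ∨ 2 * j ≤ k) := by
    intro q hq k hk hn
    refine ⟨?_, by omega⟩
    by_contra hne
    have hJj : J < j := by omega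
    have hz : ∀ p < N + 1, a p / 2 ^ (2 * j) = 0 := fun p hp =>
      Nat.div_eq_of_lt ((hlab_lt p hp).trans_le (Nat.pow_le_pow_right (by omega) (by omega)))
    have := (hblock.mem q hq).2 (by rw [hz q hq, hg, hz x (by omega)])
    omega
  refine ⟨J', ⟨ho', ?_, ?_, ?_, ?_, ?_, h.one_le.trans hJJ', hpowJ', ?_, ?_, ?_⟩, ?_, ?_⟩
  · exact hsp.links.congr (hS₄'.2 _ (by decide)) (hS₄'.2 _ (by decide))
  · intro p q hpq hq
    rw [hlab₅ p (by omega), hlab₅ q hq]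
    exact hsp.mono p q hpq hq
  · intro q hq
    have h1 : a q / 2 ^ (2 * J') = 0 := Nat.div_eq_of_lt
      ((hlab_lt q hq).trans_le (Nat.pow_le_pow_right (by omega) (by omega)))
    rw [← hblock.spread_div_of_le hc hq (by omega), ← hlab₅ q hq] at h1
    exact (Nat.div_eq_zero_iff_lt (by positivity)).1 h1
  · rw [hS₄'.1 10 (by decide), h10]
  · rw [hS₄'.1 11 (by decide), h11]
  · intro q hq k hk
    rw [hkey₅]
    by_cases hin : l ≤ q ∧ q ≤ r ∧ k < 2 * j
    · have h1 := (hpre₄ q hq k hk).1 hin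
      rw [hkey₃] at h1
      rw [hS₅.2 .pre (by decide)]
      exact h1.congr fun p hp => hdiv p (by omega) q hq k
    · obtain ⟨rfl, h2⟩ := hout q hq k hk hin
      have h1 := (htab q hq k hk).1
      rw [← ha] at h1
      rw [hS₅.2 .pre (by decide), (hpre₄ q hq k hk).2 hin, hS₃.2 .pre (by decide),
        hs₂.same.2 .pre (by decide)]
      exact h1.congr fun p hp => (hdiv p (by omega) q hq k).trans
        (hblock.spread_same hc hq (by omega) h2)
  · intro q hq k hk
    rw [hkey₅]
    by_cases hin : l ≤ q ∧ q ≤ r ∧ k < 2 * j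
    · have h1 := (hsuf₅ q hq k hk).1 hin
      rw [hS₄.key, hkey₃] at h1
      exact h1.congr fun p hp => hdiv p hp q hq k
    · obtain ⟨rfl, h2⟩ := hout q hq k hk hin
      have h1 := (htab q hq k hk).2
      rw [← ha] at h1
      rw [(hsuf₅ q hq k hk).2 hin, hS₄.2 .suf (by decide), hS₃.2 .suf (by decide),
        hs₂.same.2 .suf (by decide)]
      exact h1.congr fun p hp => (hdiv p hp q hq k).trans
        (hblock.spread_same hc hq hp h2)
  · exact hlogs.congr (hS₄'.2 _ (by decide)) (hS₄'.2 _ (by decide))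
  · intro f hf
    fin_cases hf <;> exact hS.2 _ (by decide)
  · have hQ : a x < 2 ^ (2 * (L + 1)) :=
      (hlab_lt x (by omega)).trans_le (Nat.pow_le_pow_right (by omega) (by omega))
    -- Taken 25000 times, this turns the factor 12 into 300000. The running time uses fewer than
    -- 25000 units `2 ^ j * (j + 1)` besides the linking, and the constant term is absorbed by `1 ≤
    -- L * L`.
    have h1 := spread_cost hblock hc hj1 hjL hg.symm hQ hcrowd
    have h2 : pot L (2 ^ (2 * (L + 1))) (N + 1) a ≤
        pot L (2 ^ (2 * (L + 1))) N (labs s el) + L * L :=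
      pot_insAt_le hx (fun q hq => by rw [ha, hb1 q hq]) (by rw [ha, hb2])
    rw [pot_congr hlab₅]
    have h3 : (r + 1 - l + 1) * (2 * j + 1) ≤ 4 * (2 ^ j * (j + 1)) := by
      have : 1 ≤ 2 ^ j := Nat.one_le_two_pow
      calc _ ≤ (2 * 2 ^ j) * (2 * (j + 1)) := Nat.mul_le_mul (by omega) (by omega)
        _ = _ := by ring
    have h4 : 2 ^ j + j + 1 ≤ 2 * (2 ^ j * (j + 1)) := by
      have : 1 ≤ 2 ^ j := Nat.one_le_two_pow
      nlinarith
    have h5 : J + 1 ≤ 3 * (L * L) := by nlinarith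
    have h6 : 1 ≤ L * L := Nat.mul_pos hL0 hL0
    have h7 : 2 ^ j + 1 ≤ 2 * (2 ^ j * (j + 1)) := by omega
    omega

end

end Nca

/-! ### Preorders of trees -/

namespace IncTree

variable {T T' : IncTree} {a b x y z : ℕ}

theorem Anc.refl : T.Anc x x := Relation.ReflTransGen.refl

theorem Anc.trans (h : T.Anc a b) (h' : T.Anc b x) : T.Anc a x :=
  Relation.ReflTransGen.trans h' h

theorem anc_of_parent (h : T.parent x = some a) : T.Anc a x := Relation.ReflTransGen.single h

theorem Anc.cases (h : T.Anc a x) : a = x ∨ ∃ v, T.parent x = some v ∧ T.Anc a v := by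
  rcases Relation.ReflTransGen.cases_head h with h | h
  · exact .inl h.symm
  · exact .inr h

theorem Anc.total (ha : T.Anc a x) (hb : T.Anc b x) : T.Anc a b ∨ T.Anc b a := by
  refine (Relation.ReflTransGen.total_of_right_unique (fun u v w hv hw => ?_) ha hb).symm
  exact Option.some.inj (hv.symm.trans hw)

theorem Anc.mono (h : T.Anc a x) (hT : ∀ u v, T.parent u = some v → T'.parent u = some v) :
    T'.Anc a x := Relation.ReflTransGen.mono hT _ _ h

theorem IsNCA.symm (h : T.IsNCA x y a) : T.IsNCA y x a :=
  ⟨h.2.1, h.1, fun b h1 h2 => h.2.2 b h2 h1⟩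

theorem IsCA.symm {ax ay : ℕ} (h : T.IsCA x y a ax ay) : T.IsCA y x a ay ax :=
  ⟨h.1.symm, h.2.2, h.2.1⟩

theorem isCA_self : T.IsCA x x x x x :=
  ⟨⟨.refl, .refl, fun _ h _ => h⟩, .inl ⟨rfl, rfl⟩, .inl ⟨rfl, rfl⟩⟩

end IncTree

namespace Nca

open IncTree

theorem LastMin.unique {el : ℕ → ℕ} {key : ℕ → ℤ} {S : Set ℕ} {p q : ℕ}
    (hp : LastMin el key S p) (hq : LastMin el key S q) : p = q := by
  have h1 := hp.2 q hq.1
  have h2 := hq.2 p hp.1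
  rcases lt_trichotomy p q with h | h | h
  · have := h1.2 h
    omega
  · exact h
  · have := h2.2 h
    omega

/-- The list `el` consists of `0`, followed by the successors of the nodes of the tree in preorder;
the keys of the nodes are the depths up to a constant, and the key of `0` is less. -/
structure Preorder (T : IncTree) (el : ℕ → ℕ) (key : ℕ → ℤ) : Prop where
  order : Order (T.card + 1) el
  root : el 1 = T.root + 1
  pos : 1 ≤ T.card
  parent_root : T.parent T.root = none
  lt : ∀ u v, T.parent u = some v → u < T.card ∧ v < T.card
  step : ∀ i, 1 ≤ i → i < T.card → ∃ v, T.parent (el (i + 1) - 1) = some v ∧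
    T.Anc v (el i - 1) ∧ key (el (i + 1)) = key (v + 1) + 1
  key_root : key 0 + 1 = key (T.root + 1)

namespace Preorder

variable {T : IncTree} {el : ℕ → ℕ} {key : ℕ → ℤ} {i j p q a x y z : ℕ}

theorem exists_pos (h : Preorder T el key) (hx : x < T.card) :
    ∃ i, 1 ≤ i ∧ i < T.card + 1 ∧ el i = x + 1 := by
  obtain ⟨i, hi, h'⟩ := h.order.surj (x + 1) (by omega)
  refine ⟨i, ?_, hi, h'⟩
  by_contra h0
  obtain rfl : i = 0 := by omega
  rw [h.order.zero] at h'
  omega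

theorem root_lt (h : Preorder T el key) : T.root < T.card := by
  have h1 := h.order.lt 1 (by have := h.pos; omega)
  rw [h.root] at h1
  omega

theorem el_pos (h : Preorder T el key) (hi : 1 ≤ i) (hi' : i < T.card + 1) :
    el i - 1 + 1 = el i := Nat.succ_pred (h.order.ne_zero hi' hi)

/-- The parent of the element at `i + 1` is an ancestor of the one at `i`, so by induction all
proper ancestors stand further to the left. -/
theorem anc_pos (h : Preorder T el key) (hi : 1 ≤ i) (hi' : i < T.card + 1)
    (ha : T.Anc a (el i - 1)) : ∃ p, 1 ≤ p ∧ p ≤ i ∧ el p = a + 1 := by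
  induction i, hi using Nat.le_induction generalizing a with
  | base =>
    rcases ha.cases with rfl | ⟨v, hv, -⟩
    · exact ⟨1, le_rfl, le_rfl, (h.el_pos le_rfl hi').symm⟩
    · rw [h.root, Nat.add_sub_cancel, h.parent_root] at hv
      cases hv
  | succ i hi ih =>
    rcases ha.cases with rfl | ⟨v, hv, hav⟩
    · exact ⟨i + 1, by omega, le_rfl, (h.el_pos (by omega) hi').symm⟩
    · obtain ⟨v', hv', hvi, -⟩ := h.step i hi (by omega)
      obtain rfl : v' = v := Option.some.inj (hv'.symm.trans hv)
      obtain ⟨p, hp1, hpi, hp⟩ := ih (by omega) (hav.trans hvi)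
      exact ⟨p, hp1, by omega, hp⟩

theorem key_parent (h : Preorder T el key) (hz : T.parent z = some a) :
    key (z + 1) = key (a + 1) + 1 := by
  obtain ⟨i, hi1, hi, hiz⟩ := h.exists_pos (h.lt z a hz).1
  rcases Nat.eq_or_lt_of_le hi1 with rfl | hi2
  · rw [h.root] at hiz
    rw [← Nat.succ_inj.1 hiz, h.parent_root] at hz
    cases hz
  · obtain ⟨i, rfl⟩ : ∃ i', i = i' + 1 := ⟨i - 1, by omega⟩
    obtain ⟨v, hv, -, hk⟩ := h.step i (by omega) (by omega)
    rw [hiz, Nat.add_sub_cancel] at hv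
    obtain rfl : v = a := Option.some.inj (hv.symm.trans hz)
    rwa [hiz] at hk

theorem key_anc (h : Preorder T el key) (ha : T.Anc a x) :
    a = x ∨ key (a + 1) < key (x + 1) := by
  induction ha using Relation.ReflTransGen.head_induction_on with
  | refl => exact .inl rfl
  | head h1 _ ih =>
    have := h.key_parent h1
    rcases ih with rfl | ih
    · right; omega
    · right; omega

theorem key_zero_lt (h : Preorder T el key) {e : ℕ} (h0 : 0 < e) (he : e < T.card + 1) :
    key 0 < key e := by
  obtain ⟨i, hi1, hi, rfl⟩ : ∃ i, 1 ≤ i ∧ i < T.card + 1 ∧ el i = e := by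
    obtain ⟨i, h1, h2, h3⟩ := h.exists_pos (x := e - 1) (by omega)
    exact ⟨i, h1, h2, by omega⟩
  induction i using Nat.strong_induction_on with
  | _ i ih =>
    rcases Nat.eq_or_lt_of_le hi1 with rfl | hi2
    · rw [h.root, ← h.key_root]
      omega
    · obtain ⟨i, rfl⟩ : ∃ i', i = i' + 1 := ⟨i - 1, by omega⟩
      obtain ⟨v, hv, ha, hk⟩ := h.step i (by omega) (by omega)
      obtain ⟨p, hp1, hpi, hp⟩ := h.anc_pos (by omega) (by omega) ha
      have := ih p (by omega) hp1 (by omega) (by rw [hp]; omega) (h.order.lt p (by omega))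
      rw [hp] at this
      omega

/-- Induction on the right end. Let v be the parent of the new element. If z is an ancestor of v,
the new element is deeper than z and the minimum stays. Otherwise v is a proper ancestor of z, hence
an ancestor of a; then the new element is at most as deep as z and becomes the last minimum, with v
in the place of a. -/
theorem exists_lastMin (h : Preorder T el key) (hi : 1 ≤ i) (hij : i < j) (hj : j < T.card + 1) :
    ∃ p z a, LastMin el key {q | i < q ∧ q ≤ j} p ∧ el p = z + 1 ∧ T.parent z = some a ∧
      T.Anc a (el i - 1) ∧ T.Anc z (el j - 1) := by
  induction j, hij using Nat.le_induction with
  | base =>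
    obtain ⟨v, hv, ha, hk⟩ := h.step i hi (by omega)
    refine ⟨i + 1, _, v, ⟨⟨by omega, by omega⟩, fun q hq => ?_⟩,
      (h.el_pos (by omega) hj).symm, hv, ha, .refl⟩
    obtain rfl : q = i + 1 := by
      have := hq.1
      have := hq.2
      omega
    exact ⟨le_rfl, fun h => absurd h (lt_irrefl _)⟩
  | succ j hij ih =>
    obtain ⟨p, z, a, hp, hpz, hza, hax, hzy⟩ := ih (by omega)
    obtain ⟨v, hv, ha, hk⟩ := h.step j (by omega) (by omega)
    have hkz := h.key_parent hza
    have hp1 := hp.1.1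
    have hp2 := hp.1.2
    by_cases hvz : T.Anc z v
    · refine ⟨p, z, a, ⟨⟨hp1, by omega⟩, fun q hq => ?_⟩, hpz, hza, hax,
        hvz.trans (anc_of_parent hv)⟩
      rcases Nat.eq_or_lt_of_le hq.2 with rfl | hlt
      · have : key (z + 1) ≤ key (v + 1) := by
          rcases h.key_anc hvz with rfl | h' <;> omega
        rw [hpz]
        constructor <;> omega
      · exact hp.2 q ⟨hq.1, by omega⟩
    · have hvz' := (ha.total hzy).resolve_right hvz
      rcases hvz'.cases with rfl | ⟨a', ha', hva⟩
      · exact absurd .refl hvz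
      obtain rfl : a' = a := Option.some.inj (ha'.symm.trans hza)
      refine ⟨j + 1, _, v, ⟨⟨by omega, by omega⟩, fun q hq => ?_⟩,
        (h.el_pos (by omega) hj).symm, hv, hva.trans hax, .refl⟩
      have hva' : key (v + 1) ≤ key (a' + 1) := by
        rcases h.key_anc hva with rfl | h' <;> omega
      have hq1 := hq.1
      have hq2 := hq.2
      rcases Nat.eq_or_lt_of_le hq2 with rfl | hlt
      · exact ⟨le_rfl, fun h => absurd h (lt_irrefl _)⟩
      · have := (hp.2 q ⟨hq1, by omega⟩).1
        rw [hpz] at this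
        exact ⟨by omega, by omega⟩

/-- The first element of least depth after `x` and up to `y` is the child of the nearest common
ancestor above `y`. -/
theorem lastMin_spec (h : Preorder T el key) (hi : 1 ≤ i) (hij : i < j) (hj : j < T.card + 1)
    (hx : el i = x + 1) (hy : el j = y + 1) (hp : LastMin el key {q | i < q ∧ q ≤ j} p) :
    ∃ z a, el p = z + 1 ∧ T.parent z = some a ∧ T.IsNCA x y a ∧ T.Precedes y a z := by
  obtain ⟨p', z, a, hp', hpz, hza, hax, hzy⟩ := h.exists_lastMin hi hij hj
  obtain rfl := hp.unique hp'
  rw [hx, Nat.add_sub_cancel] at hax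
  rw [hy, Nat.add_sub_cancel] at hzy
  have hkz := h.key_parent hza
  -- Ancestors of `x` stand at or before position `i`, whereas `z` stands behind it. Common
  -- ancestors therefore lie strictly above `z`.
  have hzx : ¬ T.Anc z x := by
    intro hzx
    have hzx' : T.Anc z (el i - 1) := by rwa [hx, Nat.add_sub_cancel]
    obtain ⟨q, hq1, hqi, hq⟩ := h.anc_pos hi (by omega) hzx'
    have := hp.1.1
    have := hp.1.2
    have := h.order.inj q (by omega) p (by omega) (hq.trans hpz.symm)
    omega
  refine ⟨z, a, hpz, hza, ⟨hax, (anc_of_parent hza).trans hzy, fun b hbx hby => ?_⟩,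
    .inr ⟨?_, hzy, hza⟩⟩
  · rcases hby.total hzy with hbz | hzb
    · rcases hbz.cases with rfl | ⟨a', ha', hba⟩
      · exact absurd hbx hzx
      · rwa [← Option.some.inj (ha'.symm.trans hza)]
    · exact absurd (hzb.trans hbx) hzx
  · rintro rfl
    rcases h.key_anc hzy with rfl | h' <;> omega

/-- With an ancestor of `x` as left end, the nearest common ancestor is that ancestor itself: each
of the two is an ancestor of the other, and keys exclude two different nodes. -/
theorem precedes_of_lastMin (h : Preorder T el key) (hi : 1 ≤ i) (hij : i < j)
    (hj : j < T.card + 1) (hx : el i = a + 1) (hy : el j = x + 1) (hax : T.Anc a x)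
    (hp : LastMin el key {q | i < q ∧ q ≤ j} p) :
    ∃ z, el p = z + 1 ∧ T.Precedes x a z := by
  obtain ⟨z, a', hz, -, hnca, hpr⟩ := h.lastMin_spec hi hij hj hx hy hp
  refine ⟨z, hz, ?_⟩
  have h1 := h.key_anc (hnca.2.2 a .refl hax)
  have h2 := h.key_anc hnca.1
  obtain rfl : a' = a := by
    rcases h1 with rfl | h1
    · rfl
    · rcases h2 with rfl | h2
      · rfl
      · omega
  exact hpr

theorem pos_lt_of_anc (h : Preorder T el key) (hi : 1 ≤ i) (hi' : i < T.card + 1)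
    (hx : el i = x + 1) (ha : T.Anc a x) (hne : a ≠ x) :
    ∃ p, 1 ≤ p ∧ p < i ∧ el p = a + 1 := by
  have ha' : T.Anc a (el i - 1) := by rwa [hx, Nat.add_sub_cancel]
  obtain ⟨p, hp1, hpi, hp⟩ := h.anc_pos hi hi' ha'
  refine ⟨p, hp1, lt_of_le_of_ne hpi ?_, hp⟩
  rintro rfl
  omega

/-- The leaf becomes the first child. The element that used to follow `x` has an ancestor of `x` as
its parent, which is also an ancestor of the leaf, so the defining property of the list persists. -/
theorem addLeaf {key' : ℕ → ℤ} (h : Preorder T el key) (hi : 1 ≤ i) (hi' : i < T.card + 1)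
    (hx : el i = x + 1) (hk : ∀ e < T.card + 1, key' e = key e)
    (hk' : key' (T.card + 1) = key (x + 1) + 1) :
    Preorder (T.addLeaf x T.card) (insAt el i (T.card + 1)) key' := by
  have hxc : x + 1 < T.card + 1 := hx ▸ h.order.lt i hi'
  have hpar : ∀ u v, T.parent u = some v → (T.addLeaf x T.card).parent u = some v := by
    intro u v huv
    have := (h.lt u v huv).1
    simp only [IncTree.addLeaf, Function.update_apply]
    rw [if_neg (by omega), huv]
  have hnew : (T.addLeaf x T.card).parent T.card = some x := by
    simp [IncTree.addLeaf]
  have hstep : ∀ q, 1 ≤ q → q < T.card → ∃ v, (T.addLeaf x T.card).parent (el (q + 1) - 1) = some v ∧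
      (T.addLeaf x T.card).Anc v (el q - 1) ∧ key' (el (q + 1)) = key' (v + 1) + 1 := by
    intro q hq hq'
    obtain ⟨v, h1, h2, h3⟩ := h.step q hq hq'
    refine ⟨v, hpar _ _ h1, h2.mono hpar, ?_⟩
    have := (h.lt _ _ h1).2
    rw [hk _ (h.order.lt _ (by omega)), hk _ (by omega), h3]
  refine ⟨h.order.ins hi', ?_, ?_, ?_, ?_, ?_, ?_⟩
  · rw [insAt_of_le _ _ _ hi]
    exact h.root
  · simp [IncTree.addLeaf]
  · have := h.root_lt
    simp only [IncTree.addLeaf, Function.update_apply]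
    rw [if_neg (by omega), h.parent_root]
  · intro u v huv
    simp only [IncTree.addLeaf, Function.update_apply] at huv ⊢
    split_ifs at huv with hu
    · cases huv
      omega
    · have := h.lt u v huv
      omega
  · intro q hq hq'
    have hq' : q < T.card + 1 := hq'
    rcases lt_trichotomy q i with hqi | rfl | hqi
    · rw [insAt_of_le _ _ _ hqi.le, insAt_of_le _ _ _ hqi]
      exact hstep q hq (by omega)
    · rw [insAt_new, insAt_of_le _ _ _ le_rfl, hx]
      exact ⟨x, hnew, .refl, by rw [hk', hk _ hxc]⟩
    · obtain ⟨d, rfl⟩ := Nat.exists_eq_add_of_lt hqi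
      have e1 : insAt el i (T.card + 1) (i + d + 1 + 1) = el (i + d + 1) :=
        insAt_of_lt _ _ _ (by omega)
      obtain ⟨v, h1, h2, h3⟩ := hstep (i + d) (by omega) (by omega)
      rw [e1]
      refine ⟨v, h1, ?_, h3⟩
      cases d with
      | zero =>
        rw [add_zero, hx] at h2
        rw [add_zero, insAt_new]
        exact h2.trans (anc_of_parent hnew)
      | succ d =>
        rw [insAt_of_lt _ _ _ (by omega)]
        exact h2
  · have := h.root_lt
    rw [hk _ (by omega), h.key_root]
    exact (hk _ (by omega)).symm

/-- The old sentinel key is one less than the key of the old root, exactly what the new root needs;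
lowering the sentinel restores the gap in front of it. -/
theorem addRoot {key' : ℕ → ℤ} (h : Preorder T el key)
    (hk : ∀ e, 0 < e → e < T.card + 1 → key' e = key e)
    (hk' : key' (T.card + 1) = key 0) (hk0 : key' 0 + 1 = key 0) :
    Preorder (T.addRoot T.card) (insAt el 0 (T.card + 1)) key' := by
  have hr := h.root_lt
  have hpos := h.pos
  have hpar : ∀ u v, T.parent u = some v → (T.addRoot T.card).parent u = some v := by
    intro u v huv
    simp only [IncTree.addRoot, Function.update_apply]
    rw [if_neg, huv]
    rintro rfl
    rw [h.parent_root] at huv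
    cases huv
  refine ⟨h.order.ins (by omega), insAt_new .., ?_, ?_, ?_, ?_, ?_⟩
  · simp [IncTree.addRoot]
  · simp only [IncTree.addRoot, Function.update_apply]
    rw [if_neg (by omega)]
    by_contra hne
    obtain ⟨v, hv⟩ := Option.ne_none_iff_exists'.1 hne
    have := (h.lt _ _ hv).1
    omega
  · intro u v huv
    simp only [IncTree.addRoot, Function.update_apply] at huv ⊢
    split_ifs at huv with hu
    · cases huv
      omega
    · have := h.lt u v huv
      omega
  · intro q hq hq'
    have hq' : q < T.card + 1 := hq'
    obtain ⟨d, rfl⟩ := Nat.exists_eq_add_of_le' hq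
    have e1 : insAt el 0 (T.card + 1) (d + 1 + 1) = el (d + 1) := insAt_of_lt _ _ _ (by omega)
    rw [e1]
    cases d with
    | zero =>
      refine ⟨T.card, ?_, ?_, ?_⟩
      · rw [zero_add, h.root]
        simp [IncTree.addRoot]
      · rw [insAt_new]
        exact .refl
      · rw [zero_add, h.root, hk _ (by omega) (by omega), hk', h.key_root]
    | succ d =>
      obtain ⟨v, h1, h2, h3⟩ := h.step (d + 1) (by omega) (by omega)
      refine ⟨v, hpar _ _ h1, ?_, ?_⟩
      · rw [insAt_of_lt _ _ _ (by omega)]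
        exact h2.mono hpar
      · have h4 := (h.lt _ _ h1).2
        have h5 := h.order.ne_zero (i := d + 1 + 1) (by omega) (by omega)
        rw [hk _ (by omega) (h.order.lt _ (by omega)), hk _ (by omega) (by omega), h3]
  · exact hk0.trans hk'.symm

end Preorder

end Nca

/-! ### The program for queries -/

namespace Nca

open RAM RAM.Prog RAM.Exp IncTree

/-- Computes the logarithm of the difference of the labels, and the corresponding power of two. -/
def logProg : Prog :=
  assign 21 (ld .lab (reg 4) - ld .lab (reg 3)) ⨾
  ite (reg 11 - reg 21)
    (assign 6 (ld .lg (reg 21)) ⨾ assign 22 (ld .pl (reg 21)))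
    (assign 6 (reg 10 / 2 + ld .lg (reg 21 / reg 11)) ⨾
      assign 22 (reg 11 * ld .pl (reg 21 / reg 11)))

/-- Doubles the block length if the blocks are not adjacent. -/
def adjProg : Prog :=
  ite ((ld .lab (reg 4) / reg 22 - ld .lab (reg 3) / reg 22) - 1) (assign 6 (reg 6 + 1)) skip

def lookProg : Prog :=
  assign 7 (ld .suf (reg 3 * reg 10 + reg 6)) ⨾
  assign 24 (ld .pre (reg 4 * reg 10 + reg 6)) ⨾
  ite (reg 7) (ite (keyGt (reg 24) (reg 7)) (assign 24 (reg 7)) skip) skip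

/-- Finds the last element with minimal key after the element in register `3` and up to the
element in register `4`. -/
def rmqProg : Prog := logProg ⨾ adjProg ⨾ lookProg

section

variable {M : Cfg} {s : State} {N J i j : ℕ} {el : ℕ → ℕ}

/-- Differences reach `4 ^ J` but the table has only `2 ^ J` entries, to stay within linear space.
From `2 ^ J` on, the logarithm of `d` is `J` plus that of `d / 2 ^ J`, which is again in the table.
-/
theorem runs_logProg {d u v : ℕ} (hu : s.reg 3 = u) (hv : s.reg 4 = v) (huA : u < M.A)
    (hvA : v < M.A) (hd : s.fld .lab v - s.fld .lab u = d) (h0 : 0 < d) (hdJ : d < 2 ^ (2 * J))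
    (h10 : s.reg 10 = 2 * J) (h11 : s.reg 11 = 2 ^ J) (hJA : 2 ^ J ≤ M.A) (hA : 2 * J < M.V)
    (hl : Logs (2 ^ J) s) :
    Runs M logProg s fun t s' => t ≤ 60 ∧ Same [6, 21, 22] [] s s' ∧
      s'.reg 6 = Nat.log 2 d ∧ s'.reg 22 = 2 ^ Nat.log 2 d := by
  refine .of_bdd fun hb => (Runs.straight (R := fun s' => Same [6, 21, 22] [] s s' ∧
      s'.reg 6 = Nat.log 2 d ∧ s'.reg 22 = 2 ^ Nat.log 2 d) (by decide) ?_).mono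
    fun t s' h => ⟨h.1.trans (by decide), h.2⟩
  have hdV : d < M.V := by
    have := hb.fld .lab v
    omega
  simp [logProg, swp, hu, hv, huA, hvA, hd, h10, h11]
  refine ⟨hdV, fun hlt => ?_, fun hge => ?_⟩
  · have h1 := hl d h0 (by omega)
    refine ⟨by omega, h1.1 ▸ hb.fld .lg d, by omega, h1.2 ▸ hb.fld .pl d, Same.refl.put.put.put,
      h1.1, h1.2⟩
  · have hge : 2 ^ J ≤ d := by omega
    have hp : 0 < 2 ^ J := by positivity
    have hq : 1 ≤ d / 2 ^ J := (Nat.one_le_div_iff hp).2 hge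
    have hq' : d / 2 ^ J < 2 ^ J := by
      rw [Nat.div_lt_iff_lt_mul hp, ← pow_add, ← two_mul]
      exact hdJ
    have h1 := hl _ hq hq'
    have hlog : Nat.log 2 (d / 2 ^ J) = Nat.log 2 d - J := Nat.log_div_base_pow 2 d J
    have hJ : J ≤ Nat.log 2 d := Nat.le_log_of_pow_le (by omega) hge
    have hlt : Nat.log 2 d < 2 * J := Nat.log_lt_of_lt_pow (by omega) hdJ
    have hpow : 2 ^ Nat.log 2 d ≤ d := Nat.pow_log_le_self 2 (by omega)
    have e : 2 ^ J * 2 ^ (Nat.log 2 d - J) = 2 ^ Nat.log 2 d := by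
      rw [← pow_add]
      congr 1
      omega
    rw [h1.1, h1.2, hlog, e]
    refine ⟨by omega, by omega, by omega, by omega, Same.refl.put.put.put, by omega⟩

theorem runs_rmqProg (h : Repr N J el s) (cap : Cap M N) (hij : i < j) (hj : j < N)
    (h3 : s.reg 3 = el i) (h4 : s.reg 4 = el j) :
    Runs M rmqProg s fun t s' => t ≤ 300 ∧ Same [6, 7, 21, 22, 24] [] s s' ∧
      ∃ p, LastMin el (key s) {q | i < q ∧ q ≤ j} p ∧ s'.reg 24 = el p := by
  have ho := h.order
  have hlen := cap.len
  have hAV := cap.hAV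
  have hei := ho.lt i (by omega)
  have hej := ho.lt j hj
  have hlab := h.mono i j hij hj
  have hlj := h.lab_lt j hj
  have hrows := cap.rows J h.pow_le
  have hJ := h.pow_le
  have hJA : 2 * J ≤ M.A := (Nat.le_mul_of_pos_left _ (by omega)).trans hrows
  obtain ⟨a, ha⟩ : ∃ a, a = labs s el := ⟨_, rfl⟩
  rw [← ha] at hlab hlj
  obtain ⟨k, hk⟩ : ∃ k, k = Nat.log 2 (a j - a i) := ⟨_, rfl⟩
  have hk1 : 2 ^ k ≤ a j - a i := hk ▸ Nat.pow_log_le_self 2 (by omega)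
  have hk2 : a j - a i < 2 ^ (k + 1) := hk ▸ Nat.lt_pow_succ_log_self (by omega) _
  have hkJ : k < 2 * J := by
    refine (Nat.pow_lt_pow_iff_right (a := 2) (by omega)).1 ?_
    omega
  have hadj := div_adjacent (x := a i) (y := a j) (k := k) (by omega) (by omega)
  refine .seq ((runs_logProg (d := a j - a i) h3 h4 (by omega) (by omega) (by rw [ha]; rfl)
    (by omega) (by omega) h.r10 h.r11 (by omega) (by omega) h.logs).mono ?_)
  rintro t₁ s₁ ⟨ht₁, hS₁, h6, h22⟩
  rw [← hk] at h6 h22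
  refine .seq ((Runs.straight (R := fun s' => Same [6] [] s₁ s' ∧
    ∃ k', s'.reg 6 = k' ∧ k' < 2 * J ∧ a j / 2 ^ k' = a i / 2 ^ k' + 1) (by decide) ?_).mono ?_)
  · have e3 : s₁.reg 3 = el i := (hS₁.1 3 (by decide)).trans h3
    have e4 : s₁.reg 4 = el j := (hS₁.1 4 (by decide)).trans h4
    have ei : s₁.fld .lab (el i) = a i := by rw [hS₁.2 _ (by decide), ha]; rfl
    have ej : s₁.fld .lab (el j) = a j := by rw [hS₁.2 _ (by decide), ha]; rfl
    simp only [adjProg, swp, safe_sub, safe_div, safe_ld, safe_reg, safe_ofNat, eval_sub, eval_div,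
      eval_ld, eval_reg, eval_ofNat, e3, e4, h22, ei, ej, h6, safe_add, eval_add, true_and,
      and_true, State.reg_put, if_true]
    refine ⟨by omega, fun hne => ⟨by omega, Same.refl.put, k + 1, rfl, ?_⟩, fun he =>
      ⟨.refl, k, rfl, hkJ, by omega⟩⟩
    have h' := (hadj.resolve_left (by omega)).2
    refine ⟨?_, h'⟩
    -- The tables must have a column `k + 1`. Beyond the last column all labels share block 0, so
    -- two different blocks cannot occur.
    by_contra hle
    have : a j / 2 ^ (k + 1) = 0 :=
      Nat.div_eq_of_lt (hlj.trans_le (Nat.pow_le_pow_right (by omega) (by omega)))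
    rw [this] at h'
    exact Nat.succ_ne_zero _ h'.symm
  rintro t₂ s₂ ⟨ht₂, hS₂, k', hk6, hk'J, hk'⟩
  have ht₂ : t₂ ≤ 60 := ht₂.trans (by decide)
  have hS : Same [6, 21, 22] [] s s₂ := hS₁.trans hS₂
  have hpre := h.pre j hj k' hk'J
  have hsuf := h.suf i (by omega) k' hk'J
  have hri := row_le hei hrows
  have hrj := row_le hej hrows
  obtain ⟨p, hp, hzp⟩ := lastMin_Ioc (ha ▸ h.mono) hij hj hk' ho (ha ▸ hsuf) (ha ▸ hpre)
  have hlt1 := sufOk_lt hsuf ho (by omega)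
  have hlt2 := preOk_lt hpre ho hj
  refine (Runs.straight (R := fun s' => Same [7, 24] [] s₂ s' ∧ s'.reg 24 = el p)
    (by decide) ?_).mono ?_
  · have e3 : s₂.reg 3 = el i := (hS.1 3 (by decide)).trans h3
    have e4 : s₂.reg 4 = el j := (hS.1 4 (by decide)).trans h4
    have e10 : s₂.reg 10 = 2 * J := (hS.1 10 (by decide)).trans h.r10
    have es := hS.2 .suf (by decide)
    have ep := hS.2 .pre (by decide)
    obtain ⟨z, hz⟩ : ∃ z, z = s.fld .suf (el i * (2 * J) + k') := ⟨_, rfl⟩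
    obtain ⟨z', hz'⟩ : ∃ z', z' = s.fld .pre (el j * (2 * J) + k') := ⟨_, rfl⟩
    rw [← hz, ← hz'] at hzp
    rw [← hz] at hlt1
    rw [← hz'] at hlt2
    have hkey : ∀ u v w x, key (((s₂.put u v).put w x)) = key s := fun _ _ _ _ => hS.key
    simp [lookProg, swp, e3, e4, e10, hk6, es, ep, safe_keyGt, ← hz, ← hz', eval_keyGt, hkey,
      -not_le]
    refine ⟨by omega, by omega, by omega, by omega, fun hz0 => ⟨⟨by omega, by omega⟩,
      fun hk => ⟨by omega, Same.refl.put.put.put, ?_⟩, fun hk => ⟨Same.refl.put.put, ?_⟩⟩,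
      fun hz0 => ⟨Same.refl.put.put, ?_⟩⟩
    · rw [← hzp, if_neg]
      rintro (h | h)
      · exact hz0 h
      · exact absurd h (not_le.2 hk)
    · rw [← hzp, if_pos (.inr hk)]
    · rw [← hzp, if_pos (.inl hz0)]
  · rintro t₃ s₃ ⟨ht₃, hS₃, h24⟩
    have ht₃ : t₃ ≤ 150 := ht₃.trans (by decide)
    exact ⟨by omega, hS.weaken.trans hS₃, p, hp, h24⟩

/-- This covers the writes that prepare an update: keys of elements not yet in the list are
unconstrained, and the sentinel may be lowered. -/
theorem Repr.congr {s' : State} {R : List ℕ} {F : List Field} (h : Repr N J el s)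
    (hS : Same R F s s') (h10 : 10 ∉ R := by decide) (h11 : 11 ∉ R := by decide)
    (hF : ∀ f ∈ [Field.nxt, .prv, .lab, .lg, .pl, .pre, .suf], f ∉ F := by decide)
    (hk0 : key s' 0 ≤ key s 0)
    (hk : ∀ e, 0 < e → e < N → key s' e = key s e ∧ key s 0 < key s e) : Repr N J el s' := by
  have hlab : labs s' el = labs s el := by
    ext q
    rw [labs, labs, hS.2 .lab (hF _ (by decide))]
  refine ⟨h.order, h.links.congr (hS.2 _ (hF _ (by decide))) (hS.2 _ (hF _ (by decide))),
    hlab ▸ h.mono, hlab ▸ h.lab_lt, (hS.1 10 h10).trans h.r10, (hS.1 11 h11).trans h.r11,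
    h.one_le, h.pow_le, fun q hq k hk' => ?_, fun q hq k hk' => ?_,
    h.logs.congr (hS.2 _ (hF _ (by decide))) (hS.2 _ (hF _ (by decide)))⟩
  · rw [hlab, hS.2 .pre (hF _ (by decide))]
    exact (h.pre q hq k hk').congr_key hq h.order hk0 hk
  · rw [hlab, hS.2 .suf (hF _ (by decide))]
    exact (h.suf q hq k hk').congr_key h.order hk0 hk

end

end Nca

/-! ### Characteristic ancestors from two range minima. -/

namespace Nca

open RAM RAM.Prog RAM.Exp IncTree

/-- The state of the machine represents the tree. -/
structure Inv (T : IncTree) (J : ℕ) (el : ℕ → ℕ) (s : State) : Prop where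
  repr : Repr (T.card + 1) J el s
  tree : Preorder T el (key s)
  par : ∀ u v, T.parent u = some v → s.fld .par (u + 1) = v + 1
  depth_le : ∀ e < T.card + 1, s.fld .dn e ≤ T.card ∧ s.fld .up e ≤ T.card

/-- Register 14 keeps the child towards the later node; the window for the second search runs from
the nearest common ancestor to the earlier node. -/
def moveProg : Prog :=
  assign 14 (reg 24) ⨾ assign 4 (reg 3) ⨾ assign 3 (ld .par (reg 24))

/-- The sum of both truncated differences is nonzero exactly for different registers. If the earlier
node is itself the nearest common ancestor, the window is empty and the answer is that node. -/
def againProg : Prog :=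
  ite ((reg 3 - reg 4) + (reg 4 - reg 3)) rmqProg (assign 24 (reg 3))

/-- Puts the arguments in preorder into registers `3` and `4`. -/
def sortProg : Prog :=
  assign 3 (reg 0 + 1) ⨾ assign 4 (reg 1 + 1) ⨾ assign 13 0 ⨾
  ite (ld .lab (reg 3) - ld .lab (reg 4))
    (assign 3 (reg 1 + 1) ⨾ assign 4 (reg 0 + 1) ⨾ assign 13 1) skip

def outProg : Prog :=
  assign 0 (reg 3 - 1) ⨾
  ite (reg 13) (assign 1 (reg 14 - 1) ⨾ assign 2 (reg 24 - 1))
    (assign 1 (reg 24 - 1) ⨾ assign 2 (reg 14 - 1))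

/-- Computes the characteristic ancestors of the nodes in registers `0` and `1`. -/
def caProg : Prog :=
  ite ((reg 0 - reg 1) + (reg 1 - reg 0))
    (sortProg ⨾ (rmqProg ⨾ moveProg ⨾ againProg) ⨾ outProg) (assign 2 (reg 0))

section

variable {M : Cfg} {s : State} {T : IncTree} {J i j x y : ℕ} {el : ℕ → ℕ}

theorem runs_ca_of_lt (h : Inv T J el s) (cap : Cap M (T.card + 1)) (hi : 1 ≤ i) (hij : i < j)
    (hj : j < T.card + 1) (h3 : s.reg 3 = el i) (h4 : s.reg 4 = el j) (hx : el i = x + 1)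
    (hy : el j = y + 1) :
    Runs M (rmqProg ⨾ moveProg ⨾ againProg) s fun t s' => t ≤ 700 ∧
      Same [3, 4, 6, 7, 14, 21, 22, 24] [] s s' ∧
      T.IsCA x y (s'.reg 3 - 1) (s'.reg 24 - 1) (s'.reg 14 - 1) := by
  have hlen := cap.len
  have hAV := cap.hAV
  refine .seq ((runs_rmqProg h.repr cap hij hj h3 h4).mono ?_)
  rintro t₁ s₁ ⟨ht₁, hS₁, p, hp, h24⟩
  obtain ⟨z, a, hz, hza, hnca, hpy⟩ := h.tree.lastMin_spec hi hij hj hx hy hp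
  have hlt := h.tree.lt z a hza
  have hpar : s₁.fld .par (z + 1) = a + 1 := by rw [hS₁.2 _ (by decide), h.par z a hza]
  have hxN := h.tree.order.lt i (by omega)
  refine .seq ((Runs.straight (R := fun s' => Same [3, 4, 14] [] s₁ s' ∧ s'.reg 14 = z + 1 ∧
    s'.reg 4 = x + 1 ∧ s'.reg 3 = a + 1) (by decide) ?_).mono ?_)
  · have e3 : s₁.reg 3 = x + 1 := by rw [hS₁.1 3 (by decide), h3, hx]
    have e24 : s₁.reg 24 = z + 1 := h24.trans hz
    simp [moveProg, swp, e3, e24, hpar]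
    exact ⟨by omega, by omega, by omega, by omega, Same.refl.put.put.put⟩
  rintro t₂ s₂ ⟨ht₂, hS₂, h14, h4', h3'⟩
  have ht₂ : t₂ ≤ 40 := ht₂.trans (by decide)
  have hS : Same [3, 4, 6, 7, 14, 21, 22, 24] [] s s₂ :=
    (hS₁.weaken (R' := [3, 4, 6, 7, 14, 21, 22, 24]) (F' := [])).trans hS₂
  have hcost : ((reg 3 - reg 4) + (reg 4 - reg 3) : Exp).cost = 7 := rfl
  refine Runs.ite (by decide) (by simp) (fun hne => ?_) fun he => ?_
  · simp only [eval_add, eval_sub, eval_reg, h3', h4'] at hne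
    obtain ⟨q, hq1, hqi, hq⟩ := h.tree.pos_lt_of_anc hi (by omega) hx hnca.1 (by omega)
    have hk : key s₂ = key s := hS.key
    have hr : Repr (T.card + 1) J el s₂ := h.repr.congr hS (by decide) (by decide) (by decide)
      (by rw [hk]) fun e h0 he => ⟨by rw [hk], h.tree.key_zero_lt h0 he⟩
    refine (runs_rmqProg hr cap hqi (by omega) (h3'.trans hq.symm) (h4'.trans hx.symm)).mono ?_
    rintro t₃ s₃ ⟨ht₃, hS₃, p', hp', h24'⟩
    rw [hk] at hp'
    obtain ⟨z', hz', hpx⟩ := h.tree.precedes_of_lastMin hq1 hqi (by omega) hq hx hnca.1 hp'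
    refine ⟨by omega, hS.trans hS₃, ?_⟩
    rw [hS₃.1 3 (by decide), hS₃.1 14 (by decide), h24', hz', h3', h14]
    exact ⟨hnca, hpx, hpy⟩
  · simp only [eval_add, eval_sub, eval_reg, h3', h4'] at he
    obtain rfl : x = a := by omega
    refine (Runs.straight (R := fun s' => Same [24] [] s₂ s' ∧ s'.reg 24 = x + 1)
      (by decide) ?_).mono ?_
    · simp [swp, h3']
      exact ⟨by omega, Same.refl.put⟩
    · rintro t₃ s₃ ⟨ht₃, hS₃, h24'⟩
      have ht₃ : t₃ ≤ 40 := ht₃.trans (by decide)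
      refine ⟨by omega, hS.trans hS₃, ?_⟩
      rw [hS₃.1 3 (by decide), hS₃.1 14 (by decide), h24', h3', h14]
      exact ⟨hnca, .inl ⟨rfl, rfl⟩, hpy⟩

theorem runs_caProg (h : Inv T J el s) (cap : Cap M (T.card + 1)) (hx : x < T.card)
    (hy : y < T.card) (h0 : s.reg 0 = x) (h1 : s.reg 1 = y) :
    Runs M caProg s fun t s' => t ≤ 1000 ∧
      Same [0, 1, 2, 3, 4, 6, 7, 13, 14, 21, 22, 24] [] s s' ∧
      T.IsCA x y (s'.reg 0) (s'.reg 1) (s'.reg 2) := by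
  have hlen := cap.len
  have hAV := cap.hAV
  have hcost : ((reg 0 - reg 1) + (reg 1 - reg 0) : Exp).cost = 7 := rfl
  refine Runs.ite (by decide) (by simp) (fun hne => ?_) fun he => ?_
  · simp only [eval_add, eval_sub, eval_reg, h0, h1] at hne
    obtain ⟨i, hi1, hi, hix⟩ := h.tree.exists_pos hx
    obtain ⟨j, hj1, hj, hjy⟩ := h.tree.exists_pos hy
    refine .seq ((Runs.straight (R := fun s' => Same [3, 4, 13] [] s s' ∧
      (i < j ∧ s'.reg 3 = x + 1 ∧ s'.reg 4 = y + 1 ∧ s'.reg 13 = 0 ∨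
        j < i ∧ s'.reg 3 = y + 1 ∧ s'.reg 4 = x + 1 ∧ s'.reg 13 = 1)) (by decide) ?_).mono ?_)
    · simp [sortProg, swp, h0, h1]
      refine ⟨by omega, by omega, by omega, ⟨by omega, by omega⟩, fun hlt => ⟨by omega, by omega,
        by omega, ?_, ?_⟩, fun hle => ⟨?_, ?_⟩⟩
      · exact Same.refl.put.put.put.put.put.put
      · by_contra hji
        rcases Nat.eq_or_lt_of_le (not_lt.1 hji) with rfl | hij
        · omega
        · have := h.repr.mono i j hij hj
          rw [labs, labs, hix, hjy] at this
          omega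
      · exact Same.refl.put.put.put
      · by_contra hij
        rcases Nat.eq_or_lt_of_le (not_lt.1 hij) with rfl | hji
        · omega
        · have := h.repr.mono j i hji hi
          rw [labs, labs, hix, hjy] at this
          omega
    rintro t₁ s₁ ⟨ht₁, hS₁, hcase⟩
    have ht₁ : t₁ ≤ 60 := ht₁.trans (by decide)
    have hk : key s₁ = key s := hS₁.key
    have hinv : Inv T J el s₁ := ⟨h.repr.congr hS₁ (by decide) (by decide) (by decide)
      (by rw [hk]) fun e h0 he => ⟨by rw [hk], h.tree.key_zero_lt h0 he⟩, hk ▸ h.tree,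
      by rw [hS₁.2 _ (by decide)]; exact h.par,
      by rw [hS₁.2 .dn (by decide), hS₁.2 .up (by decide)]; exact h.depth_le⟩
    refine .seq (Runs.mono (Q := fun t s' => t ≤ 700 ∧
      Same [3, 4, 6, 7, 14, 21, 22, 24] [] s₁ s' ∧
      (s'.reg 13 = 0 ∧ T.IsCA x y (s'.reg 3 - 1) (s'.reg 24 - 1) (s'.reg 14 - 1) ∨
        s'.reg 13 = 1 ∧ T.IsCA y x (s'.reg 3 - 1) (s'.reg 24 - 1) (s'.reg 14 - 1))) ?_ ?_)
    · rcases hcase with ⟨hij, e3, e4, e13⟩ | ⟨hji, e3, e4, e13⟩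
      · refine (runs_ca_of_lt hinv cap hi1 hij hj (e3.trans hix.symm) (e4.trans hjy.symm) hix
          hjy).mono fun t s' h' => ⟨h'.1, h'.2.1, .inl ⟨?_, h'.2.2⟩⟩
        rw [h'.2.1.1 13 (by decide), e13]
      · refine (runs_ca_of_lt hinv cap hj1 hji hi (e3.trans hjy.symm) (e4.trans hix.symm) hjy
          hix).mono fun t s' h' => ⟨h'.1, h'.2.1, .inr ⟨?_, h'.2.2⟩⟩
        rw [h'.2.1.1 13 (by decide), e13]
    rintro t₂ s₂ ⟨ht₂, hS₂, hca⟩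
    have hS : Same [0, 1, 2, 3, 4, 6, 7, 13, 14, 21, 22, 24] [] s s₂ :=
      (hS₁.weaken (R' := [0, 1, 2, 3, 4, 6, 7, 13, 14, 21, 22, 24]) (F' := [])).trans hS₂
    refine .of_bdd fun hb => (Runs.straight (R := fun s' => Same [0, 1, 2] [] s₂ s' ∧
      T.IsCA x y (s'.reg 0) (s'.reg 1) (s'.reg 2)) (by decide) ?_).mono ?_
    · have b3 := hb.1 3
      have b14 := hb.1 14
      have b24 := hb.1 24
      simp [outProg, swp]
      rcases hca with ⟨e13, hca⟩ | ⟨e13, hca⟩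
      · exact ⟨by omega, fun h => absurd e13 h, fun _ => ⟨by omega, by omega,
          Same.refl.put.put.put, hca⟩⟩
      · exact ⟨by omega, fun _ => ⟨by omega, by omega,
          Same.refl.put.put.put, hca.symm⟩, fun h => by omega⟩
    · rintro t₃ s₃ ⟨ht₃, hS₃, hca⟩
      have ht₃ : t₃ ≤ 60 := ht₃.trans (by decide)
      exact ⟨by omega, hS.trans hS₃, hca⟩
  · simp only [eval_add, eval_sub, eval_reg, h0, h1] at he
    obtain rfl : x = y := by omega
    refine (Runs.straight (R := fun s' => Same [2] [] s s' ∧ s'.reg 2 = x)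
      (by decide) ?_).mono ?_
    · simp [swp, h0]
      exact ⟨by omega, Same.refl.put⟩
    · rintro t₃ s₃ ⟨ht₃, hS₃, h2⟩
      have ht₃ : t₃ ≤ 60 := ht₃.trans (by decide)
      refine ⟨by omega, hS₃.weaken, ?_⟩
      rw [hS₃.1 0 (by decide), hS₃.1 1 (by decide), h2, h0, h1]
      exact isCA_self

end

end Nca

/-! ### The programs for updates -/

namespace Nca

open RAM RAM.Prog RAM.Exp IncTree

def leafStart : Prog :=
  assign 4 (reg 1 + 1) ⨾ assign 3 (reg 0 + 1) ⨾ sto .par (reg 4) (reg 3) ⨾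
    sto .dn (reg 4) (ld .dn (reg 3) + 1) ⨾ sto .up (reg 4) (ld .up (reg 3))

/-- Adds the node in register `1` as a leaf with the parent in register `0`. -/
def leafProg : Prog := leafStart ⨾ insertProg

/-- The old root is the successor of the sentinel. Counting the added roots in `up` keeps all stored
numbers nonnegative while the key of the sentinel decreases. -/
def rootStart : Prog :=
  assign 4 (reg 0 + 1) ⨾ assign 3 0 ⨾ sto .par (ld .nxt (reg 3)) (reg 4) ⨾
    sto .dn (reg 4) (ld .dn (reg 3)) ⨾ sto .up (reg 4) (ld .up (reg 3)) ⨾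
    sto .up (reg 3) (ld .up (reg 3) + 1)

/-- Adds the node in register `0` as a new root. -/
def rootProg : Prog := rootStart ⨾ insertProg

/-- Sets up the tables for the tree with the single node `0`. -/
def initProg : Prog := (assign 10 2 ⨾ assign 11 2 ⨾ sto .pl 1 1) ⨾ rootProg

/-- The potential of a state that represents a list of length `N`. -/
def statePot (L N : ℕ) (el : ℕ → ℕ) (s : State) : ℕ :=
  300000 * pot L (2 ^ (2 * (L + 1))) N (labs s el)

section

variable {M : Cfg} {s : State} {T : IncTree} {N J L x : ℕ} {el : ℕ → ℕ}

theorem one_le_sq (hL : N + 1 ≤ 2 ^ L) (hN : 0 < N) : 1 ≤ L * L := by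
  rcases Nat.eq_zero_or_pos L with rfl | h
  · rw [pow_zero] at hL
    omega
  · exact Nat.mul_pos h h

theorem runs_leafProg (h : Inv T J el s) (cap : Cap M (T.card + 1 + 1)) (hx : x < T.card)
    (h0 : s.reg 0 = x) (h1 : s.reg 1 = T.card) (hL : T.card + 1 + 1 ≤ 2 ^ L) :
    Runs M leafProg s fun t s' => ∃ J' el', Inv (T.addLeaf x T.card) J' el' s' ∧
      t + statePot L (T.card + 1 + 1) el' s' ≤ statePot L (T.card + 1) el s +
        500000 * (L * L) := by
  have hlen := cap.len
  have hAV := cap.hAV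
  have hLL := one_le_sq hL (by omega)
  obtain ⟨i, hi1, hi, hix⟩ := h.tree.exists_pos hx
  obtain ⟨hd, hu⟩ := h.depth_le (x + 1) (by omega)
  refine .seq ((Runs.straight (R := fun s' => Same [3, 4] [.par, .dn, .up] s s' ∧
    s'.reg 3 = x + 1 ∧ s'.reg 4 = T.card + 1 ∧
    (∀ e, s'.fld .par e = if e = T.card + 1 then x + 1 else s.fld .par e) ∧
    (∀ e, s'.fld .dn e = if e = T.card + 1 then s.fld .dn (x + 1) + 1 else s.fld .dn e) ∧
    ∀ e, s'.fld .up e = if e = T.card + 1 then s.fld .up (x + 1) else s.fld .up e)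
    (by decide) ?_).mono ?_)
  · simp [leafStart, swp, swp_sto, h0, h1]
    constructorm* _ ∧ _
    all_goals first
      | omega
      | exact Same.refl.put.put.setFld.setFld.setFld
  rintro t₁ s₁ ⟨ht₁, hS₁, h3, h4, hpar, hdn, hup⟩
  have ht₁ : t₁ ≤ 100 := ht₁.trans (by decide)
  have hold : ∀ e < T.card + 1, key s₁ e = key s e := by
    intro e he
    rw [key, key, hdn, hup, if_neg (by omega), if_neg (by omega)]
  have hnew : key s₁ (T.card + 1) = key s (x + 1) + 1 := by
    rw [key, key, hdn, hup, if_pos rfl, if_pos rfl]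
    push_cast
    ring
  have hr : Repr (T.card + 1) J el s₁ := h.repr.congr hS₁ (by decide) (by decide) (by decide)
    (hold 0 (by omega)).le fun e he0 he => ⟨hold e he, h.tree.key_zero_lt he0 he⟩
  refine (runs_insertProg hr cap hi (h3.trans hix.symm) h4
    (by rw [hix, hold _ (by omega), hnew]; omega) hL).mono ?_
  rintro t₂ s₂ ⟨J', hr', hf, ht₂⟩
  have fpar := hf .par (by decide)
  have fdn := hf .dn (by decide)
  have fup := hf .up (by decide)
  refine ⟨J', _, ⟨hr', ?_, ?_, ?_⟩, ?_⟩
  · rw [key_congr fdn fup]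
    exact h.tree.addLeaf hi1 hi hix hold hnew
  · intro u v huv
    rw [fpar, hpar]
    simp only [IncTree.addLeaf, Function.update_apply] at huv
    split_ifs at huv with hu
    · cases huv
      rw [if_pos (by omega)]
    · have := h.tree.lt u v huv
      rw [if_neg (by omega), h.par u v huv]
  · intro e he
    have he : e < T.card + 1 + 1 := he
    have hc : (T.addLeaf x T.card).card = T.card + 1 := rfl
    rw [fdn, fup, hdn, hup, hc]
    split_ifs with h'
    · omega
    · have := h.depth_le e (by omega)
      omega
  · have hlab : labs s₁ el = labs s el := by
      ext q
      rw [labs, labs, hS₁.2 .lab (by decide)]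
    rw [hlab] at ht₂
    simp only [statePot]
    omega

/-- Stated for lists instead of trees, since the initialization starts from the sentinel alone,
which represents no tree. -/
theorem runs_rootStart (h : Repr N J el s) (cap : Cap M (N + 1)) (hN : 0 < N)
    (hk : ∀ e, 0 < e → e < N → key s 0 < key s e) (h0 : s.reg 0 + 1 = N)
    (hd : s.fld .dn 0 < N) (hu : s.fld .up 0 < N) (hL : N + 1 ≤ 2 ^ L) :
    Runs M rootProg s fun t s' => ∃ J', Repr (N + 1) J' (insAt el 0 N) s' ∧
      (∀ e, s'.fld .par e = if e = s.fld .nxt 0 then N else s.fld .par e) ∧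
      (∀ e, s'.fld .dn e = if e = N then s.fld .dn 0 else s.fld .dn e) ∧
      (∀ e, s'.fld .up e = if e = 0 then s.fld .up 0 + 1 else if e = N then s.fld .up 0 else
        s.fld .up e) ∧
      t + statePot L (N + 1) (insAt el 0 N) s' ≤ statePot L N el s + 500000 * (L * L) := by
  have hlen := cap.len
  have hAV := cap.hAV
  have hLL := one_le_sq hL hN
  have hnx := h.links.nxt_lt h.order hN
  rw [h.order.zero] at hnx
  refine .seq ((Runs.straight (R := fun s' => Same [3, 4] [.par, .dn, .up] s s' ∧
    s'.reg 3 = 0 ∧ s'.reg 4 = N ∧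
    (∀ e, s'.fld .par e = if e = s.fld .nxt 0 then N else s.fld .par e) ∧
    (∀ e, s'.fld .dn e = if e = N then s.fld .dn 0 else s.fld .dn e) ∧
    ∀ e, s'.fld .up e = if e = 0 then s.fld .up 0 + 1 else if e = N then s.fld .up 0 else
        s.fld .up e) (by decide) ?_).mono ?_)
  · have hN0 : (0 : ℕ) ≠ N := by omega
    simp [rootStart, swp, swp_sto, h0, hN0]
    constructorm* _ ∧ _
    all_goals first
      | omega
      | exact Same.refl.put.put.setFld.setFld.setFld.setFld
  rintro t₁ s₁ ⟨ht₁, hS₁, h3, h4, hpar, hdn, hup⟩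
  have ht₁ : t₁ ≤ 150 := ht₁.trans (by decide)
  have hzero : key s₁ 0 + 1 = key s 0 := by
    rw [key, key, hdn, hup, if_neg (by omega), if_pos rfl]
    push_cast
    ring
  have hnew : key s₁ N = key s 0 := by
    rw [key, key, hdn, hup, if_pos rfl, if_neg (by omega), if_pos rfl]
  have hr : Repr N J el s₁ := h.congr hS₁ (by decide) (by decide) (by decide)
    (by omega) fun e he0 he => ⟨by
      rw [key, key, hdn, hup, if_neg (by omega), if_neg (by omega), if_neg (by omega)],
      hk e he0 he⟩
  refine (runs_insertProg hr cap hN (h3.trans h.order.zero.symm) h4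
    (by rw [h.order.zero, hnew]; omega) hL).mono ?_
  rintro t₂ s₂ ⟨J', hr', hf, ht₂⟩
  refine ⟨J', hr', ?_, ?_, ?_, ?_⟩
  · rwa [hf .par (by decide)]
  · rwa [hf .dn (by decide)]
  · rwa [hf .up (by decide)]
  · have hlab : labs s₁ el = labs s el := by
      ext q
      rw [labs, labs, hS₁.2 .lab (by decide)]
    rw [hlab] at ht₂
    simp only [statePot]
    omega

theorem runs_rootProg (h : Inv T J el s) (cap : Cap M (T.card + 1 + 1)) (h0 : s.reg 0 = T.card)
    (hL : T.card + 1 + 1 ≤ 2 ^ L) :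
    Runs M rootProg s fun t s' => ∃ J' el', Inv (T.addRoot T.card) J' el' s' ∧
      t + statePot L (T.card + 1 + 1) el' s' ≤ statePot L (T.card + 1) el s +
        500000 * (L * L) := by
  have hpos := h.tree.pos
  have hroot := h.tree.root_lt
  obtain ⟨hd, hu⟩ := h.depth_le 0 (by omega)
  have hnx : s.fld .nxt 0 = T.root + 1 := by
    rw [← h.tree.root, ← h.repr.links.nxt 0 (by omega), h.repr.order.zero]
  refine (runs_rootStart h.repr cap (by omega) (fun e h1 h2 => h.tree.key_zero_lt h1 h2)
    (by omega) (by omega) (by omega) hL).mono ?_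
  rintro t s' ⟨J', hr, hpar, hdn, hup, ht⟩
  refine ⟨J', _, ⟨hr, ?_, ?_, ?_⟩, ht⟩
  · refine h.tree.addRoot (fun e he0 he => ?_) ?_ ?_
    · rw [key, key, hdn, hup, if_neg (by omega), if_neg (by omega), if_neg (by omega)]
    · rw [key, key, hdn, hup, if_pos rfl, if_neg (by omega), if_pos rfl]
    · rw [key, key, hdn, hup, if_neg (by omega), if_pos rfl]
      push_cast
      ring
  · intro u v huv
    rw [hpar, hnx]
    simp only [IncTree.addRoot, Function.update_apply] at huv
    split_ifs at huv with hu
    · cases huv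
      rw [if_pos (by omega)]
    · rw [if_neg (by omega), h.par u v huv]
  · intro e he
    have he : e < T.card + 1 + 1 := he
    have hc : (T.addRoot T.card).card = T.card + 1 := rfl
    rw [hdn, hup, hc]
    split_ifs with h1 h2 h3
    all_goals first
      | omega
      | have := h.depth_le e (by omega)
        omega

/-- A memory of zeros is already a correct list of the sentinel alone, with label 0 and trivial
rows; only the power `2 ^ 0` in the table of logarithms has to be stored. -/
theorem repr_one (hmem : ∀ f, f ≠ .pl → ∀ i, s.fld f i = 0) (hpl : s.fld .pl 1 = 1)
    (h10 : s.reg 10 = 2) (h11 : s.reg 11 = 2) : Repr 1 1 id s := by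
  have hl : ∀ q, labs s id q = 0 := fun q => hmem _ (by decide) _
  refine ⟨⟨rfl, fun i hi => hi, fun i _ j _ h => h, fun e he => ⟨e, he, rfl⟩⟩,
    ⟨fun i hi => by omega, hmem _ (by decide) _, fun i hi => by omega, ?_⟩,
    fun p q hpq hq => by omega, fun q _ => by rw [hl]; norm_num, h10, h11, le_rfl, le_rfl,
    fun q hq k _ => ?_, fun q hq k _ => .inl ⟨?_, hmem _ (by decide) _⟩, fun i hi hi' => ?_⟩
  · rw [hmem _ (by decide)]
    exact Nat.one_pos
  · obtain rfl : q = 0 := by omega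
    refine ⟨0, ⟨⟨le_rfl, rfl⟩, fun r hr => ?_⟩, hmem _ (by decide) _⟩
    obtain rfl : r = 0 := Nat.le_zero.1 hr.1
    exact ⟨le_rfl, fun h => absurd h (lt_irrefl _)⟩
  · ext r
    simp only [sufSet, Set.mem_ofPred_eq, Set.mem_empty_iff_false, iff_false]
    omega
  · obtain rfl : i = 1 := by omega
    rw [hmem _ (by decide), hpl]
    simp

/-- The node 0 is created by adding a root to the empty list, as register 0 happens to hold its
name. The parent written for the successor `0` of the sentinel is never used. -/
theorem runs_initProg (cap : Cap M 2) (hL : 2 ≤ 2 ^ L) :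
    Runs M initProg State.zero fun t s' => ∃ J' el', Inv IncTree.single J' el' s' ∧
      t + statePot L 2 el' s' ≤ 300000 * pot L (2 ^ (2 * (L + 1))) 1 (fun _ => 0) +
        600000 * (L * L) := by
  have hlen := cap.len
  have hAV := cap.hAV
  have hLL := one_le_sq (N := 1) hL Nat.one_pos
  refine .seq ((Runs.straight (R := fun s' => s'.reg 10 = 2 ∧ s'.reg 11 = 2 ∧ s'.reg 0 = 0 ∧
    s'.fld .pl 1 = 1 ∧ ∀ f, f ≠ .pl → ∀ i, s'.fld f i = 0) (by decide) ?_).mono ?_)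
  · have h17 := M.hV
    simp [swp, swp_sto]
    refine ⟨by omega, by omega, by omega, rfl, fun f hf i => ?_⟩
    rw [State.fld_setFld_ne _ hf]
    rfl
  rintro t₁ s₁ ⟨ht₁, h10, h11, h0, hpl, hmem⟩
  have ht₁ : t₁ ≤ 100 := ht₁.trans (by decide)
  have hd := hmem .dn (by decide)
  have hu := hmem .up (by decide)
  have hr := repr_one hmem hpl h10 h11
  refine (runs_rootStart (N := 1) hr cap Nat.one_pos (fun e h1 h2 => by omega) (by omega)
    (by rw [hd]; omega) (by rw [hu]; omega) hL).mono ?_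
  rintro t₂ s₂ ⟨J', hr', hpar, hdn, hup, ht₂⟩
  refine ⟨J', _, ⟨hr', ⟨hr'.order, insAt_new .., le_rfl, rfl, fun u v h => (by cases h),
    fun i h1 h2 => ?_, ?_⟩, fun u v h => (by cases h), fun e he => ?_⟩, ?_⟩
  · have : i < 1 := h2
    omega
  · simp [key, hdn, hup, hd, hu, IncTree.single]
  · rw [hdn, hup, hd, hd, hu, hu]
    simp only [IncTree.single]
    split_ifs <;> omega
  · have hlab : labs s₁ id = fun _ => 0 := by
      ext q
      exact hmem .lab (by decide) _
    simp only [statePot, hlab, one_add_one_eq_two] at ht₂ ⊢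
    omega

end

end Nca

/-! ### The whole algorithm -/

namespace Nca

open RAM RAM.Prog RAM.Exp IncTree

def algorithm : NcaAlgorithm := ⟨initProg, leafProg, rootProg, caProg⟩

/-- The machine for trees with at most `n` nodes. -/
def machine (n : ℕ) : Cfg where
  -- With the stride 16, the memory size is `1600000 * (n * (1 + Nat.log 2 n))`, and `b` has the
  -- same factor, so that one constant serves for space, word length and time. The value of `V` is a
  -- power of 2 that exceeds all addresses and labels.
  A := 100000 * (n * (1 + Nat.log 2 n))
  V := 2 ^ (20 * (1 + Nat.log 2 n))
  b := 1600000 * (1 + Nat.log 2 n)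
  hV := le_trans (by norm_num) (Nat.pow_le_pow_right (n := 2) (by norm_num)
    (show 5 ≤ 20 * (1 + Nat.log 2 n) by omega))
  hb := by
    rw [← pow_mul]
    exact Nat.pow_le_pow_right (by norm_num) (by omega)

theorem succ_le_two_pow (n : ℕ) : n + 1 ≤ 2 ^ (1 + Nat.log 2 n) := by
  rw [add_comm 1]
  exact Nat.lt_pow_succ_log_self (by norm_num) n

/-- The list contains the sentinel besides the nodes, hence `n + 1`. -/
theorem cap_machine {n : ℕ} (hn : 1 ≤ n) : Cap (machine n) (n + 1) := by
  have hl := succ_le_two_pow n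
  obtain ⟨l, hl'⟩ : ∃ l, l = 1 + Nat.log 2 n := ⟨_, rfl⟩
  have hA : (machine n).A = 100000 * (n * l) := by rw [hl']; rfl
  have hV : (machine n).V = 2 ^ (20 * l) := by rw [hl']; rfl
  rw [← hl'] at hl
  have hl1 : 1 ≤ l := by omega
  have hnl : n ≤ n * l := Nat.le_mul_of_pos_right _ hl1
  refine ⟨by rw [hA]; omega, fun J hJ => ?_, ?_, ?_⟩
  · have hJl : J ≤ l + 1 := by
      refine (Nat.pow_le_pow_iff_right (a := 2) (by omega)).1 (hJ.trans ?_)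
      rw [pow_succ]
      omega
    rw [hA]
    calc (n + 1) * (2 * J) ≤ (2 * n) * (4 * l) := Nat.mul_le_mul (by omega) (by omega)
      _ = 8 * (n * l) := by ring
      _ ≤ _ := Nat.mul_le_mul_right _ (by norm_num)
  · rw [hA, hV]
    calc 100000 * (n * l) < 2 ^ 17 * (2 ^ l * 2 ^ l) :=
          Nat.mul_lt_mul_of_lt_of_le (by norm_num)
            (Nat.mul_le_mul (by omega) Nat.lt_two_pow_self.le) (by positivity)
      _ = 2 ^ (17 + (l + l)) := by rw [pow_add, pow_add]
      _ ≤ _ := Nat.pow_le_pow_right (by norm_num) (by omega)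
  · rw [hV]
    calc 16 * (n + 1) * (n + 1) ≤ 2 ^ 4 * 2 ^ l * 2 ^ l :=
          Nat.mul_le_mul (Nat.mul_le_mul (by norm_num) hl) hl
      _ = 2 ^ (4 + l + l) := by rw [pow_add, pow_add]
      _ ≤ _ := Nat.pow_le_pow_right (by norm_num) (by omega)

theorem card_le_foldl (os : List NcaOp) (T : IncTree) :
    T.card ≤ (os.foldl NcaOp.apply T).card := by
  induction os generalizing T with
  | nil => exact le_rfl
  | cons o os ih =>
    refine le_trans ?_ (ih _)
    cases o <;> simp [NcaOp.apply, IncTree.addLeaf, IncTree.addRoot]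

theorem pot_one (L Q : ℕ) : pot L Q 1 (fun _ => 0) = 0 := by
  refine Finset.sum_eq_zero fun i _ => ?_
  rw [Finset.sum_eq_zero, mul_zero]
  intro q _
  have h1 : cnt 1 (fun _ => 0) (i + 1) q ≤ 1 :=
    (Finset.card_filter_le _ _).trans (by simp)
  have h2 : 1 ≤ 2 ^ i := Nat.one_le_two_pow
  omega

section

variable {M : Cfg} {s s' : State} {T : IncTree} {J L n : ℕ} {el : ℕ → ℕ}

theorem Inv.congr {R : List ℕ} (h : Inv T J el s) (hS : Same R [] s s')
    (h10 : 10 ∉ R := by decide) (h11 : 11 ∉ R := by decide) : Inv T J el s' := by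
  have hk : key s' = key s := hS.key
  have hf := fun f => hS.2 f (List.not_mem_nil)
  refine ⟨h.repr.congr hS h10 h11 (fun f _ => List.not_mem_nil) (by rw [hk])
    fun e h0 he => ⟨by rw [hk], h.tree.key_zero_lt h0 he⟩, hk ▸ h.tree, ?_, ?_⟩
  · rw [hf]
    exact h.par
  · rw [hf, hf]
    exact h.depth_le

theorem statePot_congr {R : List ℕ} {N : ℕ} (hS : Same R [] s s') :
    statePot L N el s' = statePot L N el s := by
  have : labs s' el = labs s el := by
    ext q
    rw [labs, labs, hS.2 .lab (List.not_mem_nil)]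
  rw [statePot, statePot, this]

/-- The amortized bounds telescope: each update adds one node and is charged `500000 * (L * L)`,
each query is charged 1000 and leaves the potential unchanged. The same `L`, fixed by the final
size, is used throughout; the programs do not refer to it. -/
theorem serves (hL : n + 1 ≤ 2 ^ L) (cap : Cap M (n + 1)) (os : List NcaOp) (h : Inv T J el s)
    (hb : s.Bdd M.V) (hos : NcaOp.LegalSeq T os) (hn : (os.foldl NcaOp.apply T).card ≤ n) :
    ∃ t, algorithm.Serves (16 * M.A) M.b T s os t ∧
      t + 500000 * (L * L) * T.card ≤ statePot L (T.card + 1) el s +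
        500000 * (L * L) * (os.foldl NcaOp.apply T).card + 1000 * os.countP NcaOp.isQuery := by
  have hlen := cap.len
  have hAV := cap.hAV
  induction os generalizing T s J el with
  | nil => exact ⟨0, rfl, by simp⟩
  | cons o os ih =>
    obtain ⟨ho, hos⟩ := hos
    have hcard := (card_le_foldl os (o.apply T)).trans hn
    cases o with
    | addLeaf x y =>
      obtain ⟨hx, rfl⟩ := ho
      have hcard : T.card + 1 ≤ n := hcard
      have hS : Same [0, 1] [] s ((s.put 0 x).put 1 T.card) := Same.refl.put.put
      obtain ⟨t₁, s₁, he, hb₁, J', el', hinv, ht₁⟩ := runs_leafProg (h.congr hS)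
        (cap.mono (by omega)) hx (by simp) (by simp) (L := L) (by omega)
        ((hb.put (by omega)).put (by omega))
      obtain ⟨t₂, hserve, ht₂⟩ := ih hinv hb₁ hos hn
      refine ⟨t₁ + t₂, ⟨t₁, t₂, s₁, rfl, he, trivial, hserve⟩, ?_⟩
      rw [statePot_congr hS] at ht₁
      have hc : (T.addLeaf x T.card).card = T.card + 1 := rfl
      rw [hc, mul_add] at ht₂
      simp only [List.foldl_cons, List.countP_cons, NcaOp.isQuery, NcaOp.apply] at ht₂ ⊢
      simp only [Bool.false_eq_true, if_false, add_zero]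
      omega
    | addRoot y =>
      obtain rfl : y = T.card := ho
      have hcard : T.card + 1 ≤ n := hcard
      have hS : Same [0, 1] [] s (s.put 0 T.card) := Same.refl.put
      obtain ⟨t₁, s₁, he, hb₁, J', el', hinv, ht₁⟩ := runs_rootProg (h.congr hS)
        (cap.mono (by omega)) (by simp) (L := L) (by omega) (hb.put (by omega))
      obtain ⟨t₂, hserve, ht₂⟩ := ih hinv hb₁ hos hn
      refine ⟨t₁ + t₂, ⟨t₁, t₂, s₁, rfl, he, trivial, hserve⟩, ?_⟩
      rw [statePot_congr hS] at ht₁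
      have hc : (T.addRoot T.card).card = T.card + 1 := rfl
      rw [hc, mul_add] at ht₂
      simp only [List.foldl_cons, List.countP_cons, NcaOp.isQuery, NcaOp.apply] at ht₂ ⊢
      simp only [Bool.false_eq_true, if_false, add_zero]
      omega
    | ca x y =>
      obtain ⟨hx, hy⟩ := ho
      have hcard : T.card ≤ n := hcard
      have hS : Same [0, 1] [] s ((s.put 0 x).put 1 y) := Same.refl.put.put
      obtain ⟨t₁, s₁, he, hb₁, ht₁, hS₁, hca⟩ := runs_caProg (h.congr hS)
        (cap.mono (by omega)) hx hy (by simp) (by simp)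
        ((hb.put (by omega)).put (by omega))
      obtain ⟨t₂, hserve, ht₂⟩ := ih ((h.congr hS).congr hS₁) hb₁ hos hn
      refine ⟨t₁ + t₂, ⟨t₁, t₂, s₁, rfl, he, hca, hserve⟩, ?_⟩
      rw [statePot_congr hS₁, statePot_congr hS] at ht₂
      simp only [List.foldl_cons, List.countP_cons, NcaOp.isQuery, NcaOp.apply, if_true] at ht₂ ⊢
      omega

end

end Nca

open Nca in
/-- One algorithm, which does not know `n` in advance, processes every legal sequence of `m`
queries and `n - 1` updates in time `O(m + n log² n)` and space `O(n log n)`, on a random access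
machine with words of `O(log n)` bits. -/
theorem mainTheorem2 :
    ∃ (P : NcaAlgorithm) (C : ℕ), ∀ (os : List NcaOp) (n m : ℕ),
      NcaOp.LegalSeq IncTree.single os → n = NcaOp.numNodes os → m = NcaOp.numQueries os →
      ∃ t : ℕ, t ≤ C * (m + n * (1 + Nat.log 2 n) ^ 2) ∧
        P.Solves (C * (n * (1 + Nat.log 2 n))) (C * (1 + Nat.log 2 n)) os t := by
  refine ⟨algorithm, 1600000, fun os n m hos hn hm => ?_⟩
  have hn1 : 1 ≤ n := hn ▸ card_le_foldl os IncTree.single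
  have hL := succ_le_two_pow n
  have cap := cap_machine hn1
  have hA : 16 * (machine n).A = 1600000 * (n * (1 + Nat.log 2 n)) := by
    simp only [machine]
    ring
  have hzero : RAM.State.zero.Bdd (machine n).V := by
    have := (machine n).hV
    constructor <;> intro i <;> exact lt_of_lt_of_le (by norm_num : 0 < 17) this
  obtain ⟨t₁, s, he, hb, J, el, hinv, ht₁⟩ := runs_initProg (L := 1 + Nat.log 2 n)
    (cap.mono (by omega)) (by omega) hzero
  obtain ⟨t₂, hserve, ht₂⟩ := serves hL cap os hinv hb hos hn.ge
  refine ⟨t₁ + t₂, ?_, t₁, t₂, s, rfl, hA ▸ he, hA ▸ hserve⟩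
  have hf : (os.foldl NcaOp.apply IncTree.single).card = n := hn.symm
  have hq : os.countP NcaOp.isQuery = m := hm.symm
  have hc : IncTree.single.card = 1 := rfl
  rw [pot_one] at ht₁
  rw [hf, hq, hc, one_add_one_eq_two] at ht₂
  rw [pow_two]
  obtain ⟨S, hS⟩ : ∃ S, S = (1 + Nat.log 2 n) * (1 + Nat.log 2 n) := ⟨_, rfl⟩
  rw [← hS] at ht₁ ht₂ ⊢
  -- The cost of the initialization, a multiple of `S`, is absorbed by `n * S`.
  have h1 : S ≤ n * S := Nat.le_mul_of_pos_left _ hn1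
  have h2 : 500000 * S * n = 500000 * (n * S) := by ring
  omega
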